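/- Let $n\ge 2$ and $d\ge 1$ be integers. A growth function of type $n$ is a continuous increasing function $\omega:[0,\infty)\to[0,\infty)$ with $\omega(0)=0$ such that (i) for some $q\in(n,n+1)$ there is $C>0$ with $\omega(st)<Cs^{q}\omega(t)$ for all $s>1$, $t>0$, and (ii) for every real $r<n$ there is $C=C(r)>0$ with $\omega(st)<Cs^{r}\omega(t)$ for all $0<s<1$, $t>0$. A bounded domain $D\subset\mathbb{R}^d$ is a $C^{\omega}$ domain (for $\omega$ of type $n$) if there are constants $\delta\ge 0$, $R>0$ and $C$ such that for every $a\in\partial D$, after a shift sending $a$ to the origin and an orthogonal change of coordinates $x=(x',x_d)\in\mathbb{R}^{d-1}\times\mathbb{R}$, there is a $\delta$-Lipschitz function $A:\mathbb{R}^{d-1}\to\mathbb{R}$ with $D\cap Q=\{x\in Q: x_d>A(x')\}$, where $Q$ is the cube of side length $R$ centred at the origin with edges parallel to the new axes, and there is a polynomial $P$ of degree at most $n$ on $\mathbb{R}^{d-1}$ with $|A(x')-P(x')|\le C\,\omega(|x'|)$ for all $x=(x',x_d)\in Q$. A $C^{k}$-smooth homogeneous Calderón–Zygmund operator is the principal value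 operator $Tf(y)=\lim_{\varepsilon\to0+}\int_{|x-y|>\varepsilon}f(x)K(y-x)\,dx$ with kernel $K(x)=\Omega(x)/|x|^{d}$, $x\ne0$, where $\Omega$ is a (real- or complex-valued) function that is homogeneous of degree $0$, of class $C^{k}$ on $\mathbb{R}^d\setminus\{0\}$, and has zero integral over the unit sphere. For a domain $D$, the restricted operator is $T_Df=(Tf)\chi_D$. **Theorem.** Let $\omega$ be a growth function of type $n>1$, let $D\subset\mathbb{R}^d$ be a bounded $C^{\omega}$ domain, and let $T$ be a $C^{2n-1}$-smooth homogeneous Calderón–Zygmund operator with an even kernel $K$. Then the principal value $T_D\chi_D(x)$ exists for every $x\in D$, the function $T_D\chi_D$ is of class $C^n$ in $D$, and there is a constant $C>0$, independent of $x$, such that $$|\nabla^{n}T_D\chi_D(x)|\le C\,\frac{\omega(\rho(x))}{\rho(x)^{n+1}}\qquad\text{for all }x\in D,$$ where $\rho(x)=\operatorname{dist}(x,\partial D)$. -/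

import Mathlib

open Set Filter Topology MeasureTheory

noncomputable section

namespace CZDomain

/-- `ω : [0,∞) → [0,∞)` is a growth function of type `n`. Only the values of `ω` on `[0,∞)`
matter; there `ω ≥ 0` because `ω` is increasing and `ω 0 = 0`. The strict inequalities in the two
regularity properties are stated for `t > 0` (at `t = 0` both sides vanish); they force
`ω t > 0` for `t > 0`. -/
structure IsGrowthFunction (n : ℕ) (ω : ℝ → ℝ) : Prop where
  type_pos : 0 < n
  continuousOn : ContinuousOn ω (Ici 0)
  monotoneOn : MonotoneOn ω (Ici 0)
  map_zero : ω 0 = 0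
  /-- `ω t / t ^ q` is almost decreasing for some `q` with `n < q < n + 1`. -/
  almost_decreasing : ∃ q : ℝ, (n : ℝ) < q ∧ q < n + 1 ∧
    ∃ C : ℝ, 0 < C ∧ ∀ s t : ℝ, 1 < s → 0 < t → ω (s * t) < C * s ^ q * ω t
  /-- `ω t / t ^ r` is almost increasing for every `r < n`. -/
  almost_increasing : ∀ r : ℝ, r < n →
    ∃ C : ℝ, 0 < C ∧ ∀ s t : ℝ, 0 < s → s < 1 → 0 < t → ω (s * t) < C * s ^ r * ω t

/-- The first `m` coordinates `x'` of a point `x = (x', x_d)` of `ℝ^d`, where `d = m + 1`. -/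
def horizontal {m : ℕ} (x : EuclideanSpace ℝ (Fin (m + 1))) : EuclideanSpace ℝ (Fin m) :=
  WithLp.toLp 2 fun i => x i.castSucc

/-- The last coordinate `x_d` of a point `x = (x', x_d)` of `ℝ^d`, where `d = m + 1`. -/
def vertical {m : ℕ} (x : EuclideanSpace ℝ (Fin (m + 1))) : ℝ :=
  x (Fin.last m)

/-- The open cube in `ℝ^k` with centre `0`, side length `R` and edges parallel to the axes. -/
def cube (k : ℕ) (R : ℝ) : Set (EuclideanSpace ℝ (Fin k)) :=
  {x | ∀ i, |x i| < R / 2}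

/-- A bounded `C^ω` domain `D` of `ℝ^d`, `d = m + 1`, for a growth function `ω` of type `n`:
a bounded domain such that, with constants `δ`, `R`, `C` that do not depend on the boundary
point `a`, after a shift and a rotation (`x = a + U z`, with `U` orthogonal) that send `a` to the
origin, the part of `D` in the cube of side length `R` is the part of that cube strictly above
the graph of a `δ`-Lipschitz function `A`, and `A` differs from some polynomial of degree at
most `n` by at most `C ω(|x'|)` in the window. -/
structure IsCOmegaDomain (n : ℕ) (ω : ℝ → ℝ) {m : ℕ}
    (D : Set (EuclideanSpace ℝ (Fin (m + 1)))) : Prop where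
  isOpen : IsOpen D
  isConnected : IsConnected D
  isBounded : Bornology.IsBounded D
  boundary : ∃ (δ : NNReal) (R C : ℝ), 0 < R ∧ ∀ a ∈ frontier D,
    ∃ (U : EuclideanSpace ℝ (Fin (m + 1)) ≃ₗᵢ[ℝ] EuclideanSpace ℝ (Fin (m + 1)))
      (A : EuclideanSpace ℝ (Fin m) → ℝ) (P : MvPolynomial (Fin m) ℝ),
      LipschitzWith δ A ∧
      (∀ z ∈ cube (m + 1) R, a + U z ∈ D ↔ A (horizontal z) < vertical z) ∧
      P.totalDegree ≤ n ∧
      ∀ x' ∈ cube m R, |A x' - MvPolynomial.eval (fun i => x' i) P| ≤ C * ω ‖x'‖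

/-- `K` is a `C^k`-smooth homogeneous Calderón–Zygmund kernel on `ℝ^d`:
`K(x) = Ω(x) / |x|^d` for `x ≠ 0`, where `Ω` is homogeneous of degree `0`, of class `C^k` on
`ℝ^d ∖ {0}`, and has zero integral over the unit sphere with respect to surface measure. Kernels
may be complex-valued. The value `K 0` is irrelevant. -/
def IsCZKernel (k : ℕ) {d : ℕ} (K : EuclideanSpace ℝ (Fin d) → ℂ) : Prop :=
  ∃ Ω : EuclideanSpace ℝ (Fin d) → ℂ,
    (∀ (t : ℝ) (x : EuclideanSpace ℝ (Fin d)), 0 < t → x ≠ 0 → Ω (t • x) = Ω x) ∧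
    ContDiffOn ℝ k Ω {0}ᶜ ∧
    ∫ u : Metric.sphere (0 : EuclideanSpace ℝ (Fin d)) 1, Ω u
      ∂(volume : Measure (EuclideanSpace ℝ (Fin d))).toSphere = 0 ∧
    ∀ x, x ≠ 0 → K x = Ω x / (‖x‖ : ℂ) ^ d

/-- The truncated integral `∫_{|x - y| > ε} f(x) K(y - x) dx`. -/
def truncatedIntegral {d : ℕ} (K f : EuclideanSpace ℝ (Fin d) → ℂ) (ε : ℝ)
    (y : EuclideanSpace ℝ (Fin d)) : ℂ :=
  ∫ x in {x | ε < ‖x - y‖}, f x * K (y - x)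

/-- The principal value convolution operator `T f(y) = PV ∫ f(x) K(y - x) dx`, the limit of the
truncated integrals as `ε → 0+` (meaningful only where this limit exists). -/
def czOperator {d : ℕ} (K f : EuclideanSpace ℝ (Fin d) → ℂ)
    (y : EuclideanSpace ℝ (Fin d)) : ℂ :=
  limUnder (𝓝[>] (0 : ℝ)) fun ε => truncatedIntegral K f ε y

/-- The restricted operator `T_D f = (T f) χ_D`. -/
def restrictedOperator {d : ℕ} (K : EuclideanSpace ℝ (Fin d) → ℂ)
    (D : Set (EuclideanSpace ℝ (Fin d))) (f : EuclideanSpace ℝ (Fin d) → ℂ) :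
    EuclideanSpace ℝ (Fin d) → ℂ :=
  D.indicator (czOperator K f)

/-- The characteristic function `χ_D`. -/
def charFn {d : ℕ} (D : Set (EuclideanSpace ℝ (Fin d))) : EuclideanSpace ℝ (Fin d) → ℂ :=
  D.indicator fun _ => 1

end CZDomain

end

noncomputable section

namespace CZDomain

/-! Write d = m + 1. Since K has mean zero on spheres, multiplying it by a radial cutoff equal to 1
on D − D leaves the truncated integrals over D unchanged and makes the integral over {|y − x| > ε}
vanish. Hence T χ_D(x) = −∫ K(x − y) dy over the complement of D, with K cut off at a large
distance. The complement stays away from x, so this is as smooth as K, and n derivatives fall on the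
kernel (`MomentKernel.iteratedFDeriv_restrictedOperator_charFn`).

To estimate ∫ ∂ⁿK(x − y) dy over the complement, take a nearest boundary point, at distance ρ, as
origin. There the boundary is the graph of A = L + p + O(ω(|y|)), with L linear and p a polynomial
with terms of degree 2 to n only. The integral of ∂ⁿK over the half-space below L is zero
(`MomentKernel.integral_halfSpace`). Up to bounded far contributions only the layer between L and A
remains. On each vertical segment expand in the height (`norm_segment_integral_sub_le`). Replacing A
− L by p costs ω(|y|)(|y| + ρ)^(−(m+1+n)), which integrates to O(ω(ρ)/ρ^(n+1)) because ω grows no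
faster than a power q < n + 1. The Taylor remainder after n − 1 terms costs |p|ⁿ times a derivative
of order 2n − 1, that is |y|^(2n) (|y| + ρ)^(−(m+2n)), which is harmless; this is where the 2n − 1
derivatives are spent.

The Taylor terms are monomials y^γ times ∂^s K on the tangent hyperplane. Monomials of degree above
s are small enough as they stand. For degree at most s there is exact cancellation: y^γ ∂^s K has
integral zero over any hyperplane missing the pole (`MomentKernel.integral_hyperplane_monomial`). So
its integral near the origin is minus the one far away, which is bounded. Bounded quantities are
admissible because ω(ρ)/ρ^(n+1) is bounded below for bounded ρ.

The cancellation has two sources. By the divergence theorem and induction, ∂^s K is orthogonal on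
the sphere to homogeneous polynomials of degree s (`MomentKernel.fderiv_apply`). And an even
function of degree −d with mean zero on the sphere integrates to zero over hyperplanes missing the
origin (`integral_hyperplane_eq_zero`): by scaling and evenness the integral at height h is c/|h|,
while the integral over the slab 1 < |h| < 2 is, in polar coordinates, log 2 times the spherical
mean. -/

/-- Euclidean space of dimension `d`. -/
abbrev Sp (d : ℕ) := EuclideanSpace ℝ (Fin d)

/-! ### Homogeneous functions and polar coordinates -/

/-- Positive homogeneity of degree `a`. -/
def IsHomog {d : ℕ} (a : ℤ) (F : Sp d → ℂ) : Prop :=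
  ∀ t : ℝ, 0 < t → ∀ y, y ≠ 0 → F (t • y) = (t : ℂ) ^ a * F y

/-- The integral over the unit sphere. -/
def sphereIntegral {d : ℕ} (g : Sp d → ℂ) : ℂ :=
  ∫ u : Metric.sphere (0 : Sp d) 1, g u ∂(volume : Measure (Sp d)).toSphere

theorem integral_polar {m : ℕ} (F : Sp (m + 1) → ℂ) :
    ∫ y, F y = ∫ p : Metric.sphere (0 : Sp (m + 1)) 1 × Ioi (0 : ℝ), F (p.2.1 • p.1.1)
      ∂((volume : Measure (Sp (m + 1))).toSphere.prod (Measure.volumeIoiPow m)) := by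
  have h := ((volume : Measure (Sp (m + 1))).measurePreserving_homeomorphUnitSphereProd).symm
    (homeomorphUnitSphereProd (Sp (m + 1))).toMeasurableEquiv
  have h2 := h.integral_comp
    ((homeomorphUnitSphereProd (Sp (m + 1))).toMeasurableEquiv.symm.measurableEmbedding)
    (fun x => F x.1)
  rw [integral_subtype_comap (measurableSet_singleton _).compl F, restrict_compl_singleton] at h2
  rw [← h2]
  simp

theorem integrable_polar {m : ℕ} {F : Sp (m + 1) → ℂ} (hF : Integrable F) :
    Integrable (fun p : Metric.sphere (0 : Sp (m + 1)) 1 × Ioi (0 : ℝ) => F (p.2.1 • p.1.1))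
      ((volume : Measure (Sp (m + 1))).toSphere.prod (Measure.volumeIoiPow m)) := by
  have h := ((volume : Measure (Sp (m + 1))).measurePreserving_homeomorphUnitSphereProd).symm
    (homeomorphUnitSphereProd (Sp (m + 1))).toMeasurableEquiv
  have h2 := h.integrable_comp_emb
    ((homeomorphUnitSphereProd (Sp (m + 1))).toMeasurableEquiv.symm.measurableEmbedding)
    (g := fun x => F x.1)
  rw [← restrict_compl_singleton (μ := volume) (0 : Sp (m + 1)), ← IntegrableOn,
    integrableOn_iff_comap_subtypeVal (by measurability)] at hF
  have := h2.2 hF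
  simpa [Function.comp_def] using this

theorem integral_volumeIoiPow (m : ℕ) (ψ : ℝ → ℂ) :
    ∫ r : Ioi (0 : ℝ), ψ r ∂(Measure.volumeIoiPow m) = ∫ r in Ioi (0 : ℝ), (r : ℂ) ^ m * ψ r := by
  simp only [Measure.volumeIoiPow, ENNReal.ofReal]
  rw [integral_withDensity_eq_integral_smul,
        integral_subtype_comap measurableSet_Ioi fun a ↦ Real.toNNReal (a ^ m) • ψ a,
        setIntegral_congr_fun measurableSet_Ioi fun x hx ↦ ?_]
  · rw [NNReal.smul_def, Real.coe_toNNReal _ (pow_nonneg (le_of_lt hx) _)]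
    simp
  · exact (measurable_subtype_coe.pow_const _).real_toNNReal

/-- The Jacobian r^m against degree −(m+1) leaves dr/r. No integrability is required, since
integrals of products over product measures factor unconditionally; sharp radial cutoffs are
therefore allowed. -/
theorem integral_homog_mul_radial {m : ℕ} {g : Sp (m + 1) → ℂ} (hg : IsHomog (-(m + 1 : ℤ)) g)
    (ψ : ℝ → ℂ) :
    ∫ y, g y * ψ ‖y‖ = sphereIntegral g * ∫ r in Ioi (0 : ℝ), ψ r / r := by
  rw [integral_polar, sphereIntegral]
  have : (∫ r in Ioi (0 : ℝ), ψ r / r) =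
      ∫ r : Ioi (0 : ℝ), ((r : ℝ) : ℂ) ^ (-(m + 1 : ℤ)) * ψ r ∂(Measure.volumeIoiPow m) := by
    rw [integral_volumeIoiPow m fun r => (r : ℂ) ^ (-(m + 1 : ℤ)) * ψ r]
    refine setIntegral_congr_fun measurableSet_Ioi fun r hr => ?_
    have : (r : ℂ) ≠ 0 := by exact_mod_cast (ne_of_gt hr)
    rw [← mul_assoc, ← zpow_natCast, ← zpow_add₀ this]
    have e : ((m : ℤ) + -(m + 1 : ℤ)) = -1 := by ring
    rw [e, zpow_neg_one]
    field_simp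
  rw [this, ← integral_prod_mul]
  refine integral_congr_ae (Eventually.of_forall fun p => ?_)
  obtain ⟨⟨θ, hθ⟩, ⟨r, hr⟩⟩ := p
  have hn : ‖θ‖ = 1 := by simpa using hθ
  have h0 : θ ≠ 0 := by intro h; simp [h] at hn
  have hr' : (0 : ℝ) < r := hr
  simp only [hg r hr θ h0, norm_smul, hn, Real.norm_of_nonneg hr'.le, mul_one]
  ring

theorem IsHomog.mul {d : ℕ} {a b : ℤ} {F G : Sp d → ℂ} (hF : IsHomog a F) (hG : IsHomog b G) :
    IsHomog (a + b) fun y => F y * G y := by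
  intro t ht y hy
  have : (t : ℂ) ≠ 0 := by exact_mod_cast ht.ne'
  simp only [hF t ht y hy, hG t ht y hy, zpow_add₀ this]
  ring

theorem IsHomog.fderiv_apply {d : ℕ} {a : ℤ} {F : Sp d → ℂ} (hF : IsHomog a F)
    (hd : ∀ y, y ≠ 0 → DifferentiableAt ℝ F y) (v : Sp d) :
    IsHomog (a - 1) fun y => fderiv ℝ F y v := by
  intro t ht y hy
  have htc : (t : ℂ) ≠ 0 := by exact_mod_cast ht.ne'
  have hty : t • y ≠ 0 := smul_ne_zero ht.ne' hy
  have h1 : HasFDerivAt (fun z => F (t • z))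
      ((fderiv ℝ F (t • y)).comp (t • ContinuousLinearMap.id ℝ (Sp d))) y :=
    (hd _ hty).hasFDerivAt.comp y ((hasFDerivAt_id y).const_smul t)
  have h2 : HasFDerivAt (fun z => (t : ℂ) ^ a * F z) ((t : ℂ) ^ a • fderiv ℝ F y) y :=
    (hd y hy).hasFDerivAt.const_mul _
  have h3 : (fun z => F (t • z)) =ᶠ[𝓝 y] fun z => (t : ℂ) ^ a * F z := by
    filter_upwards [isOpen_compl_singleton.mem_nhds hy] with z hz
    exact hF t ht z hz
  have h4 := congrArg (fun L => L v) (h1.unique (h2.congr_of_eventuallyEq h3))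
  simp only [ContinuousLinearMap.comp_apply, _root_.smul_apply,
    ContinuousLinearMap.id_apply, map_smul, smul_eq_mul, Complex.real_smul] at h4
  rw [zpow_sub_one₀ htc, mul_right_comm, ← h4]
  field_simp

/-! ### The divergence theorem for homogeneous functions -/

/-- A smooth function of the squared radius, positive exactly on `(1, 4)`. -/
def annulusBump (s : ℝ) : ℝ := expNegInvGlue ((s - 1) * (4 - s))

theorem contDiff_annulusBump : ContDiff ℝ 1 annulusBump := by
  have : ContDiff ℝ 1 expNegInvGlue := expNegInvGlue.contDiff (n := 1)
  exact this.comp (by fun_prop)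

theorem annulusBump_eq_zero {s : ℝ} (h : s ≤ 1 ∨ 4 ≤ s) : annulusBump s = 0 := by
  refine expNegInvGlue.zero_of_nonpos ?_
  rcases h with h | h <;> nlinarith

theorem integral_annulusBump_ne_zero :
    ∫ r in Ioi (0 : ℝ), ((annulusBump (r ^ 2) : ℝ) : ℂ) / r ≠ 0 := by
  have e : ∀ r : ℝ, ((annulusBump (r ^ 2) : ℝ) : ℂ) / r = ((annulusBump (r ^ 2) / r : ℝ) : ℂ) := by
    intro r; push_cast; rfl
  simp_rw [e]
  rw [integral_complex_ofReal]
  refine Complex.ofReal_ne_zero.2 (ne_of_gt ?_)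
  have hcont : ContinuousOn (fun r : ℝ => annulusBump (r ^ 2) / r) (Icc 1 2) := by
    refine ContinuousOn.div ?_ continuousOn_id fun r hr => (lt_of_lt_of_le one_pos hr.1).ne'
    exact (contDiff_annulusBump.continuous.comp (by fun_prop)).continuousOn
  have hz : ∀ r ∈ Ioi (0 : ℝ), r ∉ Ioc (1 : ℝ) 2 → annulusBump (r ^ 2) / r = 0 := by
    intro r hr hr2
    have hr : 0 < r := hr
    rw [annulusBump_eq_zero, zero_div]
    simp only [mem_Ioc, not_and_or, not_le, not_lt] at hr2
    rcases hr2 with h | h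
    · left; nlinarith
    · right; nlinarith
  rw [setIntegral_eq_of_subset_of_forall_sdiff_eq_zero measurableSet_Ioi
    (s := Ioc 1 2) (fun r hr => lt_trans one_pos hr.1) (fun r hr => hz r hr.1 hr.2)]
  rw [← intervalIntegral.integral_of_le one_le_two]
  refine intervalIntegral.intervalIntegral_pos_of_pos_on ?_ ?_ one_lt_two
  · exact (hcont.mono (by rw [uIcc_of_le one_le_two])).intervalIntegrable
  · intro r hr
    refine div_pos (expNegInvGlue.pos_of_pos ?_) (lt_trans one_pos hr.1)
    have := hr.1; have := hr.2
    apply mul_pos <;> nlinarith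

/-- The integrand is the derivative of r ↦ `annulusBump (r ^ 2)`, which vanishes at 0 and at
infinity. This removes the term in which the cutoff is differentiated. -/
theorem integral_deriv_annulusBump :
    ∫ r in Ioi (0 : ℝ), ((2 * r ^ 2 * deriv annulusBump (r ^ 2) : ℝ) : ℂ) / r = 0 := by
  have hd : ∀ r : ℝ, HasDerivAt (fun r : ℝ => annulusBump (r ^ 2))
      (deriv annulusBump (r ^ 2) * (2 * r)) r := by
    intro r
    have h1 := ((contDiff_annulusBump.differentiable (by norm_num)) (r ^ 2)).hasDerivAt
    have h2 : HasDerivAt (fun r : ℝ => r ^ 2) (2 * r) r := by simpa using hasDerivAt_pow 2 r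
    exact HasDerivAt.comp (h₂ := annulusBump) (h := fun r : ℝ => r ^ 2) r h1 h2
  have h3 : ∫ r in Ioi (0 : ℝ), deriv (fun r : ℝ => annulusBump (r ^ 2)) r = 0 := by
    rw [HasCompactSupport.integral_Ioi_deriv_eq]
    · simp [annulusBump_eq_zero]
    · exact contDiff_annulusBump.comp (by fun_prop)
    · refine HasCompactSupport.intro (isCompact_Icc (a := -2) (b := 2)) fun x hx => ?_
      refine annulusBump_eq_zero (Or.inr ?_)
      simp only [mem_Icc, not_and_or, not_le] at hx
      rcases hx with h | h <;> nlinarith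
  have e : ∫ r in Ioi (0 : ℝ), ((2 * r ^ 2 * deriv annulusBump (r ^ 2) : ℝ) : ℂ) / r =
      ∫ r in Ioi (0 : ℝ), ((deriv (fun r : ℝ => annulusBump (r ^ 2)) r : ℝ) : ℂ) := by
    refine setIntegral_congr_fun measurableSet_Ioi fun r hr => ?_
    have : (r : ℂ) ≠ 0 := by exact_mod_cast (ne_of_gt hr)
    simp only [(hd r).deriv]
    push_cast
    field_simp
  rw [e, integral_complex_ofReal, h3, Complex.ofReal_zero]

theorem isHomog_inner_div_sq {d : ℕ} (v : Sp d) :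
    IsHomog (-1) fun y : Sp d => ((inner ℝ y v / ‖y‖ ^ 2 : ℝ) : ℂ) := by
  intro t ht y hy
  have hty : (t : ℂ) ≠ 0 := by exact_mod_cast ht.ne'
  have hy : (‖y‖ : ℂ) ≠ 0 := by exact_mod_cast (norm_ne_zero_iff.2 hy)
  simp only [real_inner_smul_left, norm_smul, Real.norm_of_nonneg ht.le]
  push_cast
  rw [zpow_neg_one]
  field_simp

/-- The divergence theorem for homogeneous functions: a derivative of a function that is
homogeneous of degree one minus the dimension has mean zero on the sphere. -/
theorem sphereIntegral_fderiv_eq_zero {m : ℕ} {H : Sp (m + 1) → ℂ} (hH : IsHomog (-(m : ℤ)) H)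
    (hC : ContDiffOn ℝ 1 H {0}ᶜ) (v : Sp (m + 1)) :
    sphereIntegral (fun y => fderiv ℝ H y v) = 0 := by
  have hd : ∀ y, y ≠ 0 → DifferentiableAt ℝ H y := fun y hy =>
    (hC.contDiffAt (isOpen_compl_singleton.mem_nhds hy)).differentiableAt (by norm_num)
  have hb : ContDiff ℝ 1 fun y : Sp (m + 1) => annulusBump (‖y‖ ^ 2) :=
    contDiff_annulusBump.comp (contDiff_norm_sq ℝ)
  set b : Sp (m + 1) → ℝ := fun y => annulusBump (‖y‖ ^ 2) with hbdef
  have hb0 : ∀ y, ‖y‖ ≤ 1 ∨ 2 ≤ ‖y‖ → b y = 0 := by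
    intro y hy
    refine annulusBump_eq_zero ?_
    rcases hy with h | h
    · left; nlinarith [norm_nonneg y]
    · right; nlinarith
  -- The bump vanishes on the unit ball, so the singularity of H at the origin disappears.
  have hbH : ContDiff ℝ 1 fun y => b y • H y := by
    rw [contDiff_iff_contDiffAt]
    intro y
    by_cases hy : y = 0
    · have : (fun y => b y • H y) =ᶠ[𝓝 y] fun _ => 0 := by
        filter_upwards [Metric.ball_mem_nhds y one_pos] with z hz
        rw [hb0 z (Or.inl _), zero_smul]
        subst hy
        simpa using (mem_ball_zero_iff.1 hz).le
      exact contDiffAt_const.congr_of_eventuallyEq this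
    · exact hb.contDiffAt.smul (hC.contDiffAt (isOpen_compl_singleton.mem_nhds hy))
  have hcs : HasCompactSupport fun y => b y • H y := by
    refine HasCompactSupport.intro (isCompact_closedBall (0 : Sp (m + 1)) 2) fun y hy => ?_
    rw [hb0 y (Or.inr _), zero_smul]
    simpa using (not_le.1 (fun h => hy (mem_closedBall_zero_iff.2 h))).le
  have hb'eq : ∀ y, fderiv ℝ b y v = deriv annulusBump (‖y‖ ^ 2) * (2 * inner ℝ y v) := by
    intro y
    have h1 := ((contDiff_annulusBump.differentiable (by norm_num)) (‖y‖ ^ 2)).hasDerivAt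
    have h2 := (hasStrictFDerivAt_norm_sq y).hasFDerivAt
    have h3 := (h1.comp_hasFDerivAt y h2).fderiv
    have h4 : (annulusBump ∘ fun y : Sp (m + 1) => ‖y‖ ^ 2) = b := rfl
    rw [h4] at h3
    rw [h3]
    simp
  have hint1 : Integrable fun y => b y • fderiv ℝ H y v := by
    refine Continuous.integrable_of_hasCompactSupport ?_ ?_
    · rw [continuous_iff_continuousAt]
      intro y
      by_cases hy : y = 0
      · have : (fun y => b y • fderiv ℝ H y v) =ᶠ[𝓝 y] fun _ => 0 := by
          filter_upwards [Metric.ball_mem_nhds y one_pos] with z hz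
          rw [hb0 z (Or.inl _), zero_smul]
          subst hy
          simpa using (mem_ball_zero_iff.1 hz).le
        exact continuousAt_const.congr this.symm
      · refine hb.continuous.continuousAt.smul ?_
        have := (hC.continuousOn_fderiv_of_isOpen isOpen_compl_singleton le_rfl).continuousAt
          (isOpen_compl_singleton.mem_nhds hy)
        exact this.clm_apply continuousAt_const
    · refine HasCompactSupport.intro (isCompact_closedBall (0 : Sp (m + 1)) 2) fun y hy => ?_
      rw [hb0 y (Or.inr _), zero_smul]
      simpa using (not_le.1 (fun h => hy (mem_closedBall_zero_iff.2 h))).le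
  have hprod : ∀ y, fderiv ℝ (fun y => b y • H y) y v =
      b y • fderiv ℝ H y v + fderiv ℝ b y v • H y := by
    intro y
    by_cases hy : y = 0
    · have h1 : (fun y => b y • H y) =ᶠ[𝓝 y] fun _ => 0 := by
        filter_upwards [Metric.ball_mem_nhds y one_pos] with z hz
        rw [hb0 z (Or.inl _), zero_smul]
        subst hy
        simpa using (mem_ball_zero_iff.1 hz).le
      rw [h1.fderiv_eq, hb'eq, hb0 y (Or.inl (by simp [hy]))]
      simp [hy]
    · have h1 := ((hb.differentiable (by norm_num) y).hasFDerivAt.smul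
        (hd y hy).hasFDerivAt).fderiv
      have h2 : (b • H) = fun y => b y • H y := rfl
      rw [← h2, h1]
      simp
  have hint0 : Integrable fun y => fderiv ℝ (fun y => b y • H y) y v := by
    refine Continuous.integrable_of_hasCompactSupport ?_ ?_
    · exact (hbH.continuous_fderiv (by norm_num)).clm_apply continuous_const
    · exact hcs.fderiv_apply (𝕜 := ℝ) v
  -- Integration by parts against the constant 1: a compactly supported derivative has integral
  -- zero.
  have hzero : ∫ y, fderiv ℝ (fun y => b y • H y) y v = 0 := by
    have := integral_mul_fderiv_eq_neg_fderiv_mul_of_integrable (𝕜 := ℂ) (μ := volume)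
      (f := fun _ : Sp (m + 1) => (1 : ℂ)) (g := fun y => b y • H y) (v := v)
      (by simp) (by simpa using hint0)
      (by simpa using hbH.continuous.integrable_of_hasCompactSupport hcs)
      (fun _ _ => differentiableAt_const _)
      (fun y _ => hbH.differentiable (by norm_num) y)
    simpa using this
  have hint2 : Integrable fun y => fderiv ℝ b y v • H y := by
    have := hint0.sub hint1
    refine this.congr (Eventually.of_forall fun y => ?_)
    simp only [Pi.sub_apply, hprod y]
    ring
  simp_rw [hprod] at hzero
  rw [integral_add hint1 hint2] at hzero
  have hA : ∫ y, b y • fderiv ℝ H y v = sphereIntegral (fun y => fderiv ℝ H y v) *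
      ∫ r in Ioi (0 : ℝ), ((annulusBump (r ^ 2) : ℝ) : ℂ) / r := by
    have hh : IsHomog (-(m + 1 : ℤ)) fun y => fderiv ℝ H y v := by
      have := hH.fderiv_apply hd v
      rwa [show (-(m : ℤ) - 1) = -(m + 1 : ℤ) by ring] at this
    rw [← integral_homog_mul_radial hh]
    refine integral_congr_ae (Eventually.of_forall fun y => ?_)
    simp only [b, Complex.real_smul]
    ring
  -- Here ∂_v b is ⟨y, v⟩/|y|², of degree −1, times the radial function 2r²b'(r²), so the integral
  -- is a spherical integral times `integral_deriv_annulusBump`.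
  have hB : ∫ y, fderiv ℝ b y v • H y = 0 := by
    have hh : IsHomog (-(m + 1 : ℤ)) fun y => H y * ((inner ℝ y v / ‖y‖ ^ 2 : ℝ) : ℂ) := by
      have := hH.mul (isHomog_inner_div_sq v)
      rwa [show (-(m : ℤ) + -1) = -(m + 1 : ℤ) by ring] at this
    have := integral_homog_mul_radial hh
      (fun r => ((2 * r ^ 2 * deriv annulusBump (r ^ 2) : ℝ) : ℂ))
    rw [integral_deriv_annulusBump, mul_zero] at this
    rw [← this]
    refine integral_congr_ae (Eventually.of_forall fun y => ?_)
    simp only [hb'eq, Complex.real_smul]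
    by_cases hy : y = 0
    · simp [hy]
    · have hy : (‖y‖ : ℂ) ≠ 0 := by exact_mod_cast (norm_ne_zero_iff.2 hy)
      push_cast
      field_simp
  rw [hA, hB, add_zero] at hzero
  exact (mul_eq_zero.1 hzero).resolve_right integral_annulusBump_ne_zero

/-! ### Horizontal and vertical coordinates, shears -/

/-- The point `(y, t)` of `ℝ^(m+1)`. -/
def emb {m : ℕ} (y : Sp m) (t : ℝ) : Sp (m + 1) :=
  WithLp.toLp 2 (Fin.snoc (α := fun _ => ℝ) (fun i => y i) t)

@[simp] theorem emb_castSucc {m : ℕ} (y : Sp m) (t : ℝ) (i : Fin m) :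
    emb y t i.castSucc = y i := by simp [emb]

@[simp] theorem emb_last {m : ℕ} (y : Sp m) (t : ℝ) : emb y t (Fin.last m) = t := by simp [emb]

@[simp] theorem horizontal_emb {m : ℕ} (y : Sp m) (t : ℝ) : horizontal (emb y t) = y := by
  ext i; simp [horizontal]

@[simp] theorem vertical_emb {m : ℕ} (y : Sp m) (t : ℝ) : vertical (emb y t) = t := by
  simp [vertical]

@[simp] theorem emb_horizontal_vertical {m : ℕ} (x : Sp (m + 1)) :
    emb (horizontal x) (vertical x) = x := by
  ext i
  refine Fin.lastCases ?_ (fun i => ?_) i <;> simp [horizontal, vertical]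

theorem norm_sq_emb {m : ℕ} (y : Sp m) (t : ℝ) : ‖emb y t‖ ^ 2 = ‖y‖ ^ 2 + t ^ 2 := by
  simp [EuclideanSpace.norm_sq_eq, Fin.sum_univ_castSucc]

theorem norm_le_norm_emb {m : ℕ} (y : Sp m) (t : ℝ) : ‖y‖ ≤ ‖emb y t‖ := by
  refine le_of_sq_le_sq ?_ (norm_nonneg _)
  rw [norm_sq_emb]; nlinarith [sq_nonneg t]

theorem abs_le_norm_emb {m : ℕ} (y : Sp m) (t : ℝ) : |t| ≤ ‖emb y t‖ := by
  refine abs_le_of_sq_le_sq ?_ (norm_nonneg _)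
  rw [norm_sq_emb]; nlinarith [sq_nonneg ‖y‖]

theorem norm_emb_le {m : ℕ} (y : Sp m) (t : ℝ) : ‖emb y t‖ ≤ ‖y‖ + |t| := by
  refine le_of_sq_le_sq ?_ (by positivity)
  rw [norm_sq_emb]; nlinarith [mul_nonneg (norm_nonneg y) (abs_nonneg t), sq_abs t]

theorem emb_add {m : ℕ} (y z : Sp m) (s t : ℝ) : emb (y + z) (s + t) = emb y s + emb z t := by
  ext i
  refine Fin.lastCases ?_ (fun i => ?_) i <;> simp

theorem emb_smul {m : ℕ} (c : ℝ) (y : Sp m) (t : ℝ) : emb (c • y) (c * t) = c • emb y t := by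
  ext i
  refine Fin.lastCases ?_ (fun i => ?_) i <;> simp

theorem emb_sub {m : ℕ} (y z : Sp m) (s t : ℝ) : emb (y - z) (s - t) = emb y s - emb z t := by
  ext i
  refine Fin.lastCases ?_ (fun i => ?_) i <;> simp

theorem emb_neg {m : ℕ} (y : Sp m) (t : ℝ) : emb (-y) (-t) = -emb y t := by
  ext i
  refine Fin.lastCases ?_ (fun i => ?_) i <;> simp

/-- The splitting `ℝ^m × ℝ → ℝ^(m+1)` as a continuous linear map. -/
def embL (m : ℕ) : Sp m × ℝ →L[ℝ] Sp (m + 1) :=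
  LinearMap.toContinuousLinearMap
    { toFun := fun p => emb p.1 p.2
      map_add' := fun p q => emb_add p.1 q.1 p.2 q.2
      map_smul' := fun c p => emb_smul c p.1 p.2 }

@[simp] theorem embL_apply {m : ℕ} (p : Sp m × ℝ) : embL m p = emb p.1 p.2 := rfl

/-- The projection `x ↦ x'` as a continuous linear map. -/
def horizontalL (m : ℕ) : Sp (m + 1) →L[ℝ] Sp m :=
  LinearMap.toContinuousLinearMap
    { toFun := horizontal
      map_add' := fun x y => by ext i; simp [horizontal]
      map_smul' := fun c x => by ext i; simp [horizontal] }

@[simp] theorem horizontalL_apply {m : ℕ} (x : Sp (m + 1)) : horizontalL m x = horizontal x := rfl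

/-- The last coordinate as a continuous linear functional. -/
def verticalL (m : ℕ) : Sp (m + 1) →L[ℝ] ℝ :=
  LinearMap.toContinuousLinearMap
    { toFun := vertical
      map_add' := fun x y => by simp [vertical]
      map_smul' := fun c x => by simp [vertical] }

@[simp] theorem verticalL_apply {m : ℕ} (x : Sp (m + 1)) : verticalL m x = vertical x := rfl

theorem continuous_horizontal {m : ℕ} : Continuous (horizontal (m := m)) :=
  (horizontalL m).continuous

theorem continuous_vertical {m : ℕ} : Continuous (vertical (m := m)) :=
  (verticalL m).continuous

theorem continuous_emb {m : ℕ} : Continuous fun p : Sp m × ℝ => emb p.1 p.2 := (embL m).continuous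

/-- The splitting `ℝ^m × ℝ ≃ ℝ^(m+1)` as a homeomorphism. -/
def embHomeo (m : ℕ) : Sp m × ℝ ≃ₜ Sp (m + 1) where
  toFun p := emb p.1 p.2
  invFun x := (horizontal x, vertical x)
  left_inv p := by simp
  right_inv x := by simp
  continuous_toFun := continuous_emb
  continuous_invFun := continuous_horizontal.prodMk continuous_vertical

theorem measurableEmbedding_emb {m : ℕ} : MeasurableEmbedding fun p : Sp m × ℝ => emb p.1 p.2 :=
  (embHomeo m).measurableEmbedding

theorem measurePreserving_emb {m : ℕ} : MeasurePreserving fun p : Sp m × ℝ => emb p.1 p.2 := by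
  have h1 : MeasurePreserving (Prod.map (WithLp.ofLp : Sp m → Fin m → ℝ) (id : ℝ → ℝ)) :=
    (PiLp.volume_preserving_ofLp (Fin m)).prod (MeasurePreserving.id volume)
  have h2 : MeasurePreserving (Prod.swap : (Fin m → ℝ) × ℝ → ℝ × (Fin m → ℝ)) :=
    Measure.measurePreserving_swap
  have h3 := (volume_preserving_piFinSuccAbove (fun _ : Fin (m + 1) => ℝ) (Fin.last m)).symm
  have h4 := PiLp.volume_preserving_toLp (Fin (m + 1))
  have h := h4.comp (h3.comp (h2.comp h1))
  convert h using 1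
  funext p
  ext i
  refine Fin.lastCases ?_ (fun i => ?_) i
  · simp [MeasurableEquiv.piFinSuccAbove, Fin.insertNthEquiv]
  · simp [MeasurableEquiv.piFinSuccAbove, Fin.insertNthEquiv]

theorem integral_emb {m : ℕ} (F : Sp (m + 1) → ℂ) :
    ∫ p : Sp m × ℝ, F (emb p.1 p.2) = ∫ x, F x :=
  measurePreserving_emb.integral_comp measurableEmbedding_emb F

theorem integrable_emb_iff {m : ℕ} {F : Sp (m + 1) → ℂ} :
    Integrable (fun p : Sp m × ℝ => F (emb p.1 p.2)) ↔ Integrable F :=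
  measurePreserving_emb.integrable_comp_emb measurableEmbedding_emb

/-- The shear `(y, h) ↦ (y, L y + h)` preserves Lebesgue measure. -/
theorem measurePreserving_shear {m : ℕ} {L : Sp m → ℝ} (hL : Continuous L) :
    MeasurePreserving (fun p : Sp m × ℝ => (p.1, L p.1 + p.2)) := by
  refine (MeasurePreserving.id (volume : Measure (Sp m))).skew_product (g := fun y h => L y + h)
    ?_ ?_
  · exact ((hL.comp continuous_fst).add continuous_snd).measurable
  · exact Eventually.of_forall fun y => (measurePreserving_add_left volume (L y)).map_eq

theorem measurableEmbedding_shear {m : ℕ} {L : Sp m → ℝ} (hL : Continuous L) :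
    MeasurableEmbedding (fun p : Sp m × ℝ => (p.1, L p.1 + p.2)) := by
  let e : Sp m × ℝ ≃ₜ Sp m × ℝ :=
    { toFun := fun p => (p.1, L p.1 + p.2)
      invFun := fun p => (p.1, p.2 - L p.1)
      left_inv := fun p => by simp
      right_inv := fun p => by simp
      continuous_toFun := by fun_prop
      continuous_invFun := by fun_prop }
  exact e.measurableEmbedding

theorem integral_emb_shear {m : ℕ} {L : Sp m → ℝ} (hL : Continuous L) (F : Sp (m + 1) → ℂ) :
    ∫ p : Sp m × ℝ, F (emb p.1 (L p.1 + p.2)) = ∫ x, F x := by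
  rw [← integral_emb F]
  exact (measurePreserving_shear hL).integral_comp (measurableEmbedding_shear hL)
    (fun p : Sp m × ℝ => F (emb p.1 p.2))

theorem integrable_emb_shear_iff {m : ℕ} {L : Sp m → ℝ} (hL : Continuous L) {F : Sp (m + 1) → ℂ} :
    Integrable (fun p : Sp m × ℝ => F (emb p.1 (L p.1 + p.2))) ↔ Integrable F := by
  rw [← integrable_emb_iff (F := F)]
  exact (measurePreserving_shear hL).integrable_comp_emb (measurableEmbedding_shear hL)
    (g := fun p : Sp m × ℝ => F (emb p.1 p.2))

/-! ### Moment conditions for derivatives of the kernel -/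

/-- Iterated directional derivatives. -/
def dirD {d : ℕ} : List (Sp d) → (Sp d → ℂ) → Sp d → ℂ
  | [], F => F
  | v :: vs, F => fun y => fderiv ℝ (dirD vs F) y v

/-- A kernel on `ℝ^(m+1)` of class `C^N` off the origin that is homogeneous of degree
`-(m+1) - s`, has the parity of `s`, and is orthogonal on the sphere to the smooth homogeneous
functions (that is, polynomials) of degree `s`. -/
structure MomentKernel {m : ℕ} (N s : ℕ) (F : Sp (m + 1) → ℂ) : Prop where
  contDiffOn : ContDiffOn ℝ N F {0}ᶜ
  homog : IsHomog (-(m + 1 + s : ℤ)) F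
  parity : ∀ y, y ≠ 0 → F (-y) = (-1) ^ s * F y
  moment : ∀ q : Sp (m + 1) → ℂ, ContDiff ℝ (⊤ : ℕ∞) q →
    (∀ t : ℝ, t ≠ 0 → ∀ y, q (t • y) = (t : ℂ) ^ s * q y) →
    sphereIntegral (fun y => F y * q y) = 0

theorem integrable_sphere {d : ℕ} {g : Sp d → ℂ} (hg : ContinuousOn g {0}ᶜ) :
    Integrable (fun u : Metric.sphere (0 : Sp d) 1 => g u)
      (volume : Measure (Sp d)).toSphere := by
  have : Continuous fun u : Metric.sphere (0 : Sp d) 1 => g u := by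
    refine hg.comp_continuous continuous_subtype_val fun u => ?_
    intro h
    have := u.2
    simp only [mem_singleton_iff] at h
    simp [h] at this
  exact this.integrable_of_hasCompactSupport (HasCompactSupport.of_compactSpace _)

/-- For q of degree s + 1 the product F q has degree −m, so ∂_v(F q) has mean zero on the sphere. By
Leibniz this mean is that of (∂_v F) q plus that of F ∂_v q, and the latter vanishes because ∂_v q
has degree s. -/
theorem MomentKernel.fderiv_apply {m N s : ℕ} {F : Sp (m + 1) → ℂ} (hF : MomentKernel (N + 1) s F)
    (v : Sp (m + 1)) : MomentKernel N (s + 1) fun y => fderiv ℝ F y v := by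
  have hd : ∀ y, y ≠ 0 → DifferentiableAt ℝ F y := fun y hy =>
    (hF.contDiffOn.contDiffAt (isOpen_compl_singleton.mem_nhds hy)).differentiableAt
      (by exact_mod_cast Nat.succ_ne_zero N)
  have hcd : ContDiffOn ℝ N (fun y => fderiv ℝ F y v) {0}ᶜ :=
    (hF.contDiffOn.fderiv_of_isOpen isOpen_compl_singleton (by norm_cast)).clm_apply
      contDiffOn_const
  refine ⟨hcd, ?_, ?_, ?_⟩
  · have := hF.homog.fderiv_apply hd v
    convert this using 1
    push_cast; ring
  · intro y hy
    have h1 : HasFDerivAt (fun z => F (-z))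
        ((fderiv ℝ F (-y)).comp (-ContinuousLinearMap.id ℝ (Sp (m + 1)))) y :=
      (hd _ (neg_ne_zero.2 hy)).hasFDerivAt.comp y (hasFDerivAt_id y).neg
    have h2 : HasFDerivAt (fun z => (-1 : ℂ) ^ s * F z) ((-1 : ℂ) ^ s • fderiv ℝ F y) y :=
      (hd y hy).hasFDerivAt.const_mul _
    have h3 : (fun z => F (-z)) =ᶠ[𝓝 y] fun z => (-1 : ℂ) ^ s * F z := by
      filter_upwards [isOpen_compl_singleton.mem_nhds hy] with z hz
      exact hF.parity z hz
    have h4 := congrArg (fun L => L v) (h1.unique (h2.congr_of_eventuallyEq h3))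
    simp only [ContinuousLinearMap.comp_apply, _root_.neg_apply, ContinuousLinearMap.id_apply,
      map_neg, _root_.smul_apply, smul_eq_mul] at h4
    rw [pow_succ, mul_assoc, mul_comm (-1 : ℂ), ← mul_assoc, ← h4]
    ring
  · intro q hq hqh
    have hq1 : ∀ y, DifferentiableAt ℝ q y := fun y => hq.differentiable (by simp) y
    have hq' : ContDiff ℝ (⊤ : ℕ∞) fun y => fderiv ℝ q y v :=
      (hq.fderiv_right (m := (⊤ : ℕ∞)) (by norm_cast)).clm_apply contDiff_const
    have hq'h : ∀ t : ℝ, t ≠ 0 → ∀ y, fderiv ℝ q (t • y) v = (t : ℂ) ^ s * fderiv ℝ q y v := by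
      intro t ht y
      have htc : (t : ℂ) ≠ 0 := by exact_mod_cast ht
      have h1 : HasFDerivAt (fun z => q (t • z))
          ((fderiv ℝ q (t • y)).comp (t • ContinuousLinearMap.id ℝ (Sp (m + 1)))) y :=
        (hq1 _).hasFDerivAt.comp y ((hasFDerivAt_id y).const_smul t)
      have h2 : HasFDerivAt (fun z => (t : ℂ) ^ (s + 1) * q z)
          ((t : ℂ) ^ (s + 1) • fderiv ℝ q y) y := (hq1 y).hasFDerivAt.const_mul _
      have h3 : (fun z => q (t • z)) = fun z => (t : ℂ) ^ (s + 1) * q z := funext (hqh t ht)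
      rw [h3] at h1
      have h4 := congrArg (fun L => L v) (h1.unique h2)
      simp only [ContinuousLinearMap.comp_apply, _root_.smul_apply,
        ContinuousLinearMap.id_apply, map_smul, smul_eq_mul, Complex.real_smul] at h4
      apply mul_left_cancel₀ htc
      rw [h4]; ring
    have hFq : sphereIntegral (fun y => fderiv ℝ (fun y => F y * q y) y v) = 0 := by
      refine sphereIntegral_fderiv_eq_zero ?_ ?_ v
      · have : IsHomog ((s + 1 : ℕ) : ℤ) q := fun t ht y _ => by
          rw [hqh t ht.ne' y, zpow_natCast]
        have h := hF.homog.mul this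
        have e : -(m + 1 + s : ℤ) + ((s + 1 : ℕ) : ℤ) = -(m : ℤ) := by push_cast; ring
        rwa [e] at h
      · exact (hF.contDiffOn.of_le (by norm_cast; omega)).mul
          (hq.contDiffOn.of_le (by norm_cast))
    have h0 := hF.moment _ hq' hq'h
    rw [sphereIntegral] at hFq h0 ⊢
    have e : ∀ u : Metric.sphere (0 : Sp (m + 1)) 1,
        fderiv ℝ (fun y => F y * q y) (u : Sp (m + 1)) v =
          fderiv ℝ F (u : Sp (m + 1)) v * q u + F u * fderiv ℝ q (u : Sp (m + 1)) v := by
      intro u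
      have hu : (u : Sp (m + 1)) ≠ 0 := by
        intro h
        have := u.2
        simp [h] at this
      have h1 := ((hd _ hu).hasFDerivAt.mul (hq1 u).hasFDerivAt).fderiv
      have h2 : (F * q) = fun y => F y * q y := rfl
      rw [← h2, h1]
      simp
      ring
    simp_rw [e] at hFq
    rw [integral_add, h0, add_zero] at hFq
    · exact hFq
    · exact integrable_sphere (g := fun y => fderiv ℝ F y v * q y)
        (hcd.continuousOn.mul hq.continuous.continuousOn)
    · exact integrable_sphere (g := fun y => F y * fderiv ℝ q y v)
        (hF.contDiffOn.continuousOn.mul hq'.continuous.continuousOn)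

theorem MomentKernel.dirD {m : ℕ} {K : Sp (m + 1) → ℂ} (vs : List (Sp (m + 1))) {N s : ℕ}
    (hK : MomentKernel (N + vs.length) s K) : MomentKernel N (s + vs.length) (dirD vs K) := by
  induction vs generalizing N with
  | nil => exact hK
  | cons v vs ih =>
    have h1 : MomentKernel (N + 1) (s + vs.length) (CZDomain.dirD vs K) := ih (by
      have : N + (v :: vs).length = N + 1 + vs.length := by simp; ring
      rwa [this] at hK)
    exact h1.fderiv_apply v

theorem IsHomog.exists_norm_le {d : ℕ} {a : ℤ} {g : Sp d → ℂ} (hg : IsHomog a g)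
    (hc : ContinuousOn g {0}ᶜ) : ∃ C, 0 ≤ C ∧ ∀ y, y ≠ 0 → ‖g y‖ ≤ C * ‖y‖ ^ a := by
  obtain ⟨C, hC⟩ := (isCompact_sphere (0 : Sp d) 1).exists_bound_of_continuousOn
    (hc.mono fun y hy h => by simp only [mem_singleton_iff] at h; simp [h] at hy)
  refine ⟨max C 0, le_max_right _ _, fun y hy => ?_⟩
  have hy' : 0 < ‖y‖ := norm_pos_iff.2 hy
  have h1 : y = ‖y‖ • (‖y‖⁻¹ • y) := by rw [smul_smul, mul_inv_cancel₀ hy'.ne', one_smul]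
  have h2 : ‖y‖⁻¹ • y ≠ 0 := smul_ne_zero (inv_ne_zero hy'.ne') hy
  have h3 : ‖‖y‖⁻¹ • y‖ = 1 := by
    rw [norm_smul, norm_inv, norm_norm, inv_mul_cancel₀ hy'.ne']
  rw [h1, hg _ hy' _ h2, norm_mul, ← h1, mul_comm]
  have h4 : ‖((‖y‖ : ℝ) : ℂ) ^ a‖ = ‖y‖ ^ a := by
    rw [norm_zpow, Complex.norm_real, norm_norm]
  rw [h4]
  gcongr
  exact (hC _ (by simpa using h3)).trans (le_max_left _ _)

theorem aestronglyMeasurable_of_continuousOn_compl {m : ℕ} {g : Sp (m + 1) → ℂ}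
    (hc : ContinuousOn g {0}ᶜ) : AEStronglyMeasurable g := by
  have := hc.aestronglyMeasurable (μ := volume) (measurableSet_singleton (0 : Sp (m + 1))).compl
  rwa [restrict_compl_singleton] at this

/-! ### Cancellation on hyperplanes and half-spaces -/

/-- The functional `x ↦ x_d - L x'` whose level sets are the translates of the graph of `L`. -/
def graphFunctional {m : ℕ} (L : Sp m →L[ℝ] ℝ) : Sp (m + 1) →L[ℝ] ℝ :=
  verticalL m - L.comp (horizontalL m)

@[simp] theorem graphFunctional_emb {m : ℕ} (L : Sp m →L[ℝ] ℝ) (y : Sp m) (t : ℝ) :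
    graphFunctional L (emb y t) = t - L y := by simp [graphFunctional]

theorem abs_graphFunctional_le {m : ℕ} (L : Sp m →L[ℝ] ℝ) (y : Sp m) (h : ℝ) :
    |h| ≤ (1 + ‖L‖) * ‖emb y (L y + h)‖ := by
  have h1 := abs_le_norm_emb y (L y + h)
  have h2 : |L y| ≤ ‖L‖ * ‖y‖ := L.le_opNorm y
  have h3 : ‖L‖ * ‖y‖ ≤ ‖L‖ * ‖emb y (L y + h)‖ := by gcongr; exact norm_le_norm_emb _ _
  have h4 : |h| ≤ |L y + h| + |L y| := by
    have := abs_sub (L y + h) (L y); simpa using this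
  linarith

/-- The surface measure of a set is a multiple of the volume of the cone over it, and this cone lies
in a proper subspace. -/
theorem toSphere_ker_eq_zero {d : ℕ} {l : Sp d →L[ℝ] ℝ} (hl : l ≠ 0) :
    (volume : Measure (Sp d)).toSphere {u | l u = 0} = 0 := by
  have hm : MeasurableSet {u : Metric.sphere (0 : Sp d) 1 | l u = 0} :=
    (isClosed_eq (l.continuous.comp continuous_subtype_val) continuous_const).measurableSet
  rw [Measure.toSphere_apply' _ hm]
  have hk : volume ((LinearMap.ker l.toLinearMap : Submodule ℝ (Sp d)) : Set (Sp d)) = 0 := by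
    refine Measure.addHaar_submodule _ _ fun h => hl ?_
    ext x
    have : x ∈ LinearMap.ker l.toLinearMap := by rw [h]; trivial
    simpa using this
  rw [measure_mono_null ?_ hk, mul_zero]
  rintro x ⟨r, -, y, ⟨u, hu, rfl⟩, rfl⟩
  simp only [mem_ofPred_eq] at hu
  simp [hu]

theorem integral_inv_dyadic {c : ℝ} (hc : 0 < c) :
    ∫ r in Ioi (0 : ℝ), (if 1 < r * c ∧ r * c < 2 then r⁻¹ else 0) = Real.log 2 := by
  have h1 : ∀ r : ℝ, (if 1 < r * c ∧ r * c < 2 then r⁻¹ else 0) =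
      (Ioo (1 / c) (2 / c)).indicator (fun r : ℝ => r⁻¹) r := by
    intro r
    simp only [indicator, mem_Ioo, div_lt_iff₀ hc, lt_div_iff₀ hc]
  simp_rw [h1]
  have hpos : 0 < 1 / c := by positivity
  have hle : 1 / c ≤ 2 / c := by gcongr; norm_num
  rw [setIntegral_indicator measurableSet_Ioo, inter_eq_right.2 (show Ioo (1 / c) (2 / c) ⊆ Ioi 0 from fun r hr => hpos.trans hr.1),
    ← integral_Ioc_eq_integral_Ioo, ← intervalIntegral.integral_of_le hle,
    integral_inv_of_pos hpos (hpos.trans_le hle)]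
  congr 1
  field_simp

/-- A homogeneous function of degree `-(m+1)` with zero mean on the sphere has
zero integral over symmetric slabs. -/
theorem integral_slab_eq_zero {m : ℕ} {g : Sp (m + 1) → ℂ} (hg : IsHomog (-(m + 1 : ℤ)) g)
    (h0 : sphereIntegral g = 0) {l : Sp (m + 1) →L[ℝ] ℝ} (hl : l ≠ 0)
    (hi : Integrable ({y | 1 < |l y| ∧ |l y| < 2}.indicator g)) :
    ∫ y, {y | 1 < |l y| ∧ |l y| < 2}.indicator g y = 0 := by
  rw [integral_polar, integral_prod _ (integrable_polar hi)]
  have hae : ∀ᵐ u : Metric.sphere (0 : Sp (m + 1)) 1 ∂(volume : Measure (Sp (m + 1))).toSphere,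
      l u ≠ 0 := by
    have := toSphere_ker_eq_zero hl
    rw [ae_iff]
    simpa using this
  -- On the ray through u the slab cuts out 1 < r|l(u)| < 2, whose dr/r length is log 2
  -- independently of u.
  have hin : (fun u : Metric.sphere (0 : Sp (m + 1)) 1 =>
      ∫ r : Ioi (0 : ℝ), {y | 1 < |l y| ∧ |l y| < 2}.indicator g (r.1 • u.1)
        ∂(Measure.volumeIoiPow m)) =ᵐ[(volume : Measure (Sp (m + 1))).toSphere]
      fun u => g u * Real.log 2 := by
    filter_upwards [hae] with u hu
    have hu0 : (u : Sp (m + 1)) ≠ 0 := by rintro h; simp [h] at hu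
    rw [integral_volumeIoiPow m fun r => {y | 1 < |l y| ∧ |l y| < 2}.indicator g (r • u.1),
      ← integral_inv_dyadic (abs_pos.2 hu), ← integral_complex_ofReal, ← integral_const_mul]
    refine setIntegral_congr_fun measurableSet_Ioi fun r hr => ?_
    have hr : 0 < r := hr
    have hrc : (r : ℂ) ≠ 0 := by exact_mod_cast hr.ne'
    simp only [indicator, mem_ofPred_eq, map_smul, smul_eq_mul, abs_mul, abs_of_pos hr]
    split_ifs with h
    · rw [hg r hr _ hu0, ← mul_assoc, ← zpow_natCast, ← zpow_add₀ hrc]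
      have e : ((m : ℤ) + -(m + 1 : ℤ)) = -1 := by ring
      rw [e, zpow_neg_one, mul_comm, Complex.ofReal_inv]
    · simp
  rw [integral_congr_ae hin, integral_mul_const]
  change sphereIntegral g * _ = 0
  rw [h0, zero_mul]

/-- After shearing the slab to a horizontal one the height is bounded, and the distance to the
origin dominates 1 + |y|. Decay of order m + 1 then suffices in the m horizontal variables. -/
theorem integrable_slab {m : ℕ} {g : Sp (m + 1) → ℂ} (hg : IsHomog (-(m + 1 : ℤ)) g)
    (hc : ContinuousOn g {0}ᶜ) (L : Sp m →L[ℝ] ℝ) :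
    Integrable ({y | 1 < |graphFunctional L y| ∧ |graphFunctional L y| < 2}.indicator g) := by
  obtain ⟨C, hC0, hC⟩ := hg.exists_norm_le hc
  rw [← integrable_emb_shear_iff L.continuous]
  have hmeas : AEStronglyMeasurable
      ({y | 1 < |graphFunctional L y| ∧ |graphFunctional L y| < 2}.indicator g) :=
    (aestronglyMeasurable_of_continuousOn_compl hc).indicator
      ((isOpen_lt continuous_const (graphFunctional L).continuous.abs).inter
        (isOpen_lt (graphFunctional L).continuous.abs continuous_const)).measurableSet
  have hmeas' := (hmeas.comp_measurePreserving (measurePreserving_emb (m := m))).comp_measurePreserving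
    (measurePreserving_shear L.continuous)
  have hb1 : Integrable fun y : Sp m => (1 + ‖y‖) ^ (-(m + 1 : ℝ)) :=
    integrable_one_add_norm (by simp)
  have hb2 : Integrable ((Icc (-2 : ℝ) 2).indicator fun _ => (1 : ℝ)) :=
    (integrable_indicator_iff measurableSet_Icc).2 (by simp)
  refine ((hb1.mul_prod hb2).const_mul (C * (2 + ‖L‖) ^ (m + 1))).mono' hmeas'
    (Eventually.of_forall fun p => ?_)
  obtain ⟨y, h⟩ := p
  simp only [indicator, mem_ofPred_eq, graphFunctional_emb, add_sub_cancel_left]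
  by_cases hh : 1 < |h| ∧ |h| < 2
  · have hI : h ∈ Icc (-2 : ℝ) 2 := by rw [mem_Icc, ← abs_le]; exact hh.2.le
    simp only [hh, hI, and_self, if_true, mul_one]
    have h1 := abs_graphFunctional_le L y h
    have h2 := norm_le_norm_emb y (L y + h)
    have h3 : 1 + ‖y‖ ≤ (2 + ‖L‖) * ‖emb y (L y + h)‖ := by nlinarith [hh.1]
    have hpos : 0 < ‖emb y (L y + h)‖ := by
      have : 0 < 1 + ‖y‖ := by positivity
      by_contra hcon
      have : ‖emb y (L y + h)‖ = 0 := le_antisymm (not_lt.1 hcon) (norm_nonneg _)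
      rw [this] at h3
      linarith
    refine (hC _ (norm_pos_iff.1 hpos)).trans ?_
    rw [mul_assoc]
    refine mul_le_mul_of_nonneg_left ?_ hC0
    have e1 : (-(m + 1 : ℝ)) = ((-(m + 1 : ℤ) : ℤ) : ℝ) := by push_cast; ring
    rw [e1, Real.rpow_intCast]
    have e2 : (-(m + 1 : ℤ)) = -((m + 1 : ℕ) : ℤ) := by push_cast; ring
    rw [e2, zpow_neg, zpow_neg, zpow_natCast, zpow_natCast]
    rw [inv_le_iff_one_le_mul₀ (by positivity), mul_right_comm, ← mul_pow,
      ← div_eq_mul_inv, one_le_div (by positivity)]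
    gcongr
  · simp only [hh, if_false, norm_zero]
    positivity

/-- An even homogeneous function of degree `-(m+1)` with zero mean on the sphere has zero integral
over every hyperplane that misses the origin. -/
theorem integral_hyperplane_eq_zero {m : ℕ} {g : Sp (m + 1) → ℂ} (hg : IsHomog (-(m + 1 : ℤ)) g)
    (hc : ContinuousOn g {0}ᶜ) (heven : ∀ y, y ≠ 0 → g (-y) = g y) (h0 : sphereIntegral g = 0)
    (L : Sp m →L[ℝ] ℝ) {h : ℝ} (hh : h ≠ 0) : ∫ y, g (emb y (L y + h)) = 0 := by
  have hne : ∀ y : Sp m, ∀ h : ℝ, h ≠ 0 → emb y (L y + h) ≠ 0 := by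
    intro y h hh hcon
    have := congrArg (graphFunctional L) hcon
    simp [hh] at this
  have hscale : ∀ h : ℝ, 0 < h →
      ∫ y, g (emb y (L y + h)) = (h : ℂ)⁻¹ * ∫ y, g (emb y (L y + 1)) := by
    intro h hh
    have hhc : (h : ℂ) ≠ 0 := by exact_mod_cast hh.ne'
    have h1 := Measure.integral_comp_smul (volume : Measure (Sp m))
      (fun y => g (emb y (L y + h))) h
    have h2 : ∀ y : Sp m, g (emb (h • y) (L (h • y) + h)) =
        (h : ℂ) ^ (-(m + 1 : ℤ)) * g (emb y (L y + 1)) := by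
      intro y
      rw [← hg h hh _ (hne y 1 one_ne_zero), ← emb_smul]
      congr 2
      simp; ring
    simp_rw [h2] at h1
    rw [integral_const_mul, finrank_euclideanSpace, Fintype.card_fin,
      abs_of_pos (by positivity), Complex.real_smul] at h1
    have h3 : ∫ y, g (emb y (L y + h)) = (h : ℂ) ^ m *
        ((((h ^ m)⁻¹ : ℝ) : ℂ) * ∫ y, g (emb y (L y + h))) := by
      push_cast
      field_simp
    rw [h3, ← h1, ← mul_assoc, ← zpow_natCast, ← zpow_add₀ hhc]
    have e : ((m : ℤ) + -(m + 1 : ℤ)) = -1 := by ring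
    rw [e, zpow_neg_one]
  have hneg : ∀ h : ℝ, h ≠ 0 → ∫ y, g (emb y (L y + -h)) = ∫ y, g (emb y (L y + h)) := by
    intro h hh
    rw [← integral_neg_eq_self]
    refine integral_congr_ae (Eventually.of_forall fun y => ?_)
    simp only
    rw [← heven _ (hne y h hh), ← emb_neg]
    congr 2
    simp; ring
  -- Homogeneity handles positive heights; evenness of g and the reflection y ↦ −y carry the formula
  -- to negative ones.
  have habs : ∀ h : ℝ, h ≠ 0 →
      ∫ y, g (emb y (L y + h)) = ((|h| : ℝ) : ℂ)⁻¹ * ∫ y, g (emb y (L y + 1)) := by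
    intro h hh
    rcases lt_or_gt_of_ne hh with h1 | h1
    · rw [abs_of_neg h1, ← hscale (-h) (by linarith), hneg h hh]
    · rw [abs_of_pos h1, ← hscale h h1]
  have hl : graphFunctional L ≠ 0 := by
    intro hcon
    have := congrArg (fun l => l (emb (0 : Sp m) 1)) hcon
    simp at this
  have hint := integrable_slab hg hc L
  have hz := integral_slab_eq_zero hg h0 hl hint
  rw [← integrable_emb_shear_iff L.continuous] at hint
  rw [← integral_emb_shear L.continuous, Measure.volume_eq_prod, integral_prod_symm _ hint] at hz
  have hfun : ∀ t : ℝ, (∫ y : Sp m, {y | 1 < |graphFunctional L y| ∧ |graphFunctional L y| < 2}.indicator g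
      (emb y (L y + t))) = (((fun r : ℝ => if 1 < r * 1 ∧ r * 1 < 2 then r⁻¹ else 0) |t| : ℝ) : ℂ) *
        ∫ y, g (emb y (L y + 1)) := by
    intro t
    simp only [indicator, mem_ofPred_eq, graphFunctional_emb, add_sub_cancel_left, mul_one]
    split_ifs with ht
    · rw [habs t (abs_pos.1 (one_pos.trans ht.1)), Complex.ofReal_inv]
    · simp
  simp_rw [hfun] at hz
  -- The two halves of the slab give the nonzero factor 2 log 2, so vanishing of the slab integral
  -- forces vanishing at height 1.
  rw [integral_mul_const, integral_complex_ofReal,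
    integral_comp_abs (f := fun r : ℝ => if 1 < r * 1 ∧ r * 1 < 2 then r⁻¹ else 0),
    integral_inv_dyadic one_pos] at hz
  have : ∫ y, g (emb y (L y + 1)) = 0 := by
    refine (mul_eq_zero.1 hz).resolve_left (Complex.ofReal_ne_zero.2 ?_)
    exact (mul_pos two_pos (Real.log_pos one_lt_two)).ne'
  rw [habs h hh, this, mul_zero]

/-- The monomial, restricted to the hyperplane, extends to a homogeneous polynomial q of degree s.
Then F q is even, of degree −(m+1), and of mean zero by the moment condition. -/
theorem MomentKernel.integral_hyperplane_monomial {m N s : ℕ} {F : Sp (m + 1) → ℂ}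
    (hF : MomentKernel N s F) (L : Sp m →L[ℝ] ℝ) {w : Sp (m + 1)} (hw : graphFunctional L w ≠ 0)
    (γ : Fin m → ℕ) (hγ : ∑ i, γ i ≤ s) :
    ∫ y, F (w - emb y (L y)) * ((∏ i, y i ^ γ i : ℝ) : ℂ) = 0 := by
  set h := graphFunctional L w with hh
  have hhc : (h : ℂ) ≠ 0 := by exact_mod_cast hw
  -- On the hyperplane where `graphFunctional L` equals h, a point v = w − (y, L y) gives v' = w' −
  -- y, so q(v) = y^γ. The factors `graphFunctional L v / h` equal 1 there and only raise the degree
  -- to s.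
  let q : Sp (m + 1) → ℂ := fun v => (((graphFunctional L v / h) ^ (s - ∑ i, γ i) *
    ∏ i, (graphFunctional L v / h * horizontal w i - horizontal v i) ^ γ i : ℝ) : ℂ)
  have hq : ContDiff ℝ (⊤ : ℕ∞) q := by
    refine Complex.ofRealCLM.contDiff.comp ?_
    refine ContDiff.mul (((graphFunctional L).contDiff.div_const h).pow _) ?_
    refine contDiff_prod fun i _ => ContDiff.pow ?_ _
    refine ContDiff.sub (((graphFunctional L).contDiff.div_const h).mul contDiff_const) ?_
    exact ((EuclideanSpace.proj i : Sp m →L[ℝ] ℝ).comp (horizontalL m)).contDiff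
  have hqh : ∀ t : ℝ, t ≠ 0 → ∀ y, q (t • y) = (t : ℂ) ^ s * q y := by
    intro t _ y
    have h1 : ∀ i, graphFunctional L (t • y) / h * horizontal w i - horizontal (t • y) i =
        t * (graphFunctional L y / h * horizontal w i - horizontal y i) := by
      intro i
      rw [← horizontalL_apply, ← horizontalL_apply, ← horizontalL_apply]
      simp only [map_smul, smul_eq_mul, PiLp.smul_apply]
      ring
    simp only [q]
    simp_rw [h1, mul_pow]
    rw [Finset.prod_mul_distrib, Finset.prod_pow_eq_pow_sum, map_smul, smul_eq_mul, mul_div_assoc,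
      mul_pow]
    have e : t ^ s = t ^ (s - ∑ i, γ i) * t ^ (∑ i, γ i) := by
      rw [← pow_add, Nat.sub_add_cancel hγ]
    rw [← Complex.ofReal_pow, e]
    push_cast
    ring
  have key := integral_hyperplane_eq_zero (g := fun v => F v * q v) ?_ ?_ ?_ (hF.moment q hq hqh)
    L hw
  · rw [← key, ← integral_sub_left_eq_self _ volume (horizontal w)]
    refine integral_congr_ae (Eventually.of_forall fun z => ?_)
    have e1 : w - emb (horizontal w - z) (L (horizontal w - z)) = emb z (L z + h) := by
      conv_lhs => rw [← emb_horizontal_vertical w]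
      rw [← emb_sub]
      congr 1
      · simp
      · rw [hh, map_sub]
        simp [graphFunctional]
        ring
    simp only [e1, q, graphFunctional_emb, add_sub_cancel_left, div_self hw, one_pow, one_mul,
      horizontal_emb, PiLp.sub_apply]
  · have h1 : IsHomog (s : ℤ) q := fun t ht y _ => by rw [hqh t ht.ne' y, zpow_natCast]
    have h2 := hF.homog.mul h1
    have e : -(m + 1 + s : ℤ) + (s : ℤ) = -(m + 1 : ℤ) := by ring
    rwa [e] at h2
  · exact hF.contDiffOn.continuousOn.mul hq.continuous.continuousOn
  · intro y hy
    have h1 := hqh (-1) (by norm_num) y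
    rw [neg_one_smul] at h1
    simp only [h1, hF.parity y hy]
    push_cast
    have : ((-1 : ℂ) ^ s) * (-1) ^ s = 1 := by rw [← mul_pow]; norm_num
    linear_combination (F y * q y) * this

theorem integrableOn_inv_norm_pow {d k : ℕ} (hk : d < k) {c : ℝ} (hc : 0 < c) :
    IntegrableOn (fun v : Sp d => (‖v‖ ^ k)⁻¹) {v | c ≤ ‖v‖} := by
  have h1 : Integrable fun v : Sp d => (1 + ‖v‖) ^ (-(k : ℝ)) :=
    integrable_one_add_norm (by simpa using hk)
  have hms : MeasurableSet {v : Sp d | c ≤ ‖v‖} :=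
    (isClosed_le continuous_const continuous_norm).measurableSet
  refine ((h1.const_mul ((1 + c⁻¹) ^ k)).integrableOn (s := {v | c ≤ ‖v‖})).mono' ?_ ?_
  · exact ((measurable_norm.pow_const k).inv).aestronglyMeasurable
  · refine (ae_restrict_iff' hms).2 (Eventually.of_forall fun v hv => ?_)
    have hv : c ≤ ‖v‖ := hv
    have hpos : 0 < ‖v‖ := hc.trans_le hv
    rw [Real.norm_of_nonneg (by positivity), Real.rpow_neg (by positivity), Real.rpow_natCast,
      ← div_eq_mul_inv, inv_eq_one_div, div_le_div_iff₀ (by positivity) (by positivity), one_mul,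
      ← mul_pow]
    refine pow_le_pow_left₀ (by positivity) ?_ k
    have : 1 ≤ c⁻¹ * ‖v‖ := by rw [← div_eq_inv_mul, one_le_div hc]; exact hv
    linarith

/-- Slice the half-space by hyperplanes parallel to its boundary: each misses w, so each slice
integrates to zero. The condition s ≥ 1 makes the integral absolutely convergent, which justifies
Fubini. -/
theorem MomentKernel.integral_halfSpace {m N s : ℕ} {F : Sp (m + 1) → ℂ}
    (hF : MomentKernel N s F) (hs : 1 ≤ s) (L : Sp m →L[ℝ] ℝ) {w : Sp (m + 1)}
    (hw : 0 < graphFunctional L w) :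
    IntegrableOn (fun y => F (w - y)) {y | graphFunctional L y ≤ 0} ∧
      ∫ y in {y | graphFunctional L y ≤ 0}, F (w - y) = 0 := by
  have hms : MeasurableSet {y | graphFunctional L y ≤ 0} :=
    (isClosed_le (graphFunctional L).continuous continuous_const).measurableSet
  have hint : IntegrableOn (fun y => F (w - y)) {y | graphFunctional L y ≤ 0} := by
    obtain ⟨C, hC0, hC⟩ := hF.homog.exists_norm_le hF.contDiffOn.continuousOn
    have hl : 0 < ‖graphFunctional L‖ := by
      refine norm_pos_iff.2 fun h => ?_
      simp [h] at hw
    set c := graphFunctional L w / ‖graphFunctional L‖ with hcdef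
    have hc : 0 < c := div_pos hw hl
    have h1 := (integrableOn_inv_norm_pow (d := m + 1) (k := m + 1 + s) (by omega) hc).const_mul C
    have hms2 : MeasurableSet {v : Sp (m + 1) | c ≤ ‖v‖} :=
      (isClosed_le continuous_const continuous_norm).measurableSet
    have h2 : IntegrableOn F {v | c ≤ ‖v‖} := by
      refine h1.mono' (aestronglyMeasurable_of_continuousOn_compl
        hF.contDiffOn.continuousOn).restrict ?_
      refine (ae_restrict_iff' hms2).2 (Eventually.of_forall fun v hv => ?_)
      have hv : c ≤ ‖v‖ := hv
      have := hC v (norm_pos_iff.1 (hc.trans_le hv))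
      have e2 : (-(m + 1 + s : ℤ)) = -((m + 1 + s : ℕ) : ℤ) := by push_cast; ring
      rwa [e2, zpow_neg, zpow_natCast] at this
    rw [← integrable_indicator_iff hms2] at h2
    have h3 := h2.comp_sub_left w
    rw [← integrable_indicator_iff hms]
    refine (h3.indicator hms).congr (Eventually.of_forall fun y => ?_)
    simp only [indicator, mem_ofPred_eq]
    split_ifs with ha hb
    · rfl
    · exfalso
      apply hb
      rw [hcdef, div_le_iff₀ hl, mul_comm]
      have := (graphFunctional L).le_opNorm (w - y)
      rw [map_sub, Real.norm_of_nonneg (by linarith)] at this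
      linarith
    · rfl
  refine ⟨hint, ?_⟩
  rw [← integrable_indicator_iff hms, ← integrable_emb_shear_iff L.continuous] at hint
  rw [← integral_indicator hms, ← integral_emb_shear L.continuous, Measure.volume_eq_prod,
    integral_prod_symm _ hint]
  refine integral_eq_zero_of_ae (Eventually.of_forall fun t => ?_)
  simp only [indicator, mem_ofPred_eq, graphFunctional_emb, add_sub_cancel_left, Pi.zero_apply]
  split_ifs with ht
  · have hw' : graphFunctional L (w - emb 0 t) ≠ 0 := by
      rw [map_sub, graphFunctional_emb, map_zero, sub_zero]
      exact (sub_pos.2 (ht.trans_lt hw)).ne'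
    have := hF.integral_hyperplane_monomial L hw' (fun _ => 0) (by simp)
    simp only [pow_zero, Finset.prod_const_one, Complex.ofReal_one, mul_one] at this
    rw [← this]
    refine integral_congr_ae (Eventually.of_forall fun y => ?_)
    simp only [sub_sub, ← emb_add, zero_add, add_comm t]
  · simp

/-! ### Iterated directional derivatives and kernel bounds -/

theorem iteratedFDeriv_apply_eq_dirD {d N : ℕ} {F : Sp d → ℂ} {U : Set (Sp d)} (hU : IsOpen U)
    (hF : ContDiffOn ℝ N F U) {n : ℕ} (hn : n ≤ N) (v : Fin n → Sp d) {y : Sp d} (hy : y ∈ U) :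
    iteratedFDeriv ℝ n F y v = dirD (List.ofFn v) F y := by
  induction n generalizing y with
  | zero => simp [dirD]
  | succ n ih =>
    have hd : DifferentiableAt ℝ (iteratedFDeriv ℝ n F) y :=
      (hF.contDiffAt (hU.mem_nhds hy)).differentiableAt_iteratedFDeriv (by exact_mod_cast hn)
    rw [hd.iteratedFDeriv_succ_apply_left', List.ofFn_succ]
    simp only [dirD]
    have : (fun x => iteratedFDeriv ℝ n F x (Fin.tail v)) =ᶠ[𝓝 y]
        dirD (List.ofFn fun i => v i.succ) F := by
      filter_upwards [hU.mem_nhds hy] with z hz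
      exact ih (by omega) (Fin.tail v) hz
    rw [this.fderiv_eq]

theorem dirD_comp_isometry {d : ℕ} (F : Sp d → ℂ) (U : Sp d ≃ₗᵢ[ℝ] Sp d) (vs : List (Sp d)) {y : Sp d} :
    dirD vs (fun z => F (U z)) y = dirD (vs.map U) F (U y) := by
  induction vs generalizing y with
  | nil => rfl
  | cons v vs ih =>
    simp only [dirD, List.map_cons]
    have e : dirD vs (fun z => F (U z)) = dirD (vs.map U) F ∘ U := funext fun z => ih
    rw [e]
    have := U.toContinuousLinearEquiv.comp_right_fderiv (f := dirD (vs.map U) F) (x := y)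
    have e2 : (dirD (List.map U vs) F ∘ U) = dirD (List.map U vs) F ∘ U.toContinuousLinearEquiv :=
      rfl
    rw [e2, this]
    rfl

/-- Uniform size bounds for the iterated directional derivatives of a kernel. -/
def KernelBound {m : ℕ} (N : ℕ) (C : ℝ) (K : Sp (m + 1) → ℂ) : Prop :=
  ∀ vs : List (Sp (m + 1)), vs.length ≤ N → (∀ v ∈ vs, ‖v‖ ≤ 1) → ∀ y, y ≠ 0 →
    ‖dirD vs K y‖ ≤ C * (‖y‖ ^ (m + 1 + vs.length))⁻¹

theorem norm_dirD_le {d N : ℕ} {F : Sp d → ℂ} {U : Set (Sp d)} (hU : IsOpen U)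
    (hF : ContDiffOn ℝ N F U) {vs : List (Sp d)} (hvs : vs.length ≤ N) (h1 : ∀ v ∈ vs, ‖v‖ ≤ 1)
    {y : Sp d} (hy : y ∈ U) : ‖dirD vs F y‖ ≤ ‖iteratedFDeriv ℝ vs.length F y‖ := by
  have h := iteratedFDeriv_apply_eq_dirD hU hF hvs vs.get hy
  rw [List.ofFn_get] at h
  rw [← h]
  refine (ContinuousMultilinearMap.le_opNorm _ _).trans ?_
  refine mul_le_of_le_one_right (norm_nonneg _) (Finset.prod_le_one (fun _ _ => norm_nonneg _) ?_)
  intro i _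
  exact h1 _ (List.get_mem _ _)

theorem MomentKernel.exists_kernelBound {m N : ℕ} {K : Sp (m + 1) → ℂ} (hK : MomentKernel N 0 K) :
    ∃ C, 0 < C ∧ KernelBound N C K := by
  have hb : ∀ j, ∃ C, 0 ≤ C ∧ (j ≤ N → ∀ y ∈ Metric.sphere (0 : Sp (m + 1)) 1,
      ‖iteratedFDeriv ℝ j K y‖ ≤ C) := by
    intro j
    by_cases hj : j ≤ N
    · have hc : ContinuousOn (iteratedFDeriv ℝ j K) {0}ᶜ := by
        intro y hy
        refine ContinuousAt.continuousWithinAt ?_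
        exact (hK.contDiffOn.contDiffAt (isOpen_compl_singleton.mem_nhds hy)).continuousAt_iteratedFDeriv
          (by exact_mod_cast hj)
      obtain ⟨C, hC⟩ := (isCompact_sphere (0 : Sp (m + 1)) 1).exists_bound_of_continuousOn
        (hc.mono fun y hy h => by simp only [mem_singleton_iff] at h; simp [h] at hy)
      exact ⟨max C 0, le_max_right _ _, fun _ y hy => (hC y hy).trans (le_max_left _ _)⟩
    · exact ⟨0, le_rfl, fun h => absurd h hj⟩
  choose c hc0 hc using hb
  refine ⟨1 + ∑ j ∈ Finset.range (N + 1), c j,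
    add_pos_of_pos_of_nonneg one_pos (Finset.sum_nonneg fun j _ => hc0 j), ?_⟩
  intro vs hvs h1 y hy
  have hy' : 0 < ‖y‖ := norm_pos_iff.2 hy
  have hM : MomentKernel (N - vs.length) (0 + vs.length) (CZDomain.dirD vs K) := by
    apply MomentKernel.dirD
    rwa [Nat.sub_add_cancel hvs]
  have h3 : ‖‖y‖⁻¹ • y‖ = 1 := by rw [norm_smul, norm_inv, norm_norm, inv_mul_cancel₀ hy'.ne']
  have h4 : ‖y‖⁻¹ • y ≠ 0 := smul_ne_zero (inv_ne_zero hy'.ne') hy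
  have h5 : y = ‖y‖ • (‖y‖⁻¹ • y) := by rw [smul_smul, mul_inv_cancel₀ hy'.ne', one_smul]
  have h6 := hM.homog ‖y‖ hy' _ h4
  rw [← h5] at h6
  rw [h6, norm_mul, norm_zpow, Complex.norm_real, norm_norm, mul_comm]
  have e2 : (-(m + 1 + (0 + vs.length : ℕ) : ℤ)) = -((m + 1 + vs.length : ℕ) : ℤ) := by
    push_cast; ring
  rw [e2, zpow_neg, zpow_natCast]
  gcongr
  refine (norm_dirD_le isOpen_compl_singleton hK.contDiffOn hvs h1 h4).trans ?_
  refine (hc _ hvs _ (by simpa using h3)).trans ?_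
  have := Finset.single_le_sum (fun j _ => hc0 j) (Finset.mem_range.2 (Nat.lt_succ_of_le hvs))
  linarith

/-! ### Taylor's formula for integrals along a segment -/

/-- Induction on N: the case N applied to the derivative expands τ₀(s) − τ₀(0), and this is
integrated in s. The remainder is bounded without its factorial, which is not needed. -/
theorem norm_integral_sub_taylor_le (N : ℕ) (τ : ℕ → ℝ → ℂ) (p B : ℝ)
    (hd : ∀ j < N, ∀ s ∈ uIcc 0 p, HasDerivAt (τ j) (τ (j + 1) s) s)
    (hc : ContinuousOn (τ N) (uIcc 0 p)) (hB : ∀ s ∈ uIcc 0 p, ‖τ N s‖ ≤ B) :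
    ‖(∫ s in (0 : ℝ)..p, τ 0 s) -
      ∑ j ∈ Finset.range N, ((p ^ (j + 1) / (j + 1).factorial : ℝ) : ℂ) * τ j 0‖
        ≤ B * |p| ^ (N + 1) := by
  induction N generalizing τ p with
  | zero =>
    simp only [Finset.range_zero, Finset.sum_empty, sub_zero, zero_add, pow_one]
    have := intervalIntegral.norm_integral_le_of_norm_le_const (f := τ 0) (a := 0) (b := p) (C := B)
      (fun s hs => hB s (uIoc_subset_uIcc hs))
    simpa using this
  | succ N ih =>
    have hcont : ∀ j ≤ N + 1, ContinuousOn (τ j) (uIcc 0 p) := by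
      intro j hj
      rcases Nat.lt_or_ge j (N + 1) with h | h
      · exact fun s hs => (hd j h s hs).continuousAt.continuousWithinAt
      · have : j = N + 1 := by omega
        rwa [this]
    have hsub : ∀ s ∈ uIcc 0 p, uIcc 0 s ⊆ uIcc 0 p := fun s hs =>
      uIcc_subset_uIcc left_mem_uIcc hs
    have hI : ∀ s ∈ uIcc 0 p, ‖(τ 0 s - τ 0 0) -
        ∑ j ∈ Finset.range N, ((s ^ (j + 1) / (j + 1).factorial : ℝ) : ℂ) * τ (j + 1) 0‖
          ≤ B * |p| ^ (N + 1) := by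
      intro s hs
      have h1 := ih (fun j => τ (j + 1)) s
        (fun j hj r hr => hd (j + 1) (by omega) r (hsub s hs hr))
        (hc.mono (hsub s hs)) (fun r hr => hB r (hsub s hs hr))
      have h2 : ∫ r in (0 : ℝ)..s, τ 1 r = τ 0 s - τ 0 0 :=
        intervalIntegral.integral_eq_sub_of_hasDerivAt
          (fun r hr => hd 0 (by omega) r (hsub s hs hr))
          ((hcont 1 (by omega)).mono (hsub s hs)).intervalIntegrable
      simp only [zero_add] at h1
      rw [h2] at h1
      refine h1.trans ?_
      have hB0 : 0 ≤ B := (norm_nonneg _).trans (hB s hs)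
      have : |s| ≤ |p| := by
        have := abs_sub_left_of_mem_uIcc hs
        simpa using this
      gcongr
    have e : (∫ s in (0 : ℝ)..p, τ 0 s) -
        ∑ j ∈ Finset.range (N + 1), ((p ^ (j + 1) / (j + 1).factorial : ℝ) : ℂ) * τ j 0 =
        ∫ s in (0 : ℝ)..p, ((τ 0 s - τ 0 0) -
          ∑ j ∈ Finset.range N, ((s ^ (j + 1) / (j + 1).factorial : ℝ) : ℂ) * τ (j + 1) 0) := by
      have hint : ∀ j : ℕ, IntervalIntegrable
          (fun s : ℝ => ((s ^ (j + 1) / (j + 1).factorial : ℝ) : ℂ) * τ (j + 1) 0) volume 0 p :=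
        fun j => Continuous.intervalIntegrable (by fun_prop) _ _
      have hτ : IntervalIntegrable (τ 0) volume 0 p := (hcont 0 (by omega)).intervalIntegrable
      have hsum : IntervalIntegrable (fun s : ℝ => ∑ j ∈ Finset.range N,
          ((s ^ (j + 1) / (j + 1).factorial : ℝ) : ℂ) * τ (j + 1) 0) volume 0 p :=
        Continuous.intervalIntegrable (by fun_prop) _ _
      refine Eq.trans ?_ (intervalIntegral.integral_sub
        (hτ.sub (intervalIntegrable_const (c := τ 0 0))) hsum).symm
      rw [intervalIntegral.integral_finsetSum fun j _ => hint j, Finset.sum_range_succ']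
      have h1 : ∫ s in (0 : ℝ)..p, (τ 0 s - τ 0 0) = (∫ s in (0 : ℝ)..p, τ 0 s) - p * τ 0 0 := by
        rw [intervalIntegral.integral_sub hτ intervalIntegrable_const]
        simp
      rw [h1]
      have hterm : ∀ j : ℕ, ∫ s in (0 : ℝ)..p,
          ((s ^ (j + 1) / (j + 1).factorial : ℝ) : ℂ) * τ (j + 1) 0 =
          ((p ^ (j + 1 + 1) / (j + 1 + 1).factorial : ℝ) : ℂ) * τ (j + 1) 0 := by
        intro j
        rw [intervalIntegral.integral_mul_const, intervalIntegral.integral_ofReal,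
          intervalIntegral.integral_div, integral_pow]
        congr 2
        rw [Nat.factorial_succ (j + 1)]
        push_cast
        field_simp
        simp
      simp_rw [hterm]
      simp
      ring
    rw [e]
    have := intervalIntegral.norm_integral_le_of_norm_le_const (a := 0) (b := p)
      (fun s hs => hI s (uIoc_subset_uIcc hs))
    refine this.trans (le_of_eq ?_)
    rw [sub_zero, pow_succ |p| (N + 1), mul_assoc]

/-! ### Growth functions and integrable weights -/

theorem IsGrowthFunction.nonneg {n : ℕ} {ω : ℝ → ℝ} (hω : IsGrowthFunction n ω) {t : ℝ}
    (ht : 0 ≤ t) : 0 ≤ ω t := by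
  rw [← hω.map_zero]
  exact hω.monotoneOn (mem_Ici.2 le_rfl) ht ht

theorem IsGrowthFunction.pos {n : ℕ} {ω : ℝ → ℝ} (hω : IsGrowthFunction n ω) {t : ℝ}
    (ht : 0 < t) : 0 < ω t := by
  obtain ⟨q, -, -, C, hC, h⟩ := hω.almost_decreasing
  have h1 := h 2 t one_lt_two ht
  have h2 := hω.nonneg (t := 2 * t) (by positivity)
  by_contra hcon
  have : C * 2 ^ q * ω t ≤ 0 := mul_nonpos_of_nonneg_of_nonpos (by positivity) (not_lt.1 hcon)
  linarith

/-- The upper regularity of a growth function, in the form used for integration. -/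
theorem IsGrowthFunction.exists_le_rpow {n : ℕ} {ω : ℝ → ℝ} (hω : IsGrowthFunction n ω) :
    ∃ q : ℝ, (n : ℝ) < q ∧ q < n + 1 ∧ ∃ C : ℝ, 0 < C ∧
      ∀ t ρ : ℝ, 0 ≤ t → 0 < ρ → ω t ≤ C * (ω ρ * ρ ^ (-q)) * (t + ρ) ^ q := by
  obtain ⟨q, hq1, hq2, C, hC, h⟩ := hω.almost_decreasing
  have hq0 : 0 ≤ q := (Nat.cast_nonneg n).trans hq1.le
  -- The summand 1 covers t ≤ ρ by monotonicity, and C covers t > ρ by the regularity condition.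
  refine ⟨q, hq1, hq2, C + 1, by positivity, fun t ρ ht hρ => ?_⟩
  have hωρ := hω.pos hρ
  have e : (C + 1) * (ω ρ * ρ ^ (-q)) * (t + ρ) ^ q = (C + 1) * ((t + ρ) / ρ) ^ q * ω ρ := by
    rw [Real.div_rpow (by positivity) hρ.le, Real.rpow_neg hρ.le]
    ring
  rw [e]
  rcases le_or_gt t ρ with h1 | h1
  · have h2 : ω t ≤ ω ρ := hω.monotoneOn ht hρ.le h1
    have h3 : 1 ≤ ((t + ρ) / ρ) ^ q :=
      Real.one_le_rpow ((one_le_div hρ).2 (by linarith)) hq0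
    nlinarith [mul_nonneg hC.le (zero_le_one.trans h3)]
  · have h2 := h (t / ρ) ρ ((one_lt_div hρ).2 h1) hρ
    rw [div_mul_cancel₀ _ hρ.ne'] at h2
    refine h2.le.trans ?_
    gcongr
    · linarith
    · linarith

/-- Applying the growth bound at the fixed time T bounds ω(ρ)ρ^(−q) from below for ρ ≤ T. This lets
bounded error terms be absorbed into the final estimate. -/
theorem IsGrowthFunction.exists_rpow_le {n : ℕ} {ω : ℝ → ℝ} (hω : IsGrowthFunction n ω) {q C T : ℝ}
    (hC : 0 < C) (hT : 0 < T)
    (h : ∀ t ρ : ℝ, 0 ≤ t → 0 < ρ → ω t ≤ C * (ω ρ * ρ ^ (-q)) * (t + ρ) ^ q) (hq : 0 ≤ q) :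
    ∃ C', 0 < C' ∧ ∀ ρ, 0 < ρ → ρ ≤ T → 1 ≤ C' * (ω ρ * ρ ^ (-q)) := by
  have hωT := hω.pos hT
  refine ⟨C * (2 * T) ^ q / ω T, by positivity, fun ρ hρ hρT => ?_⟩
  have h1 := h T ρ hT.le hρ
  have hωρ := hω.pos hρ
  have h2 : (T + ρ) ^ q ≤ (2 * T) ^ q := by gcongr; linarith
  rw [div_mul_eq_mul_div, one_le_div hωT]
  refine h1.trans ?_
  have : C * (ω ρ * ρ ^ (-q)) * (T + ρ) ^ q ≤ C * (ω ρ * ρ ^ (-q)) * (2 * T) ^ q := by gcongr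
  linarith

/-- The exponent 3/2 is admissible because n ≥ 2. Any exponent above 1 would do: the point is that
ω(t)/t tends to 0. -/
theorem IsGrowthFunction.exists_le_rpow_three_halves {n : ℕ} (hn : 1 < n) {ω : ℝ → ℝ}
    (hω : IsGrowthFunction n ω) :
    ∃ C, 0 < C ∧ ∀ t, 0 ≤ t → t < 1 → ω t ≤ C * (t * t ^ (1 / 2 : ℝ)) := by
  have h2 : (2 : ℝ) ≤ n := by exact_mod_cast hn
  obtain ⟨C, hC, h⟩ := hω.almost_increasing (1 + 1 / 2) (by linarith)
  have hω1 := hω.pos one_pos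
  refine ⟨C * ω 1, by positivity, fun t ht0 ht1 => ?_⟩
  rcases ht0.eq_or_lt with rfl | ht
  · simp [hω.map_zero]
  · have := h t 1 ht ht1 one_pos
    rw [mul_one, Real.rpow_add ht, Real.rpow_one] at this
    linarith

theorem integrable_weight {m : ℕ} {r : ℝ} (hr : (m : ℝ) < r) {ρ : ℝ} (hρ : 0 < ρ) :
    Integrable (fun y : Sp m => (‖y‖ + ρ) ^ (-r)) ∧
      ∫ y : Sp m, (‖y‖ + ρ) ^ (-r) = ρ ^ (m - r) * ∫ y : Sp m, (1 + ‖y‖) ^ (-r) := by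
  have hb : Integrable fun y : Sp m => (1 + ‖y‖) ^ (-r) := integrable_one_add_norm (by simpa using hr)
  have e : ∀ y : Sp m, (‖ρ • y‖ + ρ) ^ (-r) = ρ ^ (-r) * (1 + ‖y‖) ^ (-r) := by
    intro y
    rw [norm_smul, Real.norm_of_nonneg hρ.le, ← Real.mul_rpow hρ.le (by positivity)]
    congr 1; ring
  constructor
  · rw [← integrable_comp_smul_iff volume (fun y : Sp m => (‖y‖ + ρ) ^ (-r)) hρ.ne']
    simp_rw [e]
    exact hb.const_mul _
  · have h1 := Measure.integral_comp_smul (volume : Measure (Sp m))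
      (fun y => (‖y‖ + ρ) ^ (-r)) ρ
    simp_rw [e] at h1
    rw [integral_const_mul, finrank_euclideanSpace, Fintype.card_fin,
      abs_of_pos (by positivity), smul_eq_mul] at h1
    have h3 : ∫ y : Sp m, (‖y‖ + ρ) ^ (-r) = ρ ^ m *
        ((ρ ^ m)⁻¹ * ∫ y : Sp m, (‖y‖ + ρ) ^ (-r)) := by
      field_simp
    rw [h3, ← h1, ← mul_assoc, ← Real.rpow_natCast, ← Real.rpow_add hρ, sub_eq_add_neg]

theorem abs_monomial_le {m : ℕ} (y : Sp m) (γ : Fin m → ℕ) :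
    |∏ i, y i ^ γ i| ≤ ‖y‖ ^ ∑ i, γ i := by
  rw [Finset.abs_prod, ← Finset.prod_pow_eq_pow_sum]
  refine Finset.prod_le_prod (fun _ _ => abs_nonneg _) fun i _ => ?_
  rw [abs_pow]
  gcongr
  exact PiLp.norm_apply_le y i

/-- Since x ≤ X ≤ 1, the left side is at most X^(b − a) = X^(−m), and raising m to r only enlarges
it. Thus terms of borderline order −m fit the integrable weight of order −r. -/
theorem inv_pow_mul_pow_le_weight {m a b : ℕ} {r x X : ℝ} (hab : b + m = a) (hx : 0 ≤ x)
    (hxX : x ≤ X) (hX : 0 < X) (hX1 : X ≤ 1) (hr : (m : ℝ) ≤ r) {c : ℕ} (hc : b ≤ c) :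
    (X ^ a)⁻¹ * x ^ c ≤ X ^ (-r) := by
  have h1 : x ^ c ≤ X ^ b := (pow_le_pow_left₀ hx hxX c).trans (pow_le_pow_of_le_one hX.le hX1 hc)
  calc (X ^ a)⁻¹ * x ^ c ≤ (X ^ a)⁻¹ * X ^ b := by gcongr
    _ = X ^ (-(m : ℝ)) := by
        rw [← hab, Real.rpow_neg hX.le, Real.rpow_natCast, pow_add]
        field_simp
    _ ≤ X ^ (-r) := Real.rpow_le_rpow_of_exponent_ge hX hX1 (by linarith)

/-! ### Monomials against the kernel, and expansion across the layer -/

theorem MomentKernel.exists_norm_integral_monomial_le {m : ℕ} (s g : ℕ) {r r₀ : ℝ}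
    (hr : (m : ℝ) < r) (hr₀ : 0 < r₀) (hr₀1 : r₀ ≤ 1 / 2) : ∃ C, 0 ≤ C ∧
    ∀ (N : ℕ) (F : Sp (m + 1) → ℂ) (CF : ℝ) (L : Sp m →L[ℝ] ℝ) (w : Sp (m + 1)) (ρ : ℝ)
      (γ : Fin m → ℕ), MomentKernel N s F → 0 ≤ CF →
      (∀ v, v ≠ 0 → ‖F v‖ ≤ CF * (‖v‖ ^ (m + 1 + s))⁻¹) → 0 < ρ → ρ ≤ 1 / 2 →
      (∀ y, ‖y‖ + ρ ≤ 5 * ‖w - emb y (L y)‖) → ∑ i, γ i = g →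
      ‖∫ y in Metric.ball 0 r₀, F (w - emb y (L y)) * ((∏ i, y i ^ γ i : ℝ) : ℂ)‖ ≤
        C * CF * ρ ^ (m - r) := by
  set I₁ := ∫ y : Sp m, (1 + ‖y‖) ^ (-r) with hI₁
  set I₂ := ∫ y in {y : Sp m | r₀ ≤ ‖y‖}, (‖y‖ ^ (m + 1 + s - g))⁻¹ with hI₂
  have hI₁0 : 0 ≤ I₁ := integral_nonneg fun y => by positivity
  have hI₂0 : 0 ≤ I₂ := integral_nonneg fun y => by positivity
  have hmsb : MeasurableSet (Metric.ball (0 : Sp m) r₀) := measurableSet_ball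
  have hcompl : (Metric.ball (0 : Sp m) r₀)ᶜ = {y | r₀ ≤ ‖y‖} := by
    ext y; simp
  refine ⟨5 ^ (m + 1 + s) * (I₁ + I₂), by positivity, ?_⟩
  intro N F CF L w ρ γ hF hCF hb hρ hρ1 hd hγ
  have hne : ∀ y, w - emb y (L y) ≠ 0 := by
    intro y h
    have := hd y
    rw [h, norm_zero, mul_zero] at this
    linarith [norm_nonneg y]
  have hcont : Continuous fun y => F (w - emb y (L y)) * ((∏ i, y i ^ γ i : ℝ) : ℂ) := by
    refine Continuous.mul ?_ (by fun_prop)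
    refine hF.contDiffOn.continuousOn.comp_continuous ?_ hne
    exact continuous_const.sub (continuous_emb.comp (continuous_id.prodMk L.continuous))
  have hbd : ∀ y, ‖F (w - emb y (L y)) * ((∏ i, y i ^ γ i : ℝ) : ℂ)‖ ≤
      CF * 5 ^ (m + 1 + s) * (((‖y‖ + ρ) ^ (m + 1 + s))⁻¹ * ‖y‖ ^ g) := by
    intro y
    rw [norm_mul, Complex.norm_real, Real.norm_eq_abs]
    have h1 := hb _ (hne y)
    have h2 := abs_monomial_le y γ
    rw [hγ] at h2
    have h3 : (‖w - emb y (L y)‖ ^ (m + 1 + s))⁻¹ ≤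
        5 ^ (m + 1 + s) * ((‖y‖ + ρ) ^ (m + 1 + s))⁻¹ := by
      rw [← div_eq_mul_inv, ← div_pow, ← inv_pow, inv_eq_one_div]
      have hX : 0 < ‖y‖ + ρ := by positivity
      refine pow_le_pow_left₀ (by positivity) ?_ _
      rw [div_le_div_iff₀ (norm_pos_iff.2 (hne y)) hX, one_mul]
      exact hd y
    calc _ ≤ (CF * (5 ^ (m + 1 + s) * ((‖y‖ + ρ) ^ (m + 1 + s))⁻¹)) * ‖y‖ ^ g := by
          gcongr
          exact h1.trans (by gcongr)
      _ = _ := by ring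
  have hρ1' : 1 ≤ ρ ^ (m - r) :=
    Real.one_le_rpow_of_pos_of_le_one_of_nonpos hρ (by linarith) (by linarith)
  -- For degree above s the integrand is at most of order −m and absolute values suffice. Otherwise
  -- cancellation over the whole hyperplane is used.
  rcases Nat.lt_or_ge s g with hsg | hsg
  · obtain ⟨hw1, hw2⟩ := integrable_weight hr hρ
    have h1 : ‖∫ y in Metric.ball 0 r₀, F (w - emb y (L y)) * ((∏ i, y i ^ γ i : ℝ) : ℂ)‖ ≤
        ∫ y in Metric.ball (0 : Sp m) r₀, CF * 5 ^ (m + 1 + s) * (‖y‖ + ρ) ^ (-r) := by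
      refine norm_integral_le_of_norm_le (hw1.const_mul _).integrableOn ?_
      refine (ae_restrict_iff' hmsb).2 (Eventually.of_forall fun y hy => ?_)
      refine (hbd y).trans ?_
      gcongr
      have hy : ‖y‖ < r₀ := by simpa using hy
      exact inv_pow_mul_pow_le_weight (m := m) (b := s + 1) (by ring) (norm_nonneg y)
        (by linarith) (by positivity) (by linarith) hr.le hsg
    have h2 : ∫ y in Metric.ball (0 : Sp m) r₀, CF * 5 ^ (m + 1 + s) * (‖y‖ + ρ) ^ (-r) ≤
        ∫ y : Sp m, CF * 5 ^ (m + 1 + s) * (‖y‖ + ρ) ^ (-r) :=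
      setIntegral_le_integral (hw1.const_mul _) (Eventually.of_forall fun y => by positivity)
    have h3 : ∫ y : Sp m, CF * 5 ^ (m + 1 + s) * (‖y‖ + ρ) ^ (-r) =
        CF * 5 ^ (m + 1 + s) * (ρ ^ (m - r) * I₁) := by rw [integral_const_mul, hw2]
    rw [h3] at h2
    refine (h1.trans h2).trans ?_
    have : 0 ≤ 5 ^ (m + 1 + s) * I₂ * CF * ρ ^ (m - r) := by positivity
    nlinarith [this]
  · have hw : graphFunctional L w ≠ 0 := by
      intro h
      refine hne (horizontal w) ?_
      conv_lhs => enter [1]; rw [← emb_horizontal_vertical w]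
      have : vertical w = L (horizontal w) := by
        have h2 : vertical w - L (horizontal w) = 0 := by simpa [graphFunctional] using h
        linarith
      rw [this, sub_self]
    have hz := hF.integral_hyperplane_monomial L hw γ (hγ.trans_le hsg)
    have hb2 : ∀ y ∈ {y : Sp m | r₀ ≤ ‖y‖},
        ‖F (w - emb y (L y)) * ((∏ i, y i ^ γ i : ℝ) : ℂ)‖ ≤
        CF * 5 ^ (m + 1 + s) * (‖y‖ ^ (m + 1 + s - g))⁻¹ := by
      intro y hy
      have hy : 0 < ‖y‖ := hr₀.trans_le hy
      refine (hbd y).trans ?_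
      gcongr
      have e : ‖y‖ ^ (m + 1 + s) = ‖y‖ ^ (m + 1 + s - g) * ‖y‖ ^ g := by
        rw [← pow_add]; congr 1; omega
      calc ((‖y‖ + ρ) ^ (m + 1 + s))⁻¹ * ‖y‖ ^ g ≤ (‖y‖ ^ (m + 1 + s))⁻¹ * ‖y‖ ^ g := by
            gcongr; linarith
        _ = (‖y‖ ^ (m + 1 + s - g))⁻¹ := by rw [e]; field_simp
    have hmsc : MeasurableSet {y : Sp m | r₀ ≤ ‖y‖} := hcompl ▸ hmsb.compl
    have hio := (integrableOn_inv_norm_pow (d := m) (k := m + 1 + s - g) (by omega) hr₀).const_mul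
      (CF * 5 ^ (m + 1 + s))
    have hi2 : IntegrableOn (fun y => F (w - emb y (L y)) * ((∏ i, y i ^ γ i : ℝ) : ℂ))
        {y : Sp m | r₀ ≤ ‖y‖} :=
      hio.mono' hcont.aestronglyMeasurable
        ((ae_restrict_iff' hmsc).2 (Eventually.of_forall hb2))
    have hi1 : IntegrableOn (fun y => F (w - emb y (L y)) * ((∏ i, y i ^ γ i : ℝ) : ℂ))
        (Metric.ball (0 : Sp m) r₀) :=
      (hcont.continuousOn.integrableOn_compact (isCompact_closedBall (0 : Sp m) r₀)).mono_set
        Metric.ball_subset_closedBall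
    have hi : Integrable (fun y => F (w - emb y (L y)) * ((∏ i, y i ^ γ i : ℝ) : ℂ)) := by
      rw [← integrableOn_univ, ← union_compl_self (Metric.ball (0 : Sp m) r₀), hcompl]
      exact hi1.union hi2
    have hsplit := integral_add_compl hmsb hi
    rw [hz, hcompl] at hsplit
    -- The ball integral is minus the exterior one, where decay of order m + 1 + s − g > m gives a
    -- bound independent of ρ; it is then below a multiple of ρ^(m − r) ≥ 1.
    rw [eq_neg_of_add_eq_zero_left hsplit, norm_neg]
    have h1 := norm_integral_le_of_norm_le hio ((ae_restrict_iff' hmsc).2 (Eventually.of_forall hb2))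
    rw [integral_const_mul] at h1
    refine h1.trans ?_
    calc CF * 5 ^ (m + 1 + s) * I₂ ≤ CF * 5 ^ (m + 1 + s) * (I₁ + I₂) * 1 := by
          rw [mul_one]; gcongr; linarith
      _ ≤ CF * 5 ^ (m + 1 + s) * (I₁ + I₂) * ρ ^ (m - r) := by gcongr
      _ = _ := by ring

theorem MomentKernel.dirD_of_le {m N : ℕ} {K : Sp (m + 1) → ℂ} (hK : MomentKernel N 0 K)
    (vs : List (Sp (m + 1))) (hvs : vs.length ≤ N) :
    MomentKernel (N - vs.length) vs.length (CZDomain.dirD vs K) := by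
  have := MomentKernel.dirD (N := N - vs.length) (s := 0) vs (K := K)
    (by rwa [Nat.sub_add_cancel hvs])
  rwa [zero_add] at this

/-- Split the segment at p: Taylor's formula applies on [0, p], and [p, a] is bounded by its length.
The segment is shorter than a quarter of the distance from u to the pole, so the kernel bounds hold
along it with comparable constants. -/
theorem norm_segment_integral_sub_le {m n : ℕ} (hn : 1 ≤ n) {K : Sp (m + 1) → ℂ} {CK : ℝ}
    (hCK : 0 ≤ CK) (hK : MomentKernel (2 * n - 1) 0 K) (hb : KernelBound (2 * n - 1) CK K)
    {vs : List (Sp (m + 1))} (hvs : vs.length = n) (hvs1 : ∀ v ∈ vs, ‖v‖ ≤ 1) {e : Sp (m + 1)}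
    (he : ‖e‖ ≤ 1) {u : Sp (m + 1)} {X p a : ℝ} (hX : 0 < X) (hu : X ≤ 5 * ‖u‖)
    (hp : |p| ≤ X / 20) (ha : |a| ≤ X / 20) :
    ‖(∫ s in (0 : ℝ)..a, dirD vs K (u - s • e)) -
      ∑ j ∈ Finset.range (n - 1), ((p ^ (j + 1) / (j + 1).factorial : ℝ) : ℂ) *
        dirD (List.replicate j (-e) ++ vs) K u‖ ≤
      CK * (10 ^ (m + 1 + n) * (X ^ (m + 1 + n))⁻¹) * |a - p| +
        CK * (10 ^ (m + 2 * n) * (X ^ (m + 2 * n))⁻¹) * |p| ^ n := by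
  have hfar : ∀ s : ℝ, |s| ≤ X / 20 → X / 10 ≤ ‖u - s • e‖ := by
    intro s hs
    have h1 : ‖s • e‖ ≤ X / 20 := by
      rw [norm_smul, Real.norm_eq_abs]
      exact (mul_le_of_le_one_right (abs_nonneg s) he).trans hs
    have := norm_sub_norm_le u (s • e)
    linarith
  have hne : ∀ s : ℝ, |s| ≤ X / 20 → u - s • e ≠ 0 := by
    intro s hs h
    have := hfar s hs
    rw [h, norm_zero] at this
    linarith
  have hbound : ∀ ws : List (Sp (m + 1)), ws.length ≤ 2 * n - 1 → (∀ v ∈ ws, ‖v‖ ≤ 1) →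
      ∀ s : ℝ, |s| ≤ X / 20 → ‖dirD ws K (u - s • e)‖ ≤
        CK * (10 ^ (m + 1 + ws.length) * (X ^ (m + 1 + ws.length))⁻¹) := by
    intro ws hws hws1 s hs
    refine (hb ws hws hws1 _ (hne s hs)).trans ?_
    gcongr
    rw [← div_eq_mul_inv, ← div_pow, ← inv_pow]
    refine pow_le_pow_left₀ (by positivity) ?_ _
    have h1 := hfar s hs
    rw [inv_eq_one_div, div_le_div_iff₀ (by linarith) hX]
    linarith
  have hlen : ∀ j, (List.replicate j (-e) ++ vs).length = j + n := by intro j; simp [hvs]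
  have hmem : ∀ j, ∀ v ∈ List.replicate j (-e) ++ vs, ‖v‖ ≤ 1 := by
    intro j v hv
    rcases List.mem_append.1 hv with h | h
    · rw [List.eq_of_mem_replicate h, norm_neg]; exact he
    · exact hvs1 v h
  set τ : ℕ → ℝ → ℂ := fun j s => dirD (List.replicate j (-e) ++ vs) K (u - s • e) with hτ
  have habs : ∀ b : ℝ, |b| ≤ X / 20 → ∀ s ∈ uIcc 0 b, |s| ≤ X / 20 := by
    intro b hb s hs
    have := abs_sub_left_of_mem_uIcc hs
    simp only [sub_zero] at this
    exact this.trans hb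
  have hline : Continuous fun s : ℝ => u - s • e := by fun_prop
  have hcont : ∀ j, j + n ≤ 2 * n - 1 → ContinuousOn (τ j) {s | |s| ≤ X / 20} := by
    intro j hj
    have hM := hK.dirD_of_le (List.replicate j (-e) ++ vs) (by rw [hlen]; exact hj)
    exact hM.contDiffOn.continuousOn.comp hline.continuousOn fun s hs => hne s hs
  have hderiv : ∀ j < n - 1, ∀ s ∈ uIcc 0 p, HasDerivAt (τ j) (τ (j + 1) s) s := by
    intro j hj s hs
    have hM := hK.dirD_of_le (List.replicate j (-e) ++ vs) (by rw [hlen]; omega)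
    rw [hlen] at hM
    have hd : DifferentiableAt ℝ (dirD (List.replicate j (-e) ++ vs) K) (u - s • e) :=
      (hM.contDiffOn.contDiffAt (isOpen_compl_singleton.mem_nhds
        (hne s (habs p hp s hs)))).differentiableAt (by
          have : 2 * n - 1 - (j + n) ≠ 0 := by omega
          exact_mod_cast this)
    have h1 : HasDerivAt (fun s : ℝ => u - s • e) (-e) s := by
      have := ((hasDerivAt_id s).smul_const e).const_sub u
      simpa using this
    have h2 := hd.hasFDerivAt.comp_hasDerivAt s h1
    exact h2
  have hint : ∀ b c : ℝ, |b| ≤ X / 20 → |c| ≤ X / 20 → IntervalIntegrable (τ 0) volume b c := by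
    intro b c hb hc
    refine ((hcont 0 (by omega)).mono fun s hs => ?_).intervalIntegrable
    have h1 := abs_le.1 hb
    have h2 := abs_le.1 hc
    have h3 := uIcc_subset_Icc (a₂ := -(X / 20)) (b₂ := X / 20) (a₁ := b) (b₁ := c)
      ⟨h1.1, h1.2⟩ ⟨h2.1, h2.2⟩ hs
    exact abs_le.2 h3
  have h0 : |(0 : ℝ)| ≤ X / 20 := by rw [abs_zero]; positivity
  -- With n − 1 Taylor terms, the remainder involves order (n − 1) + n = 2n − 1, exactly the
  -- available smoothness.
  have hT := norm_integral_sub_taylor_le (n - 1) τ p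
    (CK * (10 ^ (m + 2 * n) * (X ^ (m + 2 * n))⁻¹)) hderiv
    ((hcont (n - 1) (by omega)).mono fun s hs => habs p hp s hs) (by
      intro s hs
      have := hbound (List.replicate (n - 1) (-e) ++ vs) (by rw [hlen]; omega) (hmem _) s
        (habs p hp s hs)
      rw [hlen, show m + 1 + (n - 1 + n) = m + 2 * n by omega] at this
      exact this)
  rw [Nat.sub_add_cancel hn] at hT
  have hA : ‖∫ s in p..a, τ 0 s‖ ≤ CK * (10 ^ (m + 1 + n) * (X ^ (m + 1 + n))⁻¹) * |a - p| := by
    refine intervalIntegral.norm_integral_le_of_norm_le_const fun s hs => ?_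
    have h1 := abs_le.1 hp
    have h2 := abs_le.1 ha
    have h3 := uIcc_subset_Icc (a₂ := -(X / 20)) (b₂ := X / 20) (a₁ := p) (b₁ := a)
      ⟨h1.1, h1.2⟩ ⟨h2.1, h2.2⟩ (uIoc_subset_uIcc hs)
    have := hbound vs (by omega) hvs1 s (abs_le.2 h3)
    rwa [hvs] at this
  have hsplit := intervalIntegral.integral_add_adjacent_intervals (hint 0 p h0 hp) (hint p a hp ha)
  have e1 : (∫ s in (0 : ℝ)..a, dirD vs K (u - s • e)) = ∫ s in (0 : ℝ)..a, τ 0 s := rfl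
  have e2 : ∀ j, dirD (List.replicate j (-e) ++ vs) K u = τ j 0 := by intro j; simp [hτ]
  simp_rw [e2]
  rw [e1, ← hsplit, add_comm, add_sub_assoc]
  exact (norm_add_le _ _).trans (add_le_add hA hT)

/-! ### The layer between the graph and its tangent hyperplane -/

/-- The polynomial function with coefficients `c` on the index set `S`. -/
def polyOn {m : ℕ} (S : Finset (Fin m →₀ ℕ)) (c : (Fin m →₀ ℕ) → ℝ) (y : Sp m) : ℝ :=
  ∑ γ ∈ S, c γ * ∏ i, y i ^ γ i

/-- Expanding over k-tuples of multi-indices turns each Taylor term into a sum of monomials, to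
which the moment cancellation applies. -/
theorem polyOn_pow {m : ℕ} (S : Finset (Fin m →₀ ℕ)) (c : (Fin m →₀ ℕ) → ℝ) (y : Sp m) (k : ℕ) :
    polyOn S c y ^ k = ∑ p ∈ Fintype.piFinset fun _ : Fin k => S,
      (∏ a, c (p a)) * ∏ i, y i ^ ∑ a, p a i := by
  rw [polyOn, Finset.sum_pow']
  refine Finset.sum_congr rfl fun p _ => ?_
  rw [Finset.prod_mul_distrib, Finset.prod_comm]
  simp_rw [Finset.prod_pow_eq_pow_sum]

theorem abs_polyOn_le {m : ℕ} {S : Finset (Fin m →₀ ℕ)} (hS : ∀ γ ∈ S, 2 ≤ ∑ i, γ i)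
    {c : (Fin m →₀ ℕ) → ℝ} {B : ℝ} (hc : ∀ γ ∈ S, |c γ| ≤ B) {y : Sp m} (hy : ‖y‖ ≤ 1) :
    |polyOn S c y| ≤ S.card * B * ‖y‖ ^ 2 := by
  refine (Finset.abs_sum_le_sum_abs _ _).trans ?_
  have : ∀ γ ∈ S, |c γ * ∏ i, y i ^ γ i| ≤ B * ‖y‖ ^ 2 := by
    intro γ hγ
    rw [abs_mul]
    have hB : 0 ≤ B := (abs_nonneg _).trans (hc γ hγ)
    exact mul_le_mul (hc γ hγ) ((abs_monomial_le y _).trans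
      (pow_le_pow_of_le_one (norm_nonneg y) hy (hS γ hγ))) (abs_nonneg _) hB
  refine (Finset.sum_le_sum this).trans (le_of_eq ?_)
  rw [Finset.sum_const, nsmul_eq_mul, mul_assoc]

theorem continuous_polyOn {m : ℕ} (S : Finset (Fin m →₀ ℕ)) (c : (Fin m →₀ ℕ) → ℝ) :
    Continuous (polyOn S c) := by
  unfold polyOn
  fun_prop

/-- The contribution of the region between the graphs of `A` and of the linear map `L` near the
boundary point. -/
theorem exists_norm_graph_integral_le {m n : ℕ} (hn : 1 < n) {q r₀ B CA CW CK : ℝ}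
    (hq1 : q < n + 1) (hr₀ : 0 < r₀) (hr₀1 : r₀ ≤ 1 / 2) (hB : 0 ≤ B)
    (hCA : 0 ≤ CA) (hCW : 0 ≤ CW) (hCK : 0 ≤ CK)
    (S : Finset (Fin m →₀ ℕ)) (hS : ∀ γ ∈ S, 2 ≤ ∑ i, γ i) :
    ∃ C, 0 ≤ C ∧ ∀ (K : Sp (m + 1) → ℂ) (A : Sp m → ℝ) (L : Sp m →L[ℝ] ℝ)
      (c : (Fin m →₀ ℕ) → ℝ) (w : Sp (m + 1)) (ρ W : ℝ) (vs : List (Sp (m + 1))),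
      MomentKernel (2 * n - 1) 0 K → KernelBound (2 * n - 1) CK K →
      vs.length = n → (∀ v ∈ vs, ‖v‖ ≤ 1) → 0 < ρ → ρ ≤ 1 / 2 → 1 ≤ CW * W →
      (∀ γ ∈ S, |c γ| ≤ B) →
      (∀ y, ‖y‖ + ρ ≤ 5 * ‖w - emb y (L y)‖) →
      (∀ y, ‖y‖ < r₀ → |polyOn S c y| ≤ ‖y‖ / 20) →
      (∀ y, ‖y‖ < r₀ → |A y - L y| ≤ ‖y‖ / 20) →
      (∀ y, ‖y‖ < r₀ → |A y - L y - polyOn S c y| ≤ CA * W * (‖y‖ + ρ) ^ q) →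
      ‖∫ y in Metric.ball 0 r₀, ∫ t in L y..A y, dirD vs K (w - emb y t)‖ ≤
        C * W * ρ ^ (q - n - 1) := by
  -- This is the order left when growth (|y| + ρ)^q meets a kernel of order m + 1 + n. It exceeds m
  -- because q < n + 1, and m − r = q − n − 1 is the exponent in the conclusion.
  set r : ℝ := m + 1 + n - q with hr
  have hrm : (m : ℝ) < r := by rw [hr]; linarith
  choose Cm hCm0 hCm using fun s g : ℕ =>
    MomentKernel.exists_norm_integral_monomial_le (m := m) s g hrm hr₀ hr₀1
  set I₁ := ∫ y : Sp m, (1 + ‖y‖) ^ (-r) with hI₁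
  have hI₁0 : 0 ≤ I₁ := integral_nonneg fun y => by positivity
  -- The first summand comes from replacing A − L by the polynomial, the second from the Taylor
  -- remainder.
  set E₁ : ℝ := CK * 10 ^ (m + 1 + n) * CA + CK * 10 ^ (m + 2 * n) * (S.card * B) ^ n * CW with hE₁
  have hE₁0 : 0 ≤ E₁ := by positivity
  set M₁ : ℝ := ∑ j ∈ Finset.range (n - 1), ∑ p ∈ Fintype.piFinset fun _ : Fin (j + 1) => S,
    B ^ (j + 1) * (Cm (j + n) (∑ i, ∑ a, p a i) * CK) with hM₁
  have hM₁0 : 0 ≤ M₁ := Finset.sum_nonneg fun j _ => Finset.sum_nonneg fun p _ => by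
    have := hCm0 (j + n) (∑ i, ∑ a, p a i)
    positivity
  refine ⟨E₁ * I₁ + M₁ * CW, by positivity, ?_⟩
  intro K A L c w ρ W vs hK hb hvs hvs1 hρ hρ1 hW hc hd hP hA hAP
  have hWpos : 0 < W := by
    by_contra h
    have := mul_nonpos_of_nonneg_of_nonpos hCW (not_lt.1 h)
    linarith
  set e : Sp (m + 1) := emb 0 1 with he
  have he1 : ‖e‖ ≤ 1 := by
    refine (norm_emb_le _ _).trans ?_
    simp
  set G : Sp m → ℂ := fun y => ∫ t in L y..A y, dirD vs K (w - emb y t) with hG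
  set T : Sp m → ℂ := fun y => ∑ j ∈ Finset.range (n - 1),
    ((polyOn S c y ^ (j + 1) / (j + 1).factorial : ℝ) : ℂ) *
      dirD (List.replicate j (-e) ++ vs) K (w - emb y (L y)) with hT
  have hne : ∀ y, w - emb y (L y) ≠ 0 := by
    intro y h
    have := hd y
    rw [h, norm_zero, mul_zero] at this
    linarith [norm_nonneg y]
  have hlen : ∀ j, (List.replicate j (-e) ++ vs).length = j + n := by intro j; simp [hvs]
  have hmem : ∀ j, ∀ v ∈ List.replicate j (-e) ++ vs, ‖v‖ ≤ 1 := by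
    intro j v hv
    rcases List.mem_append.1 hv with h | h
    · rw [List.eq_of_mem_replicate h, norm_neg]; exact he1
    · exact hvs1 v h
  have hkcont : ∀ j, j + n ≤ 2 * n - 1 →
      Continuous fun y => dirD (List.replicate j (-e) ++ vs) K (w - emb y (L y)) := by
    intro j hj
    have hM := hK.dirD_of_le (List.replicate j (-e) ++ vs) (by rw [hlen]; exact hj)
    refine hM.contDiffOn.continuousOn.comp_continuous ?_ hne
    exact continuous_const.sub (continuous_emb.comp (continuous_id.prodMk L.continuous))
  have hpt : ∀ y, ‖y‖ < r₀ → ‖G y - T y‖ ≤ E₁ * W * (‖y‖ + ρ) ^ (-r) := by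
    intro y hy
    have hX : 0 < ‖y‖ + ρ := by positivity
    set X := ‖y‖ + ρ with hXdef
    have hyX : ‖y‖ ≤ X := by linarith
    have hX1 : X ≤ 1 := by linarith
    have h1 := norm_segment_integral_sub_le (by omega) hCK hK hb hvs hvs1 he1 hX (hd y)
      ((hP y hy).trans (by linarith)) ((hA y hy).trans (by linarith))
    have h2 : (∫ s in (0 : ℝ)..(A y - L y), dirD vs K (w - emb y (L y) - s • e)) = G y := by
      have h3 : ∀ s : ℝ, w - emb y (L y) - s • e = w - emb y (L y + s) := by
        intro s
        rw [he, ← emb_smul, smul_zero, mul_one, sub_sub, ← emb_add, add_zero]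
      simp_rw [h3]
      rw [intervalIntegral.integral_comp_add_left fun t => dirD vs K (w - emb y t)]
      simp [hG]
    rw [h2] at h1
    refine h1.trans ?_
    have h4 : (X ^ (m + 1 + n))⁻¹ * X ^ q = X ^ (-r) := by
      rw [← Real.rpow_natCast, ← Real.rpow_neg hX.le, ← Real.rpow_add hX, hr]
      congr 1; push_cast; ring
    have h5 : |polyOn S c y| ^ n ≤ (S.card * B) ^ n * ‖y‖ ^ (2 * n) := by
      rw [pow_mul, ← mul_pow]
      exact pow_le_pow_left₀ (abs_nonneg _) (abs_polyOn_le hS hc (by linarith)) n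
    -- As p is quadratic at the origin, |p|ⁿ supplies |y|^(2n), lowering the order m + 2n of the
    -- kernel derivative to m.
    have h6 : (X ^ (m + 2 * n))⁻¹ * ‖y‖ ^ (2 * n) ≤ X ^ (-r) :=
      inv_pow_mul_pow_le_weight (by ring) (norm_nonneg y) hyX hX hX1 hrm.le le_rfl
    have hXr : 0 < X ^ (-r) := by positivity
    calc CK * (10 ^ (m + 1 + n) * (X ^ (m + 1 + n))⁻¹) * |A y - L y - polyOn S c y| +
          CK * (10 ^ (m + 2 * n) * (X ^ (m + 2 * n))⁻¹) * |polyOn S c y| ^ n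
        ≤ CK * (10 ^ (m + 1 + n) * (X ^ (m + 1 + n))⁻¹) * (CA * W * X ^ q) +
          CK * (10 ^ (m + 2 * n) * (X ^ (m + 2 * n))⁻¹) *
            ((S.card * B) ^ n * ‖y‖ ^ (2 * n)) := by
          gcongr
          exact hAP y hy
      _ = CK * 10 ^ (m + 1 + n) * CA * W * ((X ^ (m + 1 + n))⁻¹ * X ^ q) +
          CK * 10 ^ (m + 2 * n) * (S.card * B) ^ n *
            ((X ^ (m + 2 * n))⁻¹ * ‖y‖ ^ (2 * n)) * 1 := by ring
      _ ≤ CK * 10 ^ (m + 1 + n) * CA * W * X ^ (-r) +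
          CK * 10 ^ (m + 2 * n) * (S.card * B) ^ n * X ^ (-r) * (CW * W) := by
          rw [h4]
          gcongr
      _ = E₁ * W * X ^ (-r) := by rw [hE₁]; ring
  have hTI : ‖∫ y in Metric.ball 0 r₀, T y‖ ≤ M₁ * ρ ^ (m - r) := by
    have hterm : ∀ y, T y = ∑ j ∈ Finset.range (n - 1),
        ∑ p ∈ Fintype.piFinset fun _ : Fin (j + 1) => S,
        (((∏ a, c (p a)) / (j + 1).factorial : ℝ) : ℂ) *
          (dirD (List.replicate j (-e) ++ vs) K (w - emb y (L y)) *
            ((∏ i, y i ^ (∑ a, p a i) : ℝ) : ℂ)) := by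
      intro y
      refine Finset.sum_congr rfl fun j _ => ?_
      rw [polyOn_pow, Finset.sum_div, Complex.ofReal_sum, Finset.sum_mul]
      refine Finset.sum_congr rfl fun p _ => ?_
      push_cast
      ring
    have hint : ∀ j ∈ Finset.range (n - 1), ∀ p : Fin (j + 1) → Fin m →₀ ℕ,
        Integrable (fun y => (((∏ a, c (p a)) / (j + 1).factorial : ℝ) : ℂ) *
          (dirD (List.replicate j (-e) ++ vs) K (w - emb y (L y)) *
            ((∏ i, y i ^ (∑ a, p a i) : ℝ) : ℂ))) (volume.restrict (Metric.ball (0 : Sp m) r₀)) := by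
      intro j hj p
      have hj := Finset.mem_range.1 hj
      have hcc : Continuous fun y => (((∏ a, c (p a)) / (j + 1).factorial : ℝ) : ℂ) *
          (dirD (List.replicate j (-e) ++ vs) K (w - emb y (L y)) *
            ((∏ i, y i ^ (∑ a, p a i) : ℝ) : ℂ)) :=
        continuous_const.mul ((hkcont j (by omega)).mul (by fun_prop))
      exact (hcc.continuousOn.integrableOn_compact (isCompact_closedBall (0 : Sp m) r₀)).mono_set
        Metric.ball_subset_closedBall
    simp_rw [hterm]
    rw [integral_finsetSum _ fun j hj => integrable_finsetSum _ fun p _ => hint j hj p, hM₁,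
      Finset.sum_mul]
    refine (norm_sum_le _ _).trans (Finset.sum_le_sum fun j hj => ?_)
    rw [integral_finsetSum _ fun p _ => hint j hj p, Finset.sum_mul]
    refine (norm_sum_le _ _).trans (Finset.sum_le_sum fun p hp => ?_)
    have hj := Finset.mem_range.1 hj
    rw [integral_const_mul, norm_mul, Complex.norm_real, Real.norm_eq_abs, mul_assoc]
    have h1 : |(∏ a, c (p a)) / (j + 1).factorial| ≤ B ^ (j + 1) := by
      rw [abs_div, Finset.abs_prod, Nat.abs_cast]
      have h2 : ∏ a, |c (p a)| ≤ B ^ (j + 1) := by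
        refine (Finset.prod_le_prod (fun _ _ => abs_nonneg _)
          fun a _ => hc _ (Fintype.mem_piFinset.1 hp a)).trans (le_of_eq ?_)
        simp
      refine (div_le_self (Finset.prod_nonneg fun _ _ => abs_nonneg _) ?_).trans h2
      exact_mod_cast Nat.one_le_iff_ne_zero.2 (Nat.factorial_ne_zero _)
    refine mul_le_mul h1 ?_ (norm_nonneg _) (by positivity)
    have hM := hK.dirD_of_le (List.replicate j (-e) ++ vs) (by rw [hlen]; omega)
    rw [hlen] at hM
    exact hCm (j + n) _ _ _ CK L w ρ _ hM hCK (fun v hv => by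
      have := hb (List.replicate j (-e) ++ vs) (by rw [hlen]; omega) (hmem j) v hv
      rwa [hlen] at this) hρ hρ1 hd rfl
  have hmr : (m : ℝ) - r = q - n - 1 := by rw [hr]; ring
  rw [hmr] at hTI
  by_cases hGi : IntegrableOn G (Metric.ball 0 r₀)
  · have hTi : IntegrableOn T (Metric.ball 0 r₀) := by
      have hTc : Continuous T := by
        refine continuous_finsetSum _ fun j hj => ?_
        have hj := Finset.mem_range.1 hj
        refine Continuous.mul ?_ (hkcont j (by omega))
        have := continuous_polyOn S c
        fun_prop
      exact (hTc.continuousOn.integrableOn_compact (isCompact_closedBall (0 : Sp m) r₀)).mono_set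
        Metric.ball_subset_closedBall
    have hsplit : ∫ y in Metric.ball 0 r₀, G y =
        (∫ y in Metric.ball 0 r₀, (G y - T y)) + ∫ y in Metric.ball 0 r₀, T y := by
      rw [integral_sub hGi hTi]; ring
    obtain ⟨hw1, hw2⟩ := integrable_weight hrm hρ
    have h1 : ‖∫ y in Metric.ball 0 r₀, (G y - T y)‖ ≤
        ∫ y in Metric.ball (0 : Sp m) r₀, E₁ * W * (‖y‖ + ρ) ^ (-r) := by
      refine norm_integral_le_of_norm_le (hw1.const_mul _).integrableOn ?_
      refine (ae_restrict_iff' measurableSet_ball).2 (Eventually.of_forall fun y hy => ?_)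
      exact hpt y (by simpa using hy)
    have h2 : ∫ y in Metric.ball (0 : Sp m) r₀, E₁ * W * (‖y‖ + ρ) ^ (-r) ≤
        ∫ y : Sp m, E₁ * W * (‖y‖ + ρ) ^ (-r) :=
      setIntegral_le_integral (hw1.const_mul _) (Eventually.of_forall fun y => by positivity)
    have h3 : ∫ y : Sp m, E₁ * W * (‖y‖ + ρ) ^ (-r) = E₁ * W * (ρ ^ (q - n - 1) * I₁) := by
      rw [integral_const_mul, hw2, hmr]
    rw [h3] at h2
    rw [hsplit]
    refine (norm_add_le _ _).trans ?_
    calc _ ≤ E₁ * W * (ρ ^ (q - n - 1) * I₁) + M₁ * ρ ^ (q - n - 1) * 1 := by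
          rw [mul_one]; exact add_le_add (h1.trans h2) hTI
      _ ≤ E₁ * W * (ρ ^ (q - n - 1) * I₁) + M₁ * ρ ^ (q - n - 1) * (CW * W) := by gcongr
      _ = _ := by ring
  -- A non-integrable G has integral 0 by convention, so the bound holds and integrability need not
  -- be assumed.
  · rw [integral_undef hGi, norm_zero]
    positivity

/-! ### Coefficients of the approximating polynomials -/

/-- The multi-indices in `m` variables of degree at most `n`. -/
def multiIndices (m n : ℕ) : Finset (Fin m →₀ ℕ) :=
  (Finset.Iic (Finsupp.equivFunOnFinite.symm fun _ => n)).filter fun γ => ∑ i, γ i ≤ n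

@[simp] theorem mem_multiIndices {m n : ℕ} {γ : Fin m →₀ ℕ} :
    γ ∈ multiIndices m n ↔ ∑ i, γ i ≤ n := by
  simp only [multiIndices, Finset.mem_filter, Finset.mem_Iic, and_iff_right_iff_imp]
  intro h i
  exact (Finset.single_le_sum (fun _ _ => Nat.zero_le _) (Finset.mem_univ i)).trans h

theorem eval_eq_polyOn {m n : ℕ} {P : MvPolynomial (Fin m) ℝ} (hP : P.totalDegree ≤ n) (y : Sp m) :
    MvPolynomial.eval (fun i => y i) P = polyOn (multiIndices m n) (fun γ => P.coeff γ) y := by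
  rw [MvPolynomial.eval_eq', polyOn]
  refine Finset.sum_subset (fun γ hγ => ?_) fun γ _ hγ => ?_
  · have := MvPolynomial.le_totalDegree hγ
    rw [Finsupp.sum_fintype _ _ (by simp)] at this
    exact mem_multiIndices.2 (this.trans hP)
  · rw [MvPolynomial.notMem_support_iff.1 hγ, zero_mul]

/-- The coefficients of a polynomial are controlled by its supremum over a cube. -/
theorem exists_coeff_bound (m n : ℕ) {η : ℝ} (hη : 0 < η) : ∃ C, 0 ≤ C ∧
    ∀ (P : MvPolynomial (Fin m) ℝ) (M : ℝ), P.totalDegree ≤ n → 0 ≤ M →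
      (∀ y : Sp m, (∀ i, |y i| ≤ η) → |MvPolynomial.eval (fun i => y i) P| ≤ M) →
      ∀ γ ∈ multiIndices m n, |P.coeff γ| ≤ C * M := by
  let Q : Set (Fin m → ℝ) := Icc (fun _ => -η) (fun _ => η)
  have : CompactSpace Q := isCompact_iff_compactSpace.1 isCompact_Icc
  let Φ : (multiIndices m n → ℝ) →ₗ[ℝ] C(Q, ℝ) :=
    { toFun := fun c => ⟨fun y => ∑ γ : multiIndices m n, c γ * ∏ i, y.1 i ^ γ.1 i,
          continuous_finsetSum _ fun γ _ => continuous_const.mul <| continuous_finsetProd _ fun i _ =>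
            ((continuous_apply i).comp continuous_subtype_val).pow _⟩
      map_add' := fun c c' => by
        ext y; simp [add_mul, Finset.sum_add_distrib]
      map_smul' := fun c c' => by
        ext y; simp [Finset.mul_sum, mul_assoc] }
  -- A polynomial vanishing on a product of infinite sets is zero.
  have hinj : LinearMap.ker Φ = ⊥ := by
    rw [LinearMap.ker_eq_bot']
    intro c hc
    let P : MvPolynomial (Fin m) ℝ := ∑ γ : multiIndices m n, MvPolynomial.monomial γ.1 (c γ)
    have hP : P = 0 := by
      refine MvPolynomial.funext_set (fun _ => Icc (-η) η) (fun _ => ?_) fun x hx => ?_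
      · exact Icc_infinite (by linarith)
      · have hxQ : x ∈ Q := ⟨fun i => (hx i (mem_univ i)).1, fun i => (hx i (mem_univ i)).2⟩
        have := congrArg (fun f : C(Q, ℝ) => f ⟨x, hxQ⟩) hc
        simp only [Φ, LinearMap.coe_mk, AddHom.coe_mk, ContinuousMap.coe_mk,
          ContinuousMap.zero_apply] at this
        rw [map_zero, ← this, map_sum]
        refine Finset.sum_congr rfl fun γ _ => ?_
        rw [MvPolynomial.eval_monomial, Finsupp.prod_fintype _ _ (by simp)]
    ext γ
    have h1 := congrArg (MvPolynomial.coeff γ.1) hP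
    rw [MvPolynomial.coeff_sum, MvPolynomial.coeff_zero] at h1
    simp_rw [MvPolynomial.coeff_monomial] at h1
    rw [Finset.sum_eq_single γ] at h1
    · simpa using h1
    · intro b _ hb
      rw [if_neg fun h => hb (Subtype.ext h)]
    · intro h; exact absurd (Finset.mem_univ _) h
  -- An injective linear map on a finite-dimensional space is bounded below, which gives one
  -- constant for all polynomials of degree at most n.
  obtain ⟨K, -, hK⟩ := LinearMap.exists_antilipschitzWith Φ hinj
  refine ⟨K, K.2, fun P M hP hM hb γ hγ => ?_⟩
  set c : multiIndices m n → ℝ := fun γ => P.coeff γ.1 with hc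
  have h1 := hK.le_mul_dist c 0
  rw [map_zero, dist_zero_right, dist_zero_right] at h1
  have h2 : ‖Φ c‖ ≤ M := by
    rw [ContinuousMap.norm_le _ hM]
    intro y
    have h3 := hb (WithLp.toLp 2 y.1) fun i => abs_le.2 ⟨y.2.1 i, y.2.2 i⟩
    rw [eval_eq_polyOn hP, polyOn, ← Finset.sum_coe_sort] at h3
    exact h3
  calc |P.coeff γ| = ‖c ⟨γ, hγ⟩‖ := rfl
    _ ≤ ‖c‖ := norm_le_pi_norm c _
    _ ≤ K * ‖Φ c‖ := h1
    _ ≤ K * M := by gcongr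

/-- The multi-indices of degree between `2` and `n`. -/
def higherIndices (m n : ℕ) : Finset (Fin m →₀ ℕ) :=
  (multiIndices m n).filter fun γ => 2 ≤ ∑ i, γ i

/-- The linear form with coefficients `c`. -/
def linearPart {m : ℕ} (c : Fin m → ℝ) : Sp m →L[ℝ] ℝ :=
  ∑ i, c i • (EuclideanSpace.proj i : Sp m →L[ℝ] ℝ)

theorem polyOn_eq_linear_add {m n : ℕ} (hn : 1 ≤ n) (c : (Fin m →₀ ℕ) → ℝ) (h0 : c 0 = 0)
    (y : Sp m) : polyOn (multiIndices m n) c y =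
      linearPart (fun i => c (Finsupp.single i 1)) y + polyOn (higherIndices m n) c y := by
  have h1 : ((multiIndices m n).filter fun γ => ¬ 2 ≤ ∑ i, γ i) =
      insert 0 (Finset.univ.image fun i => Finsupp.single i 1) := by
    ext γ
    simp only [Finset.mem_filter, mem_multiIndices, Finset.mem_insert, Finset.mem_image,
      Finset.mem_univ, true_and, not_le]
    constructor
    · rintro ⟨-, h⟩
      have h : ∑ i, γ i = 0 ∨ ∑ i, γ i = 1 := by omega
      rcases h with h | h
      · left
        ext i
        exact (Finset.sum_eq_zero_iff.1 h) i (Finset.mem_univ i)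
      · right
        obtain ⟨i, -, hi⟩ := Finset.exists_ne_zero_of_sum_ne_zero (by rw [h]; exact one_ne_zero)
        have h2 := Finset.add_sum_erase Finset.univ γ (Finset.mem_univ i)
        rw [h] at h2
        have h3 : ∑ j ∈ Finset.univ.erase i, γ j = 0 := by omega
        refine ⟨i, ?_⟩
        ext j
        by_cases hj : j = i
        · subst hj
          rw [Finsupp.single_eq_same]; omega
        · rw [Finsupp.single_apply, if_neg (Ne.symm hj)]
          exact ((Finset.sum_eq_zero_iff.1 h3) j
            (Finset.mem_erase.2 ⟨hj, Finset.mem_univ j⟩)).symm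
    · rintro (rfl | ⟨i, rfl⟩)
      · simp
      · have : ∑ j, (Finsupp.single i 1 : Fin m →₀ ℕ) j = 1 := by
          simp [Finsupp.single_apply]
        rw [this]; omega
  have h2 : polyOn (multiIndices m n) c y = polyOn (higherIndices m n) c y +
      ∑ γ ∈ (multiIndices m n).filter (fun γ => ¬ 2 ≤ ∑ i, γ i), c γ * ∏ i, y i ^ γ i := by
    rw [polyOn, polyOn, higherIndices, Finset.sum_filter_add_sum_filter_not]
  rw [h2, h1, Finset.sum_insert, h0, zero_mul, zero_add, Finset.sum_image, add_comm]
  · congr 1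
    simp only [linearPart, _root_.sum_apply, _root_.smul_apply, smul_eq_mul,
      PiLp.proj_apply]
    refine Finset.sum_congr rfl fun i _ => ?_
    congr 1
    rw [Finset.prod_eq_single i]
    · simp
    · intro j _ hj
      rw [Finsupp.single_apply, if_neg (Ne.symm hj), pow_zero]
    · intro h; exact absurd (Finset.mem_univ _) h
  · intro i _ j _ h
    exact Finsupp.single_left_injective one_ne_zero h
  · simp

/-! ### Local frames at boundary points -/

/-- The local description of a domain near a boundary point `a`, in the window `|x'| < r₀`,
`|x_d| < r₁` after the isometry `z ↦ a + U z`. -/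
structure BoundaryFrame {m : ℕ} (n : ℕ) (ω : ℝ → ℝ) (D : Set (Sp (m + 1))) (r₀ r₁ B CA : ℝ)
    (a : Sp (m + 1)) (U : Sp (m + 1) ≃ₗᵢ[ℝ] Sp (m + 1)) (A : Sp m → ℝ) (L : Sp m →L[ℝ] ℝ)
    (c : (Fin m →₀ ℕ) → ℝ) : Prop where
  mem_iff : ∀ y t, ‖y‖ < r₀ → |t| < r₁ → (a + U (emb y t) ∈ D ↔ A y < t)
  coeff_le : ∀ γ ∈ higherIndices m n, |c γ| ≤ B
  poly_le : ∀ y, ‖y‖ < r₀ → |polyOn (higherIndices m n) c y| ≤ ‖y‖ / 20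
  graph_le : ∀ y, ‖y‖ < r₀ → |A y - L y| ≤ ‖y‖ / 20
  approx : ∀ y, ‖y‖ < r₀ → |A y - L y - polyOn (higherIndices m n) c y| ≤ CA * ω ‖y‖
  graph_lt : ∀ y, ‖y‖ < r₀ → |A y| < r₁
  linear_lt : ∀ y, ‖y‖ < r₀ → |L y| < r₁

theorem norm_le_sum_abs {m : ℕ} (y : Sp m) : ‖y‖ ≤ ∑ i, |y i| := by
  rw [EuclideanSpace.norm_eq]
  refine Real.sqrt_le_iff.2 ⟨Finset.sum_nonneg fun _ _ => abs_nonneg _, ?_⟩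
  simp only [Real.norm_eq_abs]
  exact Finset.sum_sq_le_sq_sum_of_nonneg fun _ _ => abs_nonneg _

/-- L is the linear part of the approximating polynomial. On a fixed cube the polynomial is bounded
through the Lipschitz and ω constants, so its coefficients are bounded uniformly over the boundary,
and the window sizes can be chosen independently of the point. -/
theorem IsCOmegaDomain.exists_boundaryFrame {m n : ℕ} (hn : 1 < n) {ω : ℝ → ℝ}
    (hω : IsGrowthFunction n ω) {D : Set (Sp (m + 1))} (hD : IsCOmegaDomain n ω D) :
    ∃ r₀ r₁ B CA : ℝ, 0 < r₀ ∧ r₀ ≤ 1 / 2 ∧ r₀ ≤ r₁ ∧ 0 ≤ B ∧ 0 ≤ CA ∧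
      ∀ a ∈ frontier D, ∃ U A L c, BoundaryFrame n ω D r₀ r₁ B CA a U A L c := by
  obtain ⟨δ, R, C, hR, hfr⟩ := hD.boundary
  obtain ⟨C₃, hC₃, hω3⟩ := hω.exists_le_rpow_three_halves hn
  set η : ℝ := R / 4 with hη
  have hη0 : 0 < η := by positivity
  obtain ⟨Kc, hKc, hcoef⟩ := exists_coeff_bound m n hη0
  set C' : ℝ := max C 0 with hC'
  have hC'0 : 0 ≤ C' := le_max_right _ _
  set M : ℝ := δ * (m * η) + C' * ω (m * η) with hM
  have hωη : 0 ≤ ω (m * η) := hω.nonneg (by positivity)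
  have hM0 : 0 ≤ M := by positivity
  set B : ℝ := Kc * M with hB
  have hB0 : 0 ≤ B := by positivity
  set k : ℝ := (higherIndices m n).card * B with hk
  have hk0 : 0 ≤ k := by positivity
  set s : ℝ := 1 / (40 * (C' * C₃ + 1)) with hs
  have hs0 : 0 < s := by positivity
  -- Besides |y| ≤ 1/2, the constraints keep both graphs inside the window, make the terms of degree
  -- at least 2 at most |y|/40, and, with √|y| ≤ s, do the same for the ω error.
  set r₀ : ℝ := min (min (1 / 2) (R / 2 / (δ + 2))) (min (1 / (40 * (k + 1))) (s ^ 2)) with hr₀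
  have hδ : (0 : ℝ) ≤ δ := δ.2
  have hr₀0 : 0 < r₀ := by rw [hr₀]; positivity
  have hr1 : r₀ ≤ 1 / 2 := (min_le_left _ _).trans (min_le_left _ _)
  have hr2 : r₀ ≤ R / 2 / (δ + 2) := (min_le_left _ _).trans (min_le_right _ _)
  have hr3 : r₀ ≤ 1 / (40 * (k + 1)) := (min_le_right _ _).trans (min_le_left _ _)
  have hr4 : r₀ ≤ s ^ 2 := (min_le_right _ _).trans (min_le_right _ _)
  rw [le_div_iff₀ (by positivity)] at hr2
  have hr2' : r₀ ≤ R / 2 := by nlinarith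
  refine ⟨r₀, R / 2, B, C', hr₀0, hr1, hr2', hB0, hC'0, fun a ha => ?_⟩
  obtain ⟨U, A, P, hA, hmem, hdeg, happ⟩ := hfr a ha
  have happ' : ∀ x' ∈ cube m R, |A x' - MvPolynomial.eval (fun i => x' i) P| ≤ C' * ω ‖x'‖ :=
    fun x' hx' => (happ x' hx').trans
      (mul_le_mul_of_nonneg_right (le_max_left _ _) (hω.nonneg (norm_nonneg _)))
  have hcube : ∀ (y : Sp m) (t : ℝ), y ∈ cube m R → |t| < R / 2 → emb y t ∈ cube (m + 1) R := by
    intro y t hy ht i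
    refine Fin.lastCases ?_ (fun i => ?_) i
    · simpa using ht
    · simpa using hy i
  have hball : ∀ y : Sp m, ‖y‖ < R / 2 → y ∈ cube m R := fun y hy i =>
    (PiLp.norm_apply_le y i).trans_lt hy
  have h0c : (0 : Sp m) ∈ cube m R := hball 0 (by rw [norm_zero]; positivity)
  -- A negative value would put the boundary point in the open set D; a positive one would give it a
  -- neighbourhood missing D.
  have hA0 : A 0 = 0 := by
    have haD : a ∉ D := fun h => (hD.isOpen.frontier_eq ▸ ha).2 h
    have h1 := hmem (emb 0 0) (hcube 0 0 h0c (by rw [abs_zero]; positivity))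
    have h2 : emb (0 : Sp m) 0 = 0 := by
      have := emb_smul (0 : ℝ) (0 : Sp m) 0
      simpa using this
    rw [h2, map_zero, add_zero] at h1
    have h3 : 0 ≤ A 0 := by
      by_contra hneg
      refine haD (h1.2 ?_)
      rw [← h2]
      simpa using hneg
    by_contra hne
    have hpos : 0 < A 0 := lt_of_le_of_ne h3 (Ne.symm hne)
    have hopen : IsOpen {z : Sp (m + 1) | vertical z < A (horizontal z)} :=
      isOpen_lt continuous_vertical (hA.continuous.comp continuous_horizontal)
    have hopen2 : IsOpen {z : Sp (m + 1) | ‖z‖ < R / 2} := isOpen_lt continuous_norm continuous_const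
    have hnhds : ∀ᶠ z in 𝓝 (0 : Sp (m + 1)), a + U z ∉ D := by
      filter_upwards [hopen.mem_nhds (show vertical (0 : Sp (m + 1)) < A (horizontal 0) by
          rw [← h2]; simpa using hpos),
        hopen2.mem_nhds (show ‖(0 : Sp (m + 1))‖ < R / 2 by rw [norm_zero]; positivity)] with z hz hz2
      rw [hmem z fun i => (PiLp.norm_apply_le z i).trans_lt hz2, not_lt]
      exact le_of_lt hz
    have hcont : Tendsto (fun x => U.symm (x - a)) (𝓝 a) (𝓝 0) := by
      have : Continuous fun x => U.symm (x - a) := by fun_prop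
      have h := this.tendsto a
      simpa using h
    have hnotcl : a ∉ closure D := by
      rw [mem_closure_iff_frequently, not_frequently]
      filter_upwards [hcont.eventually hnhds] with x hx
      simpa using hx
    exact hnotcl (frontier_subset_closure ha)
  have hP0 : P.coeff 0 = 0 := by
    have h1 := happ' 0 h0c
    rw [norm_zero, hω.map_zero, mul_zero, hA0, zero_sub, abs_neg] at h1
    have h2 : MvPolynomial.eval (fun i => (0 : Sp m) i) P = P.coeff 0 := by
      have : (fun i => (0 : Sp m) i) = (0 : Fin m → ℝ) := rfl
      rw [this, MvPolynomial.eval_zero, MvPolynomial.constantCoeff_eq]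
    rw [← h2]
    exact abs_eq_zero.1 (le_antisymm h1 (abs_nonneg _))
  have hAle : ∀ y, |A y| ≤ δ * ‖y‖ := by
    intro y
    have := hA.dist_le_mul y 0
    rwa [hA0, dist_zero_right, dist_zero_right] at this
  have hcf : ∀ γ ∈ multiIndices m n, |P.coeff γ| ≤ B := by
    refine hcoef P M hdeg hM0 fun y hy => ?_
    have hyn : ‖y‖ ≤ m * η := by
      refine (norm_le_sum_abs y).trans ((Finset.sum_le_sum fun i _ => hy i).trans (le_of_eq ?_))
      simp
    have hyc : y ∈ cube m R := fun i => (hy i).trans_lt (by rw [hη]; linarith)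
    have h1 := happ' y hyc
    have h2 := hAle y
    have h3 : ω ‖y‖ ≤ ω (m * η) :=
      hω.monotoneOn (norm_nonneg y) (mem_Ici.2 (by positivity)) hyn
    have h4 : δ * ‖y‖ ≤ δ * (m * η) := by gcongr
    have h5 : C' * ω ‖y‖ ≤ C' * ω (m * η) := by gcongr
    have h6 := abs_sub_abs_le_abs_sub (MvPolynomial.eval (fun i => y i) P) (A y)
    rw [abs_sub_comm] at h6
    linarith
  set c : (Fin m →₀ ℕ) → ℝ := fun γ => P.coeff γ with hc
  set L : Sp m →L[ℝ] ℝ := linearPart (fun i => c (Finsupp.single i 1)) with hL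
  have heval : ∀ y : Sp m, MvPolynomial.eval (fun i => y i) P =
      L y + polyOn (higherIndices m n) c y := by
    intro y
    rw [eval_eq_polyOn hdeg]
    exact polyOn_eq_linear_add hn.le c hP0 y
  have hcf2 : ∀ γ ∈ higherIndices m n, |c γ| ≤ B := fun γ hγ =>
    hcf γ (Finset.mem_filter.1 hγ).1
  have hpoly : ∀ y, ‖y‖ < r₀ → |polyOn (higherIndices m n) c y| ≤ ‖y‖ / 40 := by
    intro y hy
    have h1 := abs_polyOn_le (S := higherIndices m n) (fun γ hγ => (Finset.mem_filter.1 hγ).2) hcf2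
      (y := y) (by linarith)
    refine h1.trans ?_
    rw [← hk]
    have h2 : ‖y‖ * (40 * (k + 1)) ≤ 1 := by
      rw [le_div_iff₀ (by positivity)] at hr3
      exact (mul_le_mul_of_nonneg_right hy.le (by positivity)).trans hr3
    nlinarith [norm_nonneg y, mul_nonneg hk0 (norm_nonneg y)]
  have hωs : ∀ y : Sp m, ‖y‖ < r₀ → C' * ω ‖y‖ ≤ ‖y‖ / 40 := by
    intro y hy
    have h1 := hω3 ‖y‖ (norm_nonneg y) (by linarith)
    have h2 : ‖y‖ ^ (1 / 2 : ℝ) ≤ s := by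
      rw [← Real.sqrt_eq_rpow]
      exact Real.sqrt_le_iff.2 ⟨hs0.le, hy.le.trans hr4⟩
    have h3 : C' * C₃ * s ≤ 1 / 40 := by
      rw [hs, mul_one_div, div_le_div_iff₀ (by positivity) (by norm_num)]
      linarith
    calc C' * ω ‖y‖ ≤ C' * (C₃ * (‖y‖ * s)) := by
          gcongr
          exact h1.trans (by gcongr)
      _ = ‖y‖ * (C' * C₃ * s) := by ring
      _ ≤ ‖y‖ * (1 / 40) := by gcongr
      _ = ‖y‖ / 40 := by ring
  have happr : ∀ y, ‖y‖ < r₀ → |A y - L y - polyOn (higherIndices m n) c y| ≤ C' * ω ‖y‖ := by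
    intro y hy
    have := happ' y (hball y (hy.trans_le hr2'))
    rwa [heval, ← sub_sub] at this
  have hgraph : ∀ y, ‖y‖ < r₀ → |A y - L y| ≤ ‖y‖ / 20 := by
    intro y hy
    have h1 := happr y hy
    have h2 := hpoly y hy
    have h3 := hωs y hy
    have h4 := abs_sub_abs_le_abs_sub (A y - L y) (polyOn (higherIndices m n) c y)
    linarith
  have hδr : ∀ y : Sp m, ‖y‖ < r₀ → δ * ‖y‖ + ‖y‖ < R / 2 := by
    intro y hy
    have : (δ + 2) * ‖y‖ ≤ (δ + 2) * r₀ := by gcongr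
    rcases (norm_nonneg y).eq_or_lt with h | h
    · rw [← h]; simpa using hR
    · nlinarith
  refine ⟨U, A, L, c, ?_, hcf2, fun y hy => (hpoly y hy).trans ?_, hgraph, happr, ?_, ?_⟩
  · intro y t hy ht
    have := hmem (emb y t) (hcube y t (hball y (hy.trans_le hr2')) ht)
    simpa using this
  · have := norm_nonneg y; linarith
  · intro y hy
    have h1 := hAle y
    have h2 := hδr y hy
    have := norm_nonneg y
    linarith
  · intro y hy
    have h1 := hAle y
    have h2 := hδr y hy
    have h3 := hgraph y hy
    have h4 := norm_nonneg y
    have h5 := abs_sub_abs_le_abs_sub (L y) (A y)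
    rw [abs_sub_comm] at h5
    linarith

/-- The tangent hyperplane stays at distance at least ρ/2 from w. A closer point, lowered by ρ/4,
would still lie in the interior ball and hence in D, yet below the graph of A, which is within 3ρ/40
of the hyperplane there. -/
theorem BoundaryFrame.norm_add_le {m n : ℕ} {ω : ℝ → ℝ} {D : Set (Sp (m + 1))} {r₀ r₁ B CA : ℝ}
    {a : Sp (m + 1)} {U : Sp (m + 1) ≃ₗᵢ[ℝ] Sp (m + 1)} {A : Sp m → ℝ} {L : Sp m →L[ℝ] ℝ}
    {c : (Fin m →₀ ℕ) → ℝ} (hF : BoundaryFrame n ω D r₀ r₁ B CA a U A L c) (hr : r₀ ≤ r₁)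
    {w : Sp (m + 1)} {ρ : ℝ} (hρ : 0 < ρ) (hρr : ρ ≤ r₀ / 4) (hw : ‖w‖ = ρ)
    (hball : ∀ z, ‖z - w‖ < ρ → a + U z ∈ D) (y : Sp m) :
    ‖y‖ + ρ ≤ 5 * ‖w - emb y (L y)‖ := by
  have h1 : ρ / 2 ≤ ‖w - emb y (L y)‖ := by
    by_contra hcon
    rw [not_le] at hcon
    have h2 : ‖emb y (L y)‖ < 3 * ρ / 2 := by
      have := norm_sub_norm_le (emb y (L y)) w
      rw [norm_sub_rev] at this
      linarith
    have h3 : ‖y‖ < 3 * ρ / 2 := (norm_le_norm_emb _ _).trans_lt h2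
    have h4 : |L y| < 3 * ρ / 2 := (abs_le_norm_emb _ _).trans_lt h2
    have h5 : emb y (L y - ρ / 4) = emb y (L y) - emb 0 (ρ / 4) := by rw [← emb_sub, sub_zero]
    have h6 : ‖emb (0 : Sp m) (ρ / 4)‖ ≤ ρ / 4 := by
      refine (norm_emb_le _ _).trans ?_
      rw [norm_zero, zero_add, abs_of_pos (by positivity)]
    have h7 : ‖emb y (L y - ρ / 4) - w‖ < ρ := by
      rw [h5, sub_right_comm]
      have := norm_sub_le (emb y (L y) - w) (emb 0 (ρ / 4))
      rw [norm_sub_rev] at hcon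
      linarith
    have h8 : |L y - ρ / 4| < r₁ := by
      have := abs_sub (L y) (ρ / 4)
      rw [abs_of_pos (by positivity : 0 < ρ / 4)] at this
      linarith
    have h9 := (hF.mem_iff y _ (by linarith) h8).1 (hball _ h7)
    have h10 := hF.graph_le y (by linarith)
    have h11 := (abs_le.1 h10).1
    linarith
  have h2 : ‖y‖ - ρ ≤ ‖w - emb y (L y)‖ := by
    have h3 := norm_sub_norm_le (emb y (L y)) w
    rw [norm_sub_rev] at h3
    have h4 := norm_le_norm_emb y (L y)
    linarith
  -- Write |y| + ρ as (|y| − ρ) + 4(ρ/2); this produces the factor 5.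
  linarith

theorem BoundaryFrame.graphFunctional_pos {m n : ℕ} {ω : ℝ → ℝ} {D : Set (Sp (m + 1))}
    {r₀ r₁ B CA : ℝ}
    {a : Sp (m + 1)} {U : Sp (m + 1) ≃ₗᵢ[ℝ] Sp (m + 1)} {A : Sp m → ℝ} {L : Sp m →L[ℝ] ℝ}
    {c : (Fin m →₀ ℕ) → ℝ} (hF : BoundaryFrame n ω D r₀ r₁ B CA a U A L c) (hr : r₀ ≤ r₁)
    {w : Sp (m + 1)} {ρ : ℝ} (hρ : 0 < ρ) (hρr : ρ ≤ r₀ / 4) (hw : ‖w‖ = ρ)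
    (hball : ∀ z, ‖z - w‖ < ρ → a + U z ∈ D) : 0 < graphFunctional L w := by
  have h0 := hF.norm_add_le hr hρ hρr hw hball (horizontal w)
  have h1 : w - emb (horizontal w) (L (horizontal w)) = emb 0 (graphFunctional L w) := by
    conv_lhs => enter [1]; rw [← emb_horizontal_vertical w]
    rw [← emb_sub, sub_self]
    rfl
  have h2 : ‖emb (0 : Sp m) (graphFunctional L w)‖ ≤ |graphFunctional L w| := by
    refine (norm_emb_le _ _).trans ?_
    rw [norm_zero, zero_add]
  rw [h1] at h0
  have hh : ‖horizontal w‖ ≤ ρ := by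
    have := norm_le_norm_emb (horizontal w) (vertical w)
    rwa [emb_horizontal_vertical, hw] at this
  have hv : |vertical w| ≤ ρ := by
    have := abs_le_norm_emb (horizontal w) (vertical w)
    rwa [emb_horizontal_vertical, hw] at this
  have h3 : A (horizontal w) < vertical w := by
    refine (hF.mem_iff _ _ (by linarith) (by linarith)).1 ?_
    rw [emb_horizontal_vertical]
    exact hball w (by rw [sub_self, norm_zero]; exact hρ)
  have h4 := hF.graph_le (horizontal w) (by linarith)
  by_contra hneg
  rw [not_lt] at hneg
  rw [abs_of_nonpos hneg] at h2
  have h5 : graphFunctional L w = vertical w - L (horizontal w) := by simp [graphFunctional]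
  have h6 := (abs_le.1 h4).1
  linarith

/-! ### The boundary estimate in a frame -/

theorem norm_setIntegral_far_le {d k : ℕ} (hk : d < k) {c C : ℝ} (hc : 0 < c) {F : Sp d → ℂ}
    (hC : 0 ≤ C) (hF : ∀ v, c ≤ ‖v‖ → ‖F v‖ ≤ C * (‖v‖ ^ k)⁻¹) (w : Sp d) {T : Set (Sp d)}
    (hT : MeasurableSet T) (hTc : ∀ z ∈ T, c ≤ ‖w - z‖) :
    ‖∫ z in T, F (w - z)‖ ≤ C * ∫ v in {v : Sp d | c ≤ ‖v‖}, (‖v‖ ^ k)⁻¹ := by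
  have hms : MeasurableSet {v : Sp d | c ≤ ‖v‖} :=
    (isClosed_le continuous_const continuous_norm).measurableSet
  have hi := integrableOn_inv_norm_pow hk hc
  rw [← integrable_indicator_iff hms] at hi
  have hi2 := (hi.comp_sub_left w).const_mul C
  have h1 : ‖∫ z in T, F (w - z)‖ ≤
      ∫ z in T, C * {v : Sp d | c ≤ ‖v‖}.indicator (fun v => (‖v‖ ^ k)⁻¹) (w - z) := by
    refine norm_integral_le_of_norm_le hi2.integrableOn ?_
    refine (ae_restrict_iff' hT).2 (Eventually.of_forall fun z hz => ?_)
    have h2 : w - z ∈ {v : Sp d | c ≤ ‖v‖} := hTc z hz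
    rw [indicator_of_mem h2]
    exact hF _ (hTc z hz)
  have hnn : ∀ v : Sp d, 0 ≤ {v : Sp d | c ≤ ‖v‖}.indicator (fun v => (‖v‖ ^ k)⁻¹) v :=
    fun v => indicator_nonneg (fun v _ => by positivity) v
  have h2 := setIntegral_le_integral (s := T) hi2
    (Eventually.of_forall fun z => mul_nonneg hC (hnn (w - z)))
  refine (h1.trans h2).trans (le_of_eq ?_)
  rw [integral_const_mul, integral_sub_left_eq_self _ volume w, integral_indicator hms]

theorem integrableOn_comp_sub_left {d : ℕ} {F : Sp d → ℂ} {c : ℝ}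
    (hF : IntegrableOn F {v | c ≤ ‖v‖}) (w : Sp d) {T : Set (Sp d)} (hT : MeasurableSet T)
    (hTc : ∀ z ∈ T, c ≤ ‖w - z‖) : IntegrableOn (fun z => F (w - z)) T := by
  have hms : MeasurableSet {v : Sp d | c ≤ ‖v‖} :=
    (isClosed_le continuous_const continuous_norm).measurableSet
  rw [← integrable_indicator_iff hms] at hF
  refine (hF.comp_sub_left w).integrableOn.congr ?_
  refine (ae_restrict_iff' hT).2 (Eventually.of_forall fun z hz => ?_)
  have h2 : w - z ∈ {v : Sp d | c ≤ ‖v‖} := hTc z hz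
  exact indicator_of_mem h2 F

/-- Fubini's theorem for a region below a graph. -/
theorem setIntegral_subgraph {m : ℕ} {h : Sp (m + 1) → ℂ} {T : Set (Sp (m + 1))} {r₀ s : ℝ}
    {b : Sp m → ℝ} (hT : MeasurableSet T)
    (hmem : ∀ y t, emb y t ∈ T ↔ ‖y‖ < r₀ ∧ s < t ∧ t ≤ b y) (hb : ∀ y, ‖y‖ < r₀ → s ≤ b y)
    (hi : IntegrableOn h T) :
    (∫ z in T, h z = ∫ y in Metric.ball 0 r₀, ∫ t in s..b y, h (emb y t)) ∧
      IntegrableOn (fun y => ∫ t in s..b y, h (emb y t)) (Metric.ball 0 r₀) ∧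
      ∀ᵐ y ∂volume.restrict (Metric.ball 0 r₀),
        IntervalIntegrable (fun t => h (emb y t)) volume s (b y) := by
  rw [← integrable_indicator_iff hT, ← integrable_emb_iff] at hi
  have hslice : ∀ y t, T.indicator h (emb y t) =
      (Metric.ball (0 : Sp m) r₀).indicator
        (fun y => (Ioc s (b y)).indicator (fun t => h (emb y t)) t) y := by
    intro y t
    by_cases hy : ‖y‖ < r₀
    · have hy' : y ∈ Metric.ball (0 : Sp m) r₀ := by simpa using hy
      rw [indicator_of_mem hy']
      simp only [indicator, hmem, hy, true_and, mem_Ioc]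
    · have hy' : y ∉ Metric.ball (0 : Sp m) r₀ := by simpa using hy
      have hyT : emb y t ∉ T := by rw [hmem]; tauto
      rw [indicator_of_notMem hy', indicator_of_notMem hyT]
  have hinner : ∀ y, ∫ t, T.indicator h (emb y t) = (Metric.ball (0 : Sp m) r₀).indicator
      (fun y => ∫ t in s..b y, h (emb y t)) y := by
    intro y
    simp_rw [hslice]
    by_cases hy : ‖y‖ < r₀
    · have hy' : y ∈ Metric.ball (0 : Sp m) r₀ := by simpa using hy
      simp_rw [indicator_of_mem hy']
      rw [integral_indicator measurableSet_Ioc, intervalIntegral.integral_of_le (hb y hy)]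
    · have hy' : y ∉ Metric.ball (0 : Sp m) r₀ := by simpa using hy
      simp_rw [indicator_of_notMem hy']
      simp
  refine ⟨?_, ?_, ?_⟩
  · rw [← integral_indicator hT, ← integral_emb, Measure.volume_eq_prod, integral_prod _ hi]
    simp_rw [hinner]
    rw [integral_indicator measurableSet_ball]
  · rw [← integrable_indicator_iff measurableSet_ball]
    have := hi.integral_prod_left
    simp_rw [hinner] at this
    exact this
  · rw [ae_restrict_iff' measurableSet_ball]
    filter_upwards [hi.prod_right_ae] with y hy hyb
    have hy2 : ‖y‖ < r₀ := by simpa using hyb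
    simp_rw [hslice, indicator_of_mem hyb] at hy
    rw [intervalIntegrable_iff_integrableOn_Ioc_of_le (hb y hy2)]
    exact (integrable_indicator_iff measurableSet_Ioc).1 hy

set_option maxHeartbeats 800000 in
/-- The boundary estimate in the coordinates of a boundary frame: the integral of the derivative of
a truncated kernel over the complement of the domain. -/
theorem exists_norm_compl_integral_frame_le {m n : ℕ} (hn : 1 < n)
    {q r₀ r₁ B CA CW CK Cω Cφ : ℝ}
    (hq1 : q < n + 1) (hr₀ : 0 < r₀) (hr₀1 : r₀ ≤ 1 / 2) (hr : r₀ ≤ r₁) (hB : 0 ≤ B)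
    (hCA : 0 ≤ CA) (hCW : 0 ≤ CW) (hCK : 0 ≤ CK) (hCω : 0 ≤ Cω) (hCφ : 0 ≤ Cφ) :
    ∃ C, 0 ≤ C ∧ ∀ (ω : ℝ → ℝ) (D : Set (Sp (m + 1))) (a : Sp (m + 1))
      (U : Sp (m + 1) ≃ₗᵢ[ℝ] Sp (m + 1)) (K fφ : Sp (m + 1) → ℂ) (A : Sp m → ℝ) (L : Sp m →L[ℝ] ℝ)
      (c : (Fin m →₀ ℕ) → ℝ) (w : Sp (m + 1)) (ρ W : ℝ) (vs : List (Sp (m + 1))),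
      IsOpen D → BoundaryFrame n ω D r₀ r₁ B CA a U A L c →
      MomentKernel (2 * n - 1) 0 K → KernelBound (2 * n - 1) CK K →
      vs.length = n → (∀ v ∈ vs, ‖v‖ ≤ 1) → 0 < ρ → ρ ≤ r₀ / 4 → 1 ≤ CW * W →
      (∀ t, 0 ≤ t → ω t ≤ Cω * W * (t + ρ) ^ q) →
      ‖w‖ = ρ → (∀ z, ‖z - w‖ < ρ → a + U z ∈ D) →
      (∀ v, ‖v‖ < 2 * r₀ + r₁ → fφ v = dirD vs K v) →
      (∀ v, r₀ / 2 ≤ ‖v‖ → ‖fφ v‖ ≤ Cφ * (‖v‖ ^ (m + 2))⁻¹) →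
      IntegrableOn fφ {v | ρ ≤ ‖v‖} →
      ‖∫ z in {z | a + U z ∉ D}, fφ (w - z)‖ ≤ C * W * ρ ^ (q - n - 1) := by
  obtain ⟨C₁, hC₁, hloc⟩ := exists_norm_graph_integral_le (m := m) hn hq1 hr₀ hr₀1 hB
    (mul_nonneg hCA hCω) hCW hCK (higherIndices m n) (fun γ hγ => (Finset.mem_filter.1 hγ).2)
  set I₁ := ∫ v in {v : Sp (m + 1) | r₀ / 2 ≤ ‖v‖}, (‖v‖ ^ (m + 2))⁻¹ with hI₁
  set I₂ := ∫ v in {v : Sp (m + 1) | r₀ / 2 ≤ ‖v‖}, (‖v‖ ^ (m + 1 + n))⁻¹ with hI₂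
  have hI₁0 : 0 ≤ I₁ := integral_nonneg fun y => by positivity
  have hI₂0 : 0 ≤ I₂ := integral_nonneg fun y => by positivity
  refine ⟨(Cφ * I₁ + CK * I₂) * CW + C₁, by positivity, ?_⟩
  intro ω D a U K fφ A L c w ρ W vs hDo hF hK hb hvs hvs1 hρ hρr hW hω hw hball hφ hφb hφi
  have hWpos : 0 < W := by
    by_contra h
    have := mul_nonpos_of_nonneg_of_nonpos hCW (not_lt.1 h)
    linarith
  have hd := hF.norm_add_le hr hρ hρr hw hball
  have hLw := hF.graphFunctional_pos hr hρ hρr hw hball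
  have hM := hK.dirD_of_le vs (by omega)
  rw [hvs] at hM
  obtain ⟨hHi, hH0⟩ := hM.integral_halfSpace (by omega) L hLw
  set f := dirD vs K with hf
  set Z : Set (Sp (m + 1)) := {z | a + U z ∉ D} with hZ
  set H : Set (Sp (m + 1)) := {y | graphFunctional L y ≤ 0} with hH
  set V : Set (Sp (m + 1)) := {z | ‖horizontal z‖ < r₀ ∧ |vertical z| < r₁} with hV
  have hZm : MeasurableSet Z := by
    have : IsClosed Z := hDo.isClosed_compl.preimage (f := fun z => a + U z) (by fun_prop)
    exact this.measurableSet
  have hHm : MeasurableSet H :=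
    (isClosed_le (graphFunctional L).continuous continuous_const).measurableSet
  have hVm : MeasurableSet V :=
    ((isOpen_lt continuous_horizontal.norm continuous_const).inter
      (isOpen_lt continuous_vertical.abs continuous_const)).measurableSet
  have hVfar : ∀ z, z ∉ V → r₀ / 2 ≤ ‖w - z‖ := by
    intro z hz
    have h1 : r₀ ≤ ‖z‖ := by
      by_contra hlt
      rw [not_le] at hlt
      apply hz
      have h2 := norm_le_norm_emb (horizontal z) (vertical z)
      have h3 := abs_le_norm_emb (horizontal z) (vertical z)
      rw [emb_horizontal_vertical] at h2 h3
      exact ⟨h2.trans_lt hlt, h3.trans_lt (hlt.trans_le hr)⟩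
    have := norm_sub_norm_le z w
    rw [norm_sub_rev] at this
    linarith
  have hVnear : ∀ z ∈ V, ‖w - z‖ < 2 * r₀ + r₁ := by
    intro z hz
    have h1 := norm_emb_le (horizontal z) (vertical z)
    rw [emb_horizontal_vertical] at h1
    have h2 := norm_sub_le w z
    have h3 := hz.1
    have h4 := hz.2
    linarith
  have hZfar : ∀ z ∈ Z, ρ ≤ ‖w - z‖ := by
    intro z hz
    by_contra hlt
    rw [not_le, norm_sub_rev] at hlt
    exact hz (hball z hlt)
  have hZi : IntegrableOn (fun z => fφ (w - z)) Z := integrableOn_comp_sub_left hφi w hZm hZfar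
  have hc0 : 0 < r₀ / 2 := by positivity
  have hfar1 : ‖∫ z in Z \ V, fφ (w - z)‖ ≤ Cφ * I₁ :=
    norm_setIntegral_far_le (by omega) hc0 hCφ hφb w (hZm.diff hVm) fun z hz => hVfar z hz.2
  have hfar2 : ‖∫ z in H \ V, f (w - z)‖ ≤ CK * I₂ := by
    refine norm_setIntegral_far_le (by omega) hc0 hCK (fun v hv => ?_) w (hHm.diff hVm)
      fun z hz => hVfar z hz.2
    have := hb vs (by omega) hvs1 v (norm_pos_iff.1 (hc0.trans_le hv))
    rwa [hvs] at this
  have hZV : ∫ z in Z ∩ V, fφ (w - z) = ∫ z in Z ∩ V, f (w - z) :=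
    setIntegral_congr_fun (hZm.inter hVm) fun z hz => hφ _ (hVnear z hz.2)
  have hZVi : IntegrableOn (fun z => f (w - z)) (Z ∩ V) := by
    refine (hZi.mono_set inter_subset_left).congr_fun (fun z hz => hφ _ (hVnear z hz.2))
      (hZm.inter hVm)
  obtain ⟨hA1, hA2, hA3⟩ := setIntegral_subgraph (h := fun z => f (w - z)) (T := Z ∩ V)
    (r₀ := r₀) (s := -r₁) (b := A) (hZm.inter hVm) (by
      intro y t
      have hgl := hF.graph_lt y
      simp only [hZ, hV, mem_inter_iff, mem_ofPred_eq, horizontal_emb, vertical_emb]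
      constructor
      · rintro ⟨h1, h2, h3⟩
        rw [hF.mem_iff y t h2 h3, not_lt] at h1
        exact ⟨h2, (abs_lt.1 h3).1, h1⟩
      · rintro ⟨h1, h2, h3⟩
        have h4 : |t| < r₁ := abs_lt.2 ⟨h2, h3.trans_lt (abs_lt.1 (hgl h1)).2⟩
        rw [hF.mem_iff y t h1 h4, not_lt]
        exact ⟨h3, h1, h4⟩) (fun y hy => (abs_lt.1 (hF.graph_lt y hy)).1.le) hZVi
  obtain ⟨hL1, hL2, hL3⟩ := setIntegral_subgraph (h := fun z => f (w - z)) (T := H ∩ V)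
    (r₀ := r₀) (s := -r₁) (b := L) (hHm.inter hVm) (by
      intro y t
      have hgl := hF.linear_lt y
      simp only [hH, hV, mem_inter_iff, mem_ofPred_eq, horizontal_emb, vertical_emb,
        graphFunctional_emb, sub_nonpos]
      constructor
      · rintro ⟨h1, h2, h3⟩
        exact ⟨h2, (abs_lt.1 h3).1, h1⟩
      · rintro ⟨h1, h2, h3⟩
        exact ⟨h3, h1, abs_lt.2 ⟨h2, h3.trans_lt (abs_lt.1 (hgl h1)).2⟩⟩)
      (fun y hy => (abs_lt.1 (hF.linear_lt y hy)).1.le) (hHi.mono_set inter_subset_left)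
  -- Inside the window both regions are subgraphs with the same floor −r₁, so their difference is
  -- the signed integral from L to A.
  have hdiff : (∫ z in Z ∩ V, f (w - z)) - ∫ z in H ∩ V, f (w - z) =
      ∫ y in Metric.ball 0 r₀, ∫ t in L y..A y, f (w - emb y t) := by
    rw [hA1, hL1, ← integral_sub hA2 hL2]
    refine integral_congr_ae ?_
    filter_upwards [hA3, hL3] with y h1 h2
    exact intervalIntegral.integral_interval_sub_left h1 h2
  have hZsplit := integral_inter_add_sdiff hVm hZi
  have hHsplit := integral_inter_add_sdiff hVm hHi
  rw [hH0] at hHsplit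
  have hL := hloc K A L c w ρ W vs hK hb hvs hvs1 hρ (by linarith) hW hF.coeff_le hd hF.poly_le
    hF.graph_le (fun y hy => by
      refine (hF.approx y hy).trans ?_
      have := mul_le_mul_of_nonneg_left (hω ‖y‖ (norm_nonneg y)) hCA
      refine this.trans (le_of_eq ?_)
      ring)
  -- The half-space integral is zero, so its window part is minus its far part. The far pieces are
  -- bounded separately, hence the cut and uncut kernels need not agree there.
  have hfinal : ∫ z in Z, fφ (w - z) =
      (∫ z in Z \ V, fφ (w - z)) - (∫ z in H \ V, f (w - z)) +
        ∫ y in Metric.ball 0 r₀, ∫ t in L y..A y, f (w - emb y t) := by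
    rw [← hdiff, ← hZsplit, hZV]
    linear_combination hHsplit
  have hρ1 : 1 ≤ ρ ^ (q - n - 1) :=
    Real.one_le_rpow_of_pos_of_le_one_of_nonpos hρ (by linarith) (by linarith)
  rw [hfinal]
  calc _ ≤ ‖(∫ z in Z \ V, fφ (w - z)) - (∫ z in H \ V, f (w - z))‖ +
        ‖∫ y in Metric.ball 0 r₀, ∫ t in L y..A y, f (w - emb y t)‖ := norm_add_le _ _
    _ ≤ (Cφ * I₁ + CK * I₂) + C₁ * W * ρ ^ (q - n - 1) :=
        add_le_add ((norm_sub_le _ _).trans (add_le_add hfar1 hfar2)) hL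
    _ ≤ (Cφ * I₁ + CK * I₂) * (CW * W) * ρ ^ (q - n - 1) + C₁ * W * ρ ^ (q - n - 1) := by
        refine add_le_add ?_ le_rfl
        have h0 : 0 ≤ Cφ * I₁ + CK * I₂ :=
          add_nonneg (mul_nonneg hCφ hI₁0) (mul_nonneg hCK hI₂0)
        rw [mul_assoc]
        exact le_mul_of_one_le_right h0 (one_le_mul_of_one_le_of_one_le hW hρ1)
    _ = _ := by ring

/-! ### Even Calderón–Zygmund kernels as moment kernels -/

/-- For s = 0 the test functions are continuous and constant along punctured lines through the
origin, hence constant, so the moment condition reduces to zero mean. -/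
theorem momentKernel_zero_of_even {m N : ℕ} {K : Sp (m + 1) → ℂ} (hc : ContDiffOn ℝ N K {0}ᶜ)
    (hh : IsHomog (-(m + 1 : ℤ)) K) (he : ∀ y, y ≠ 0 → K (-y) = K y) (h0 : sphereIntegral K = 0) :
    MomentKernel N 0 K := by
  refine ⟨hc, by simpa using hh, by simpa using he, fun q hq hqh => ?_⟩
  have hconst : ∀ y, q y = q 0 := by
    intro y
    have h1 : Tendsto (fun t : ℝ => q (t • y)) (𝓝[≠] 0) (𝓝 (q 0)) := by
      have : Continuous fun t : ℝ => q (t • y) :=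
        hq.continuous.comp (continuous_id.smul continuous_const)
      have h2 := this.tendsto 0
      rw [zero_smul] at h2
      exact h2.mono_left nhdsWithin_le_nhds
    have h2 : Tendsto (fun t : ℝ => q (t • y)) (𝓝[≠] 0) (𝓝 (q y)) := by
      refine tendsto_const_nhds.congr' ?_
      filter_upwards [self_mem_nhdsWithin] with t ht
      rw [hqh t ht y, pow_zero, one_mul]
    exact tendsto_nhds_unique h2 h1
  unfold sphereIntegral at h0 ⊢
  simp_rw [hconst]
  rw [integral_mul_const, h0, zero_mul]

theorem IsCZKernel.momentKernel {m N : ℕ} {K : Sp (m + 1) → ℂ} (hK : IsCZKernel N K)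
    (he : ∀ x, K (-x) = K x) : MomentKernel N 0 K := by
  obtain ⟨Ω, hΩh, hΩc, hΩ0, hKΩ⟩ := hK
  refine momentKernel_zero_of_even ?_ ?_ (fun y _ => he y) ?_
  · have h1 : ContDiffOn ℝ N (fun x : Sp (m + 1) => Ω x / ((‖x‖ : ℝ) : ℂ) ^ (m + 1)) {0}ᶜ := by
      have hn : ContDiffOn ℝ N (fun x : Sp (m + 1) => ((‖x‖ : ℝ) : ℂ)) {0}ᶜ := fun x hx =>
        (Complex.ofRealCLM.contDiff.contDiffAt.comp x (contDiffAt_norm ℝ hx)).contDiffWithinAt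
      simp_rw [div_eq_mul_inv]
      refine hΩc.mul ((hn.pow _).inv fun x hx => ?_)
      exact pow_ne_zero _ (Complex.ofReal_ne_zero.2 (norm_ne_zero_iff.2 hx))
    exact h1.congr fun x hx => hKΩ x hx
  · intro t ht y hy
    have htc : (t : ℂ) ≠ 0 := by exact_mod_cast ht.ne'
    rw [hKΩ _ (smul_ne_zero ht.ne' hy), hKΩ y hy, hΩh t y ht hy, norm_smul,
      Real.norm_of_nonneg ht.le]
    have e : (-(m + 1 : ℤ)) = -((m + 1 : ℕ) : ℤ) := by push_cast; ring
    rw [e, zpow_neg, zpow_natCast, Complex.ofReal_mul, mul_pow]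
    field_simp
  · unfold sphereIntegral
    rw [← hΩ0]
    refine integral_congr_ae (Eventually.of_forall fun u => ?_)
    have hu : ‖(u : Sp (m + 1))‖ = 1 := by simp
    have hu0 : (u : Sp (m + 1)) ≠ 0 := by intro h; rw [h, norm_zero] at hu; norm_num at hu
    simp [hKΩ _ hu0]

theorem MomentKernel.sphereIntegral_eq_zero {m N : ℕ} {K : Sp (m + 1) → ℂ}
    (hK : MomentKernel N 0 K) : sphereIntegral K = 0 := by
  have := hK.moment (fun _ => 1) contDiff_const (by simp)
  simpa using this

theorem MomentKernel.isHomog_zero {m N : ℕ} {K : Sp (m + 1) → ℂ}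
    (hK : MomentKernel N 0 K) : IsHomog (-(m + 1 : ℤ)) K := by
  simpa using hK.homog

/-- Zero mean is transferred through volume integrals against a radial bump, which are invariant
under isometries. -/
theorem MomentKernel.comp_isometry {m N : ℕ} {K : Sp (m + 1) → ℂ} (hK : MomentKernel N 0 K)
    (U : Sp (m + 1) ≃ₗᵢ[ℝ] Sp (m + 1)) : MomentKernel N 0 fun z => K (U z) := by
  have hU : ∀ y, y ≠ 0 → U y ≠ 0 := fun y hy => by simpa using hy
  have hh : IsHomog (-(m + 1 : ℤ)) fun z => K (U z) := fun t ht y hy => by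
    simp only [map_smul]
    exact hK.isHomog_zero t ht _ (hU y hy)
  refine momentKernel_zero_of_even ?_ hh (fun y hy => ?_) ?_
  · exact hK.contDiffOn.comp U.contDiff.contDiffOn fun y hy => hU y hy
  · have := hK.parity (U y) (hU y hy)
    rw [map_neg]
    simpa using this
  · have h1 := integral_homog_mul_radial hh fun r => ((annulusBump (r ^ 2) : ℝ) : ℂ)
    have h2 := integral_homog_mul_radial hK.isHomog_zero fun r => ((annulusBump (r ^ 2) : ℝ) : ℂ)
    rw [hK.sphereIntegral_eq_zero, zero_mul] at h2
    have h3 := U.measurePreserving.integral_comp U.toHomeomorph.measurableEmbedding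
      fun y => K y * ((annulusBump (‖y‖ ^ 2) : ℝ) : ℂ)
    simp only [U.norm_map] at h3
    rw [h3, h2] at h1
    exact (mul_eq_zero.1 h1.symm).resolve_right integral_annulusBump_ne_zero

theorem KernelBound.comp_isometry {m N : ℕ} {C : ℝ} {K : Sp (m + 1) → ℂ} (hK : KernelBound N C K)
    (U : Sp (m + 1) ≃ₗᵢ[ℝ] Sp (m + 1)) : KernelBound N C fun z => K (U z) := by
  intro vs hvs h1 y hy
  rw [dirD_comp_isometry]
  have := hK (vs.map U) (by simpa using hvs) (by
    intro v hv
    obtain ⟨v', hv', rfl⟩ := List.mem_map.1 hv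
    rw [U.norm_map]
    exact h1 v' hv') (U y) (by simpa using hy)
  simpa using this

/-! ### Differentiating integrals over a fixed set -/

theorem dirD_congr {d : ℕ} {F G : Sp d → ℂ} {V : Set (Sp d)} (hV : IsOpen V) (h : EqOn F G V)
    (vs : List (Sp d)) : EqOn (dirD vs F) (dirD vs G) V := by
  induction vs with
  | nil => exact h
  | cons v vs ih =>
    intro y hy
    have : dirD vs F =ᶠ[𝓝 y] dirD vs G := by
      filter_upwards [hV.mem_nhds hy] with z hz using ih hz
    simp only [dirD, this.fderiv_eq]

theorem dirD_zero {d : ℕ} (vs : List (Sp d)) : dirD vs (fun _ => (0 : ℂ)) = fun _ => 0 := by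
  induction vs with
  | nil => rfl
  | cons v vs ih => simp [dirD, ih]

theorem contDiffOn_dirD {d N : ℕ} {F : Sp d → ℂ} {V : Set (Sp d)} (hV : IsOpen V)
    (vs : List (Sp d)) (hF : ContDiffOn ℝ (N + vs.length : ℕ) F V) :
    ContDiffOn ℝ N (dirD vs F) V := by
  induction vs generalizing N with
  | nil => exact hF
  | cons v vs ih =>
    have h1 : ContDiffOn ℝ (N + 1 : ℕ) (dirD vs F) V := ih (by
      have e : N + (v :: vs).length = N + 1 + vs.length := by simp; ring
      rwa [e] at hF)
    exact (h1.fderiv_of_isOpen hV (by norm_cast)).clm_apply contDiffOn_const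

/-- The integral is the convolution of g with the locally integrable indicator of T, so derivatives
fall on g. -/
theorem fderiv_setIntegral_comp_sub {d : ℕ} {g : Sp d → ℂ} (hg : ContDiff ℝ 1 g)
    (hs : HasCompactSupport g) {T : Set (Sp d)} (hT : MeasurableSet T) (v x : Sp d) :
    fderiv ℝ (fun x => ∫ y in T, g (x - y)) x v = ∫ y in T, fderiv ℝ g (x - y) v := by
  have hf : LocallyIntegrable (T.indicator fun _ => (1 : ℝ)) :=
    (locallyIntegrable_const (1 : ℝ)).indicator hT
  have h1 := (hs.hasFDerivAt_convolution_right (ContinuousLinearMap.lsmul ℝ ℝ) (μ := volume) hf hg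
    x).fderiv
  have e : ∀ G : Sp d → ℂ, ∀ x, (convolution (T.indicator fun _ => (1 : ℝ)) G
      (ContinuousLinearMap.lsmul ℝ ℝ) volume) x = ∫ y in T, G (x - y) := by
    intro G x
    rw [convolution_def, ← integral_indicator hT]
    refine integral_congr_ae (Eventually.of_forall fun y => ?_)
    by_cases hy : y ∈ T <;> simp [hy]
  have e2 : (convolution (T.indicator fun _ => (1 : ℝ)) g
      (ContinuousLinearMap.lsmul ℝ ℝ) volume) = fun x => ∫ y in T, g (x - y) := funext (e g)
  rw [e2] at h1
  rw [h1, convolution_precompR_apply _ hf (hs.fderiv (𝕜 := ℝ)) (hg.continuous_fderiv (by norm_num)),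
    e]

theorem contDiff_setIntegral_comp_sub {d N : ℕ} {g : Sp d → ℂ} (hg : ContDiff ℝ N g)
    (hs : HasCompactSupport g) {T : Set (Sp d)} (hT : MeasurableSet T) :
    ContDiff ℝ N fun x => ∫ y in T, g (x - y) := by
  have hf : LocallyIntegrable (T.indicator fun _ => (1 : ℝ)) :=
    (locallyIntegrable_const (1 : ℝ)).indicator hT
  have h := hs.contDiff_convolution_right (n := N) (ContinuousLinearMap.lsmul ℝ ℝ) (μ := volume)
    hf (by exact_mod_cast hg)
  have e : (convolution (T.indicator fun _ => (1 : ℝ)) g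
      (ContinuousLinearMap.lsmul ℝ ℝ) volume) = fun x => ∫ y in T, g (x - y) := by
    funext x
    rw [convolution_def, ← integral_indicator hT]
    refine integral_congr_ae (Eventually.of_forall fun y => ?_)
    by_cases hy : y ∈ T <;> simp [hy]
  rw [e] at h
  exact_mod_cast h

theorem dirD_setIntegral_comp_sub {d N : ℕ} {g : Sp d → ℂ} (hg : ContDiff ℝ N g)
    (hs : HasCompactSupport g) {T : Set (Sp d)} (hT : MeasurableSet T) (vs : List (Sp d))
    (hvs : vs.length ≤ N) : HasCompactSupport (dirD vs g) ∧
    dirD vs (fun x => ∫ y in T, g (x - y)) = fun x => ∫ y in T, dirD vs g (x - y) := by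
  induction vs with
  | nil => exact ⟨hs, rfl⟩
  | cons v vs ih =>
    have hlen : vs.length + 1 ≤ N := by simpa using hvs
    obtain ⟨h1, h2⟩ := ih (by omega)
    have h3 : ContDiff ℝ 1 (dirD vs g) := by
      rw [← contDiffOn_univ]
      exact contDiffOn_dirD (N := 1) isOpen_univ vs
        (hg.of_le (by rw [add_comm]; exact_mod_cast hlen)).contDiffOn
    refine ⟨h1.fderiv_apply (𝕜 := ℝ) v, ?_⟩
    funext x
    simp only [dirD]
    rw [h2]
    exact fderiv_setIntegral_comp_sub h3 h1 hT v x

theorem norm_multilinear_le_of_unit {n : ℕ} {d : ℕ}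
    (f : ContinuousMultilinearMap ℝ (fun _ : Fin n => Sp d) ℂ) {C : ℝ} (hC : 0 ≤ C)
    (h : ∀ v : Fin n → Sp d, (∀ i, ‖v i‖ ≤ 1) → ‖f v‖ ≤ C) : ‖f‖ ≤ C := by
  refine f.opNorm_le_bound hC fun v => ?_
  have e : v = fun i => ‖v i‖ • (‖v i‖⁻¹ • v i) := by
    funext i
    by_cases hv : v i = 0
    · simp [hv]
    · rw [smul_smul, mul_inv_cancel₀ (norm_ne_zero_iff.2 hv), one_smul]
  have h1 : f v = (∏ i, ‖v i‖) • f fun i => ‖v i‖⁻¹ • v i := by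
    conv_lhs => rw [e]
    exact f.map_smul_univ _ _
  rw [h1, norm_smul, Real.norm_of_nonneg (Finset.prod_nonneg fun _ _ => norm_nonneg _), mul_comm]
  refine mul_le_mul_of_nonneg_right (h _ fun i => ?_) (Finset.prod_nonneg fun _ _ => norm_nonneg _)
  rw [norm_smul, norm_inv, norm_norm]
  exact inv_mul_le_one

/-! ### Cutoffs of the kernel and the nearest boundary point -/

/-- The kernel `K` cut off at distance `M` by a smooth radial function. -/
def outerCut {d : ℕ} (M : ℝ) (K : Sp d → ℂ) (v : Sp d) : ℂ :=
  K v * ((Real.smoothTransition (2 - ‖v‖ ^ 2 / M ^ 2) : ℝ) : ℂ)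

/-- The function `F` cut off in a neighbourhood of the origin. -/
def innerCut {d : ℕ} (r : ℝ) (F : Sp d → ℂ) (v : Sp d) : ℂ :=
  F v * ((Real.smoothTransition (2 * ‖v‖ ^ 2 / r ^ 2 - 1) : ℝ) : ℂ)

theorem outerCut_eq {d : ℕ} {M : ℝ} (hM : 0 < M) (K : Sp d → ℂ) {v : Sp d} (hv : ‖v‖ ≤ M) :
    outerCut M K v = K v := by
  have : ‖v‖ ^ 2 / M ^ 2 ≤ 1 := by
    rw [div_le_one (by positivity)]
    gcongr
  rw [outerCut, Real.smoothTransition.one_of_one_le (by linarith), Complex.ofReal_one, mul_one]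

theorem outerCut_eq_zero {d : ℕ} {M : ℝ} (hM : 0 < M) (K : Sp d → ℂ) {v : Sp d}
    (hv : 2 * M ≤ ‖v‖) : outerCut M K v = 0 := by
  have : 4 ≤ ‖v‖ ^ 2 / M ^ 2 := by
    rw [le_div_iff₀ (by positivity)]
    nlinarith
  rw [outerCut, Real.smoothTransition.zero_of_nonpos (by linarith), Complex.ofReal_zero, mul_zero]

theorem innerCut_eq {d : ℕ} {r : ℝ} (hr : 0 < r) (F : Sp d → ℂ) {v : Sp d} (hv : r ≤ ‖v‖) :
    innerCut r F v = F v := by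
  have : 2 ≤ 2 * ‖v‖ ^ 2 / r ^ 2 := by
    rw [le_div_iff₀ (by positivity)]
    gcongr
  rw [innerCut, Real.smoothTransition.one_of_one_le (by linarith), Complex.ofReal_one, mul_one]

theorem innerCut_eq_zero {d : ℕ} {r : ℝ} (hr : 0 < r) (F : Sp d → ℂ) {v : Sp d}
    (hv : ‖v‖ ≤ r / 2) : innerCut r F v = 0 := by
  have : 2 * ‖v‖ ^ 2 / r ^ 2 ≤ 1 := by
    rw [div_le_one (by positivity)]
    nlinarith [norm_nonneg v]
  rw [innerCut, Real.smoothTransition.zero_of_nonpos (by linarith), Complex.ofReal_zero, mul_zero]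

theorem contDiffOn_outerCut {d N : ℕ} (M : ℝ) {K : Sp d → ℂ} (hK : ContDiffOn ℝ N K {0}ᶜ) :
    ContDiffOn ℝ N (outerCut M K) {0}ᶜ := by
  refine hK.mul (ContDiff.contDiffOn ?_)
  refine Complex.ofRealCLM.contDiff.comp (Real.smoothTransition.contDiff.comp ?_)
  exact contDiff_const.sub ((contDiff_norm_sq ℝ).div_const _)

theorem contDiff_innerCut {d N : ℕ} {r : ℝ} (hr : 0 < r) {F : Sp d → ℂ}
    (hF : ContDiffOn ℝ N F {0}ᶜ) : ContDiff ℝ N (innerCut r F) := by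
  rw [contDiff_iff_contDiffAt]
  intro y
  by_cases hy : y = 0
  · have : innerCut r F =ᶠ[𝓝 y] fun _ => 0 := by
      filter_upwards [Metric.ball_mem_nhds y (half_pos hr)] with z hz
      subst hy
      exact innerCut_eq_zero hr F (mem_ball_zero_iff.1 hz).le
    exact contDiffAt_const.congr_of_eventuallyEq this
  · refine (hF.contDiffAt (isOpen_compl_singleton.mem_nhds hy)).mul (ContDiff.contDiffAt ?_)
    refine Complex.ofRealCLM.contDiff.comp (Real.smoothTransition.contDiff.comp ?_)
    exact ((contDiff_const.mul (contDiff_norm_sq ℝ)).div_const _).sub contDiff_const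

theorem integrableOn_of_eq_zero {d : ℕ} {F : Sp d → ℂ} (hF : ContinuousOn F {0}ᶜ) {R : ℝ}
    (h0 : ∀ v, R < ‖v‖ → F v = 0) {c : ℝ} (hc : 0 < c) : IntegrableOn F {v | c ≤ ‖v‖} := by
  have hcl : IsClosed {v : Sp d | c ≤ ‖v‖} := isClosed_le continuous_const continuous_norm
  have hcomp : IsCompact ({v : Sp d | c ≤ ‖v‖} ∩ Metric.closedBall 0 R) :=
    (isCompact_closedBall 0 R).inter_left hcl
  have h1 : IntegrableOn F ({v : Sp d | c ≤ ‖v‖} ∩ Metric.closedBall 0 R) := by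
    refine (hF.mono fun v hv h => ?_).integrableOn_compact hcomp
    have h2 : c ≤ ‖v‖ := hv.1
    rw [mem_singleton_iff.1 h, norm_zero] at h2
    linarith
  refine h1.of_forall_sdiff_eq_zero hcl.measurableSet fun v hv => h0 v ?_
  by_contra hle
  exact hv.2 ⟨hv.1, mem_closedBall_zero_iff.2 (not_lt.1 hle)⟩

theorem exists_mem_frontier_ball_subset {m : ℕ} {D : Set (Sp (m + 1))} (hD : IsOpen D)
    (hb : Bornology.IsBounded D) {x : Sp (m + 1)} (hx : x ∈ D) :
    ∃ a ∈ frontier D, Metric.infDist x (frontier D) = ‖x - a‖ ∧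
      0 < Metric.infDist x (frontier D) ∧ Metric.ball x (Metric.infDist x (frontier D)) ⊆ D := by
  have hne : D ≠ univ := fun h => NormedSpace.unbounded_univ ℝ (Sp (m + 1)) (h ▸ hb)
  obtain ⟨a, ha, hda⟩ := exists_mem_frontier_infDist_compl_eq_dist hx hne
  have hsub : frontier D ⊆ Dᶜ := by
    rw [hD.frontier_eq]
    exact fun y hy => hy.2
  have e : Metric.infDist x (frontier D) = Metric.infDist x Dᶜ :=
    le_antisymm ((Metric.infDist_le_dist_of_mem ha).trans hda.ge)
      (Metric.infDist_le_infDist_of_subset hsub ⟨a, ha⟩)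
  have hball : Metric.ball x (Metric.infDist x Dᶜ) ⊆ D := by
    intro y hy
    by_contra hyD
    have := Metric.infDist_le_dist_of_mem (x := x) (show y ∈ Dᶜ from hyD)
    rw [Metric.mem_ball, dist_comm] at hy
    linarith
  refine ⟨a, ha, by rw [e, hda, dist_eq_norm], ?_, by rwa [e]⟩
  rw [e, hda]
  exact dist_pos.2 fun h => hsub ha (h ▸ hx)

/-! ### The restricted operator as an integral over the complement -/

section Representation

variable {m N : ℕ} {K : Sp (m + 1) → ℂ} {D : Set (Sp (m + 1))} {M : ℝ}

theorem MomentKernel.continuousOn_outerCut (hK : MomentKernel N 0 K) (M : ℝ) :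
    ContinuousOn (outerCut M K) {0}ᶜ :=
  (contDiffOn_outerCut M hK.contDiffOn).continuousOn

/-- The sharp truncation and the outer cutoff are both radial, so the integral is a radial factor
times the spherical mean of K, which is zero. -/
theorem MomentKernel.setIntegral_outerCut (hK : MomentKernel N 0 K) (M ε : ℝ) (x : Sp (m + 1)) :
    ∫ y in {y | ε < ‖y - x‖}, outerCut M K (x - y) = 0 := by
  have hm : MeasurableSet {y : Sp (m + 1) | ε < ‖y - x‖} :=
    (isOpen_lt continuous_const (by fun_prop)).measurableSet
  rw [← integral_indicator hm]
  have e : (fun y => {y : Sp (m + 1) | ε < ‖y - x‖}.indicator (fun y => outerCut M K (x - y)) y) =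
      fun y => (fun v => K v * (fun r : ℝ => if ε < r then
        ((Real.smoothTransition (2 - r ^ 2 / M ^ 2) : ℝ) : ℂ) else 0) ‖v‖) (x - y) := by
    funext y
    by_cases hy : ε < ‖y - x‖
    · rw [indicator_of_mem (by exact hy)]
      simp only [norm_sub_rev x y, if_pos hy, outerCut]
    · rw [indicator_of_notMem (by exact hy)]
      simp only [norm_sub_rev x y, if_neg hy, mul_zero]
  rw [e]
  refine (integral_sub_left_eq_self (μ := volume) (fun v => K v * (fun r : ℝ => if ε < r then
    ((Real.smoothTransition (2 - r ^ 2 / M ^ 2) : ℝ) : ℂ) else 0) ‖v‖) x).trans ?_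
  rw [integral_homog_mul_radial hK.isHomog_zero (fun r : ℝ => if ε < r then
    ((Real.smoothTransition (2 - r ^ 2 / M ^ 2) : ℝ) : ℂ) else 0), hK.sphereIntegral_eq_zero, zero_mul]

/-- The outer cutoff equals 1 on x − D, and the cut kernel has integral zero over {|y − x| > ε};
that set minus D is the whole complement once the ε-ball lies in D. The truncations are thus
constant for small ε. -/
theorem MomentKernel.truncatedIntegral_charFn (hK : MomentKernel N 0 K) (hD : IsOpen D)
    (hM : 0 < M) {x : Sp (m + 1)} {ρ ε : ℝ} (hε : 0 < ε) (hερ : ε < ρ)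
    (hball : Metric.ball x ρ ⊆ D) (hDM : ∀ y ∈ D, ‖x - y‖ ≤ M) :
    truncatedIntegral K (charFn D) ε x = -∫ y in Dᶜ, outerCut M K (x - y) := by
  set E : Set (Sp (m + 1)) := {y | ε < ‖y - x‖} with hE
  have hm : MeasurableSet E := (isOpen_lt continuous_const (by fun_prop)).measurableSet
  have hsd : E \ D = Dᶜ := by
    refine Subset.antisymm (fun y hy => hy.2) fun y hy => ⟨?_, hy⟩
    by_contra hle
    refine hy (hball ?_)
    rw [Metric.mem_ball, dist_eq_norm]
    exact (not_lt.1 hle).trans_lt hερ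
  have hint : IntegrableOn (fun y => outerCut M K (x - y)) E := by
    refine integrableOn_comp_sub_left (integrableOn_of_eq_zero (hK.continuousOn_outerCut M)
      (R := 2 * M) (fun v hv => outerCut_eq_zero hM K hv.le) hε) x hm fun z hz => ?_
    rw [norm_sub_rev]
    exact le_of_lt hz
  have h1 := integral_inter_add_sdiff hD.measurableSet hint
  rw [hK.setIntegral_outerCut, hsd] at h1
  rw [← eq_neg_iff_add_eq_zero.2 h1, truncatedIntegral, ← setIntegral_indicator hD.measurableSet]
  refine setIntegral_congr_fun hm fun y _ => ?_
  by_cases hy : y ∈ D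
  · simp [charFn, hy, outerCut_eq hM K (hDM y hy)]
  · simp [charFn, hy]

theorem MomentKernel.tendsto_truncatedIntegral_charFn (hK : MomentKernel N 0 K) (hD : IsOpen D)
    (hM : 0 < M) {x : Sp (m + 1)} {ρ : ℝ} (hρ : 0 < ρ)
    (hball : Metric.ball x ρ ⊆ D) (hDM : ∀ y ∈ D, ‖x - y‖ ≤ M) :
    Tendsto (fun ε : ℝ => truncatedIntegral K (charFn D) ε x) (𝓝[>] (0 : ℝ))
      (𝓝 (-∫ y in Dᶜ, outerCut M K (x - y))) := by
  refine tendsto_const_nhds.congr' ?_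
  filter_upwards [Ioo_mem_nhdsGT hρ] with ε hε
  exact (hK.truncatedIntegral_charFn hD hM hε.1 hε.2 hball hDM).symm

theorem MomentKernel.restrictedOperator_charFn (hK : MomentKernel N 0 K) (hD : IsOpen D)
    (hM : 0 < M) {x : Sp (m + 1)} (hx : x ∈ D) (hDM : ∀ y ∈ D, ‖x - y‖ ≤ M) :
    restrictedOperator K D (charFn D) x = -∫ y in Dᶜ, outerCut M K (x - y) := by
  obtain ⟨ρ, hρ, hball⟩ := Metric.isOpen_iff.1 hD x hx
  rw [restrictedOperator, indicator_of_mem hx, czOperator]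
  exact (hK.tendsto_truncatedIntegral_charFn hD hM hρ hball hDM).limUnder_eq

/-- Points of the complement stay at distance at least r from every z within r of x, so the inner
cutoff is inactive. The kernel becomes smooth and compactly supported, and convolution calculus
applies. -/
theorem MomentKernel.restrictedOperator_charFn_eventuallyEq (hK : MomentKernel N 0 K)
    (hD : IsOpen D) (hM : 0 < M) (hDM : ∀ x ∈ D, ∀ y ∈ D, ‖x - y‖ ≤ M) {x : Sp (m + 1)} {r : ℝ}
    (hr : 0 < r) (hball : Metric.ball x (2 * r) ⊆ D) :
    restrictedOperator K D (charFn D) =ᶠ[𝓝 x]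
      fun z => -∫ y in Dᶜ, innerCut r (outerCut M K) (z - y) := by
  filter_upwards [Metric.ball_mem_nhds x hr] with z hz
  have hz' := Metric.mem_ball.1 hz
  have hzD : z ∈ D := hball (Metric.mem_ball.2 (by linarith))
  rw [hK.restrictedOperator_charFn hD hM hzD (hDM z hzD)]
  congr 1
  refine setIntegral_congr_fun hD.measurableSet.compl fun y hy => ?_
  refine (innerCut_eq hr _ ?_).symm
  by_contra hlt
  refine hy (hball (Metric.mem_ball.2 ?_))
  have h1 := dist_triangle y z x
  rw [dist_comm y z, dist_eq_norm z y] at h1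
  linarith [not_le.1 hlt]

theorem hasCompactSupport_innerCut_outerCut (hM : 0 < M) (r : ℝ) :
    HasCompactSupport (innerCut r (outerCut M K)) := by
  refine HasCompactSupport.of_support_subset_isCompact (isCompact_closedBall 0 (2 * M))
    fun v hv => ?_
  by_contra h
  rw [mem_closedBall_zero_iff, not_le] at h
  exact hv (by rw [innerCut, outerCut_eq_zero hM K h.le, zero_mul])

theorem MomentKernel.contDiffAt_restrictedOperator_charFn (hK : MomentKernel N 0 K)
    (hD : IsOpen D) (hM : 0 < M) (hDM : ∀ x ∈ D, ∀ y ∈ D, ‖x - y‖ ≤ M) {x : Sp (m + 1)}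
    (hx : x ∈ D) : ContDiffAt ℝ N (restrictedOperator K D (charFn D)) x := by
  obtain ⟨ρ, hρ, hball⟩ := Metric.isOpen_iff.1 hD x hx
  have hr : 0 < ρ / 2 := half_pos hρ
  refine ContDiffAt.congr_of_eventuallyEq ?_ (hK.restrictedOperator_charFn_eventuallyEq hD hM hDM
    hr (by rwa [mul_div_cancel₀ _ (two_ne_zero' ℝ)]))
  exact (contDiff_setIntegral_comp_sub (contDiff_innerCut hr (contDiffOn_outerCut M hK.contDiffOn))
    (hasCompactSupport_innerCut_outerCut hM _) hD.measurableSet.compl).neg.contDiffAt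

theorem MomentKernel.iteratedFDeriv_restrictedOperator_charFn (hK : MomentKernel N 0 K)
    (hD : IsOpen D) (hM : 0 < M) (hDM : ∀ x ∈ D, ∀ y ∈ D, ‖x - y‖ ≤ M) {n : ℕ} (hn : n ≤ N)
    {x : Sp (m + 1)} (hx : x ∈ D) (v : Fin n → Sp (m + 1)) :
    iteratedFDeriv ℝ n (restrictedOperator K D (charFn D)) x v =
      -∫ y in Dᶜ, CZDomain.dirD (List.ofFn v) (outerCut M K) (x - y) := by
  obtain ⟨ρ, hρ, hball⟩ := Metric.isOpen_iff.1 hD x hx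
  have hr : 0 < ρ / 2 := half_pos hρ
  set g := innerCut (ρ / 2) (outerCut M K) with hg
  have hgc : ContDiff ℝ N g := contDiff_innerCut hr (contDiffOn_outerCut M hK.contDiffOn)
  have hgs : HasCompactSupport g := hasCompactSupport_innerCut_outerCut hM _
  have hlen : (List.ofFn v).length ≤ N := by simpa using hn
  have heq := hK.restrictedOperator_charFn_eventuallyEq hD hM hDM hr
    (by rwa [mul_div_cancel₀ _ (two_ne_zero' ℝ)])
  have hneg : iteratedFDeriv ℝ n (fun z => -∫ y in Dᶜ, g (z - y)) x =
      -iteratedFDeriv ℝ n (fun z => ∫ y in Dᶜ, g (z - y)) x := iteratedFDeriv_neg_apply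
  rw [(EventuallyEq.iteratedFDeriv ℝ heq n).eq_of_nhds, ← hg, hneg, neg_apply,
    iteratedFDeriv_apply_eq_dirD isOpen_univ
      (contDiff_setIntegral_comp_sub hgc hgs hD.measurableSet.compl).contDiffOn hn v (mem_univ x),
    (dirD_setIntegral_comp_sub hgc hgs hD.measurableSet.compl _ hlen).2]
  congr 1
  -- The inner cutoff is inactive on the open set |v| > ρ/2, which contains x − y, so it may also be
  -- dropped after differentiation.
  refine setIntegral_congr_fun hD.measurableSet.compl fun y hy => ?_
  have hV : IsOpen {v : Sp (m + 1) | ρ / 2 < ‖v‖} := isOpen_lt continuous_const continuous_norm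
  refine dirD_congr hV (fun v hv => innerCut_eq hr _ (le_of_lt hv)) _ ?_
  have h1 : ρ ≤ ‖x - y‖ := by
    by_contra hlt
    refine hy (hball (Metric.mem_ball.2 ?_))
    rw [dist_comm, dist_eq_norm]
    exact not_le.1 hlt
  show ρ / 2 < ‖x - y‖
  linarith

theorem dirD_outerCut_eq_zero (hM : 0 < M) (vs : List (Sp (m + 1))) {v : Sp (m + 1)}
    (hv : 2 * M < ‖v‖) : CZDomain.dirD vs (outerCut M K) v = 0 := by
  have hV : IsOpen {v : Sp (m + 1) | 2 * M < ‖v‖} := isOpen_lt continuous_const continuous_norm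
  rw [dirD_congr hV (fun v hv => outerCut_eq_zero hM K (le_of_lt hv)) vs hv, dirD_zero]

theorem MomentKernel.exists_norm_dirD_outerCut_le (hK : MomentKernel N 0 K) (hM : 0 < M) {n : ℕ}
    (hn : n ≤ N) (k : ℕ) {c : ℝ} (hc : 0 < c) :
    ∃ C, 0 ≤ C ∧ ∀ vs : List (Sp (m + 1)), vs.length = n → (∀ v ∈ vs, ‖v‖ ≤ 1) →
      ∀ v, c ≤ ‖v‖ → ‖CZDomain.dirD vs (outerCut M K) v‖ ≤ C * (‖v‖ ^ k)⁻¹ := by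
  have hU : IsOpen ({0}ᶜ : Set (Sp (m + 1))) := isOpen_compl_singleton
  have hF := contDiffOn_outerCut M hK.contDiffOn
  have hcont : ContinuousOn (iteratedFDeriv ℝ n (outerCut M K)) {0}ᶜ :=
    (hF.continuousOn_iteratedFDerivWithin (by exact_mod_cast hn) hU.uniqueDiffOn).congr
      fun y hy => (iteratedFDerivWithin_of_isOpen n hU hy).symm
  have hcomp : IsCompact ({v : Sp (m + 1) | c ≤ ‖v‖} ∩ Metric.closedBall 0 (2 * M)) :=
    (isCompact_closedBall 0 _).inter_left (isClosed_le continuous_const continuous_norm)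
  have hne : ∀ v : Sp (m + 1), c ≤ ‖v‖ → v ∈ ({0}ᶜ : Set (Sp (m + 1))) := fun v hv =>
    norm_pos_iff.1 (hc.trans_le hv)
  obtain ⟨B, hB⟩ := hcomp.exists_bound_of_continuousOn (hcont.mono fun v hv => hne v hv.1)
  refine ⟨max B 0 * (2 * M) ^ k, by positivity, fun vs hvs h1 v hv => ?_⟩
  have hv0 : 0 < ‖v‖ := hc.trans_le hv
  rcases le_or_gt ‖v‖ (2 * M) with h | h
  · have h2 := norm_dirD_le hU hF (by omega) h1 (hne v hv)
    rw [hvs] at h2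
    rw [← div_eq_mul_inv, le_div_iff₀ (by positivity)]
    exact mul_le_mul ((h2.trans (hB v ⟨hv, mem_closedBall_zero_iff.2 h⟩)).trans (le_max_left _ _))
      (by gcongr) (by positivity) (le_max_right _ _)
  · rw [dirD_outerCut_eq_zero hM vs h, norm_zero]
    positivity

theorem MomentKernel.integrableOn_dirD_outerCut (hK : MomentKernel N 0 K) (hM : 0 < M)
    {vs : List (Sp (m + 1))} (hvs : vs.length ≤ N) {c : ℝ} (hc : 0 < c) :
    IntegrableOn (CZDomain.dirD vs (outerCut M K)) {v | c ≤ ‖v‖} := by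
  refine integrableOn_of_eq_zero (R := 2 * M) ?_ (fun v hv => dirD_outerCut_eq_zero hM vs hv) hc
  refine (contDiffOn_dirD (N := 0) isOpen_compl_singleton vs
    ((contDiffOn_outerCut M hK.contDiffOn).of_le ?_)).continuousOn
  rw [zero_add]
  exact_mod_cast hvs

end Representation

/-! ### The estimate on the whole domain -/

theorem integral_comp_frame {m : ℕ} (D : Set (Sp (m + 1))) (hD : IsOpen D) (a x : Sp (m + 1))
    (U : Sp (m + 1) ≃ₗᵢ[ℝ] Sp (m + 1)) (f : Sp (m + 1) → ℂ) :
    ∫ y in Dᶜ, f (x - y) = ∫ z in {z | a + U z ∉ D}, f (U (U.symm (x - a) - z)) := by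
  have hm : MeasurableSet {z | a + U z ∉ D} := by
    have : Continuous fun z => a + U z := by fun_prop
    exact (hD.preimage this).measurableSet.compl
  rw [← integral_indicator hD.measurableSet.compl, ← integral_indicator hm,
    ← integral_add_left_eq_self (μ := volume) _ a,
    ← U.measurePreserving.integral_comp U.toHomeomorph.measurableEmbedding]
  refine integral_congr_ae (Eventually.of_forall fun z => ?_)
  have e : U (U.symm (x - a) - z) = x - (a + U z) := by
    rw [map_sub, U.apply_symm_apply]
    abel
  by_cases hz : a + U z ∈ D
  · simp [hz]
  · have h1 : a + U z ∈ Dᶜ := hz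
    have h2 : z ∈ {z | a + U z ∉ D} := hz
    simp only [indicator_of_mem h1, indicator_of_mem h2, e]

theorem exists_norm_compl_integral_le {m n : ℕ} (hn : 1 < n) {ω : ℝ → ℝ}
    (hω : IsGrowthFunction n ω) {D : Set (Sp (m + 1))} (hD : IsCOmegaDomain n ω D)
    {K : Sp (m + 1) → ℂ} (hK : MomentKernel (2 * n - 1) 0 K) :
    ∃ M C : ℝ, 0 < M ∧ 0 ≤ C ∧ (∀ x ∈ D, ∀ y ∈ D, ‖x - y‖ ≤ M) ∧
      ∀ vs : List (Sp (m + 1)), vs.length = n → (∀ v ∈ vs, ‖v‖ ≤ 1) → ∀ x ∈ D,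
      ‖∫ y in Dᶜ, dirD vs (outerCut M K) (x - y)‖ ≤
        C * (ω (Metric.infDist x (frontier D)) / Metric.infDist x (frontier D) ^ (n + 1)) := by
  obtain ⟨r₀, r₁, B, CA, hr₀, hr₀1, hr, hB, hCA, hframe⟩ := hD.exists_boundaryFrame hn hω
  obtain ⟨R, hR⟩ := hD.isBounded.subset_closedBall (0 : Sp (m + 1))
  -- The first term bounds the diameter of D; the others keep the cutoff inactive on the frame
  -- window seen from w.
  set M : ℝ := 2 * |R| + 2 * r₀ + r₁ with hM
  have hr₁ : 0 < r₁ := hr₀.trans_le hr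
  have hM0 : 0 < M := by positivity
  have hsub : ∀ x ∈ D, ∀ y ∈ closure D, ‖x - y‖ ≤ 2 * |R| := by
    intro x hx y hy
    have h1 := mem_closedBall_zero_iff.1 (hR hx)
    have h2 := mem_closedBall_zero_iff.1 (closure_minimal hR Metric.isClosed_closedBall hy)
    have h3 := norm_sub_le x y
    linarith [le_abs_self R]
  obtain ⟨q, hq, hq1, Cω, hCω, hωq⟩ := hω.exists_le_rpow
  have hq0 : 0 ≤ q := (Nat.cast_nonneg n).trans hq.le
  obtain ⟨CW, hCW, hW⟩ := hω.exists_rpow_le hCω hM0 hωq hq0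
  obtain ⟨CK, hCK, hKb⟩ := hK.exists_kernelBound
  have hnN : n ≤ 2 * n - 1 := by omega
  have hc4 : 0 < r₀ / 4 := by positivity
  obtain ⟨Cφ, hCφ, hφ⟩ := hK.exists_norm_dirD_outerCut_le hM0 hnN (m + 2) hc4
  obtain ⟨C, hC, hloc⟩ := exists_norm_compl_integral_frame_le (m := m) hn hq1 hr₀ hr₀1 hr hB hCA
    hCW.le hCK.le hCω.le hCφ
  set I : ℝ := ∫ v in {v : Sp (m + 1) | r₀ / 4 ≤ ‖v‖}, (‖v‖ ^ (m + 2))⁻¹ with hI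
  have hI0 : 0 ≤ I := integral_nonneg fun y => by positivity
  have hp : 0 < M ^ (n + 1 - q) := by positivity
  refine ⟨M, C + Cφ * I * CW * M ^ (n + 1 - q), hM0,
    add_nonneg hC (mul_nonneg (mul_nonneg (mul_nonneg hCφ hI0) hCW.le) hp.le),
    fun x hx y hy => (hsub x hx y (subset_closure hy)).trans (by linarith), ?_⟩
  intro vs hvs hvs1 x hx
  obtain ⟨a, ha, hρa, hρ, hball⟩ := exists_mem_frontier_ball_subset hD.isOpen hD.isBounded hx
  set ρ := Metric.infDist x (frontier D) with hρd
  have hρM : ρ ≤ M := by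
    rw [hρa]
    exact (hsub x hx a (frontier_subset_closure ha)).trans (by linarith)
  have hW1 := hW ρ hρ hρM
  set W : ℝ := ω ρ * ρ ^ (-q) with hWd
  have hωρ := hω.pos hρ
  have hW0 : 0 < W := by positivity
  -- With W = ω(ρ)ρ^(−q), the frame estimate has the required form.
  have e : ω ρ / ρ ^ (n + 1) = W * ρ ^ (q - n - 1) := by
    rw [hWd, mul_assoc, ← Real.rpow_add hρ, div_eq_mul_inv, ← Real.rpow_natCast, ← Real.rpow_neg hρ.le]
    congr 2
    push_cast
    ring
  rw [e]
  have hdist : ∀ y ∈ Dᶜ, ρ ≤ ‖x - y‖ := by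
    intro y hy
    by_contra hlt
    refine hy (hball ?_)
    rw [Metric.mem_ball, dist_comm, dist_eq_norm]
    exact not_le.1 hlt
  have hP : 0 < ρ ^ (q - n - 1) := by positivity
  have hωW : ∀ t, 0 ≤ t → ω t ≤ Cω * W * (t + ρ) ^ q := fun t ht => hωq t ρ ht hρ
  have hWP : 0 ≤ W * ρ ^ (q - n - 1) := (mul_pos hW0 hP).le
  have hfar : 0 ≤ Cφ * I * CW * M ^ (n + 1 - q) :=
    mul_nonneg (mul_nonneg (mul_nonneg hCφ hI0) hCW.le) hp.le
  clear_value ρ W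
  -- Near the boundary the frame estimate applies. Away from it the integral is bounded, and both W
  -- and ρ^(q − n − 1) are bounded below for ρ ≤ M.
  rcases le_or_gt ρ (r₀ / 4) with hsmall | hlarge
  · obtain ⟨U, A, L, c, hF⟩ := hframe a ha
    have hUU : (U ∘ U.symm : Sp (m + 1) → Sp (m + 1)) = id := by
      funext z
      simp
    have hvs' : ∀ v ∈ vs.map U.symm, ‖v‖ ≤ 1 := by
      intro v hv
      obtain ⟨v', hv', rfl⟩ := List.mem_map.1 hv
      rw [U.symm.norm_map]
      exact hvs1 v' hv'
    have hball' : ∀ z, ‖z - U.symm (x - a)‖ < ρ → a + U z ∈ D := by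
      intro z hz
      refine hball ?_
      rw [Metric.mem_ball, dist_eq_norm]
      have : a + U z - x = U (z - U.symm (x - a)) := by
        rw [map_sub, U.apply_symm_apply]
        abel
      rwa [this, U.norm_map]
    have hcut : ∀ v, ‖v‖ < 2 * r₀ + r₁ → dirD vs (outerCut M K) (U v) =
        dirD (vs.map U.symm) (fun z => K (U z)) v := by
      intro v hv
      rw [dirD_comp_isometry, List.map_map, hUU, List.map_id]
      refine dirD_congr Metric.isOpen_ball (fun y hy => outerCut_eq hM0 K
        (mem_ball_zero_iff.1 hy).le) vs ?_
      rw [mem_ball_zero_iff, U.norm_map]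
      linarith [abs_nonneg R]
    have hφ' : ∀ v, r₀ / 2 ≤ ‖v‖ → ‖dirD vs (outerCut M K) (U v)‖ ≤ Cφ * (‖v‖ ^ (m + 2))⁻¹ := by
      intro v hv
      have := hφ vs hvs hvs1 (U v) (by rw [U.norm_map]; linarith)
      rwa [U.norm_map] at this
    have hint : IntegrableOn (fun v => dirD vs (outerCut M K) (U v)) {v | ρ ≤ ‖v‖} := by
      have h1 := hK.integrableOn_dirD_outerCut hM0 (vs := vs) (by omega) hρ
      have h2 := (U.measurePreserving.integrableOn_comp_preimage
        U.toHomeomorph.measurableEmbedding).2 h1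
      have h3 : U ⁻¹' {v | ρ ≤ ‖v‖} = {v | ρ ≤ ‖v‖} := by
        ext v
        simp
      rw [h3] at h2
      exact h2
    have key := hloc ω D a U (fun z => K (U z)) (fun v => dirD vs (outerCut M K) (U v)) A L c
      (U.symm (x - a)) ρ W (vs.map U.symm) hD.isOpen hF (hK.comp_isometry U)
      (hKb.comp_isometry U) (by rw [List.length_map, hvs]) hvs' hρ hsmall hW1
      hωW (by rw [U.symm.norm_map, hρa]) hball' hcut hφ' hint
    rw [integral_comp_frame D hD.isOpen a x U]
    refine key.trans ?_
    rw [mul_assoc]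
    exact mul_le_mul_of_nonneg_right (by linarith) hWP
  · have h1 := norm_setIntegral_far_le (d := m + 1) (k := m + 2) (by omega) hc4 hCφ
      (hφ vs hvs hvs1) x hD.isOpen.measurableSet.compl
      fun z hz => hlarge.le.trans (hdist z hz)
    refine h1.trans ?_
    have h2 : 1 ≤ M ^ (n + 1 - q) * ρ ^ (q - n - 1) := by
      have e2 : q - n - 1 = -(n + 1 - q) := by ring
      rw [e2, Real.rpow_neg hρ.le, ← div_eq_mul_inv, one_le_div (by positivity)]
      exact Real.rpow_le_rpow hρ.le hρM (by linarith)
    have h3 : 1 ≤ CW * W * (M ^ (n + 1 - q) * ρ ^ (q - n - 1)) := one_le_mul_of_one_le_of_one_le hW1 h2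
    calc Cφ * I ≤ Cφ * I * (CW * W * (M ^ (n + 1 - q) * ρ ^ (q - n - 1))) :=
          le_mul_of_one_le_right (mul_nonneg hCφ hI0) h3
      _ = Cφ * I * CW * M ^ (n + 1 - q) * (W * ρ ^ (q - n - 1)) := by ring
      _ ≤ _ := mul_le_mul_of_nonneg_right (by linarith) hWP

end CZDomain

end

theorem theorem1p2 (m n : ℕ) (hn : 1 < n) (ω : ℝ → ℝ) (hω : CZDomain.IsGrowthFunction n ω)
    (D : Set (EuclideanSpace ℝ (Fin (m + 1)))) (hD : CZDomain.IsCOmegaDomain n ω D)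
    (K : EuclideanSpace ℝ (Fin (m + 1)) → ℂ) (hK : CZDomain.IsCZKernel (2 * n - 1) K)
    (hKeven : ∀ x, K (-x) = K x) :
    (∀ x ∈ D, Tendsto (fun ε : ℝ => CZDomain.truncatedIntegral K (CZDomain.charFn D) ε x)
      (𝓝[>] (0 : ℝ)) (𝓝 (CZDomain.restrictedOperator K D (CZDomain.charFn D) x))) ∧
    ContDiffOn ℝ n (CZDomain.restrictedOperator K D (CZDomain.charFn D)) D ∧
    ∃ C : ℝ, 0 < C ∧ ∀ x ∈ D,
      ‖iteratedFDeriv ℝ n (CZDomain.restrictedOperator K D (CZDomain.charFn D)) x‖ ≤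
        C * (ω (Metric.infDist x (frontier D)) / Metric.infDist x (frontier D) ^ (n + 1)) := by
  have hKm := hK.momentKernel hKeven
  have hnN : n ≤ 2 * n - 1 := by omega
  obtain ⟨M, C, hM, hC, hDM, hbound⟩ := CZDomain.exists_norm_compl_integral_le hn hω hD hKm
  -- C may be 0, and the constant must be positive.
  refine ⟨fun x hx => ?_, fun x hx => ?_, C + 1, by positivity, fun x hx => ?_⟩
  · obtain ⟨ρ, hρ, hball⟩ := Metric.isOpen_iff.1 hD.isOpen x hx
    rw [hKm.restrictedOperator_charFn hD.isOpen hM hx (hDM x hx)]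
    exact hKm.tendsto_truncatedIntegral_charFn hD.isOpen hM hρ hball (hDM x hx)
  · exact ((hKm.contDiffAt_restrictedOperator_charFn hD.isOpen hM hDM hx).of_le
      (by exact_mod_cast hnN)).contDiffWithinAt
  · have h0 : 0 ≤ ω (Metric.infDist x (frontier D)) / Metric.infDist x (frontier D) ^ (n + 1) :=
      div_nonneg (hω.nonneg Metric.infDist_nonneg) (pow_nonneg Metric.infDist_nonneg _)
    refine le_trans (CZDomain.norm_multilinear_le_of_unit _ (mul_nonneg hC h0) fun v hv => ?_)
      (mul_le_mul_of_nonneg_right (by linarith) h0)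
    rw [hKm.iteratedFDeriv_restrictedOperator_charFn hD.isOpen hM hDM hnN hx, norm_neg]
    refine hbound _ (by simp) (fun u hu => ?_) x hx
    obtain ⟨i, rfl⟩ := List.mem_ofFn.1 hu
    exact hv i
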